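/- \textbf{Setting.} Let $\mathcal A$ be a unital $C^*$-algebra with state space $\mathcal S\subset\mathcal A^*$, and let $\mathfrak M$ be a von Neumann algebra of operators on a complex Hilbert space. \emph{Conditional expectations.} For a normal state $\Phi$ on a von Neumann algebra $\mathfrak A$ with von Neumann subalgebra $\mathfrak A_0$, a (version of the) conditional expectation $\Phi(\,\cdot\,|\mathfrak A_0):\mathfrak A\to\mathfrak A_0$ is a linear map $E$ with $E(I)=I$, $E(X^*X)\ge0$, $E(X^*)=E(X)^*$, $E(XYZ)=XE(Y)Z$ for $Y\in\mathfrak A$, $X,Z\in\mathfrak A_0$, and $\Phi(E(X))=\Phi(X)$. Identities between a conditional expectation with respect to $\Phi$ and an operator are understood for every version, up to $\Phi$-indistinguishability: $P$ and $Q$ are identified if $\Phi(|P-Q|^2)=0$. A \emph{quantum Markov filtering model} consists of the following. \begin{itemize} \item A one-parameter semigroup $\{P_t\}_{t\ge0}$ of contractive completely positive linear maps $\mathcal A\to\mathcal A$ with $P_0=\mathrm{id}$ and $P_t[I]=I$. \item An increasing family $\{\mathfrak M_{t]}\}_{t\ge0}$ of von Neumann subalgebras of $\mathfrak M$ with $(\bigcup_t\mathfrak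 M_{t]})''=\mathfrak M$. \item Normal states $\{\Phi_\rho:\rho\in\mathcal S\}$ on $\mathfrak M$ such that the conditional expectations $\Phi_\rho(\,\cdot\,|\mathfrak M_{t]}):\mathfrak M\to\mathfrak M_{t]}$ exist for all $t\ge0$, $\rho\in\mathcal S$. \item Unital injective $*$-homomorphisms $j_t:\mathcal A\to\mathfrak M_{t]}$, $t\ge0$, with $j_0(\mathcal A)''=\mathfrak M_{0]}$, such that $(\mathfrak M_{0]},j_0)$ is the enveloping von Neumann algebra $\mathcal A^{**}$ of $\mathcal A$, with $\Phi_\rho(j_0(X))=\rho(X)$, and with the Markov property $\Phi_\rho(j_{t+s}(X)|\mathfrak M_{s]})=j_s(P_t[X])$ for all $s,t\ge0$, $X\in\mathcal A$, $\rho\in\mathcal S$. \item Self-adjoint (possibly unbounded) operators $Y_t^k$, $t\ge0$, $k=1,\dots,n$, affiliated to $\mathfrak M_{t]}$, with $Y_0^k=0$. Let $\mathfrak Y_{t]}$ be the von Neumann algebra generated by $\{Y_s^k:s\le t,\ 1\le k\le n\}$ and $\mathfrak Y=(\bigcup_t\mathfrak Y_{t]})''$. It is assumed that $\mathfrak Y_{t]}$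 is commutative and $j_t(\mathcal A)\subset\mathfrak Y_{t]}'$ for all $t\ge0$. \item (Feller-type assumption) For all $m$, all $t_1,\dots,t_m>0$, all components $k_1,\dots,k_m\in\{1,\dots,n\}$ and all bounded continuous $f_1,\dots,f_m:\mathbb R\to\mathbb R$ there is $Z\in\mathcal A$, independent of $\rho$ and $s$, with $$\Phi_\rho\big(f_1(Y^{k_1}_{t_1})\cdots f_m(Y^{k_m}_{t_m})\big|\mathfrak M_{0]}\big)=j_0(Z),\qquad \Phi_\rho\big(f_1(Y^{k_1}_{s+t_1}-Y^{k_1}_s)\cdots f_m(Y^{k_m}_{s+t_m}-Y^{k_m}_s)\big|\mathfrak M_{s]}\big)=j_s(Z)$$ for all $s\ge0$, $\rho\in\mathcal S$. (Differences denote closures.) \end{itemize} The \emph{filter} with initial state $\rho$ is $\pi^\rho_t(X)=\Phi_\rho(j_t(X)|\mathfrak Y_{t]})$, where $\Phi_\rho(\,\cdot\,|\mathfrak Y_{t]})$ is a conditional expectation from $\mathfrak M\cap\mathfrak Y_{t]}'$ onto $\mathfrak Y_{t]}$. The model is \emph{observable} if there are no $\rho_1\ne\rho_2$ in $\mathcal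 S$ with $\Phi_{\rho_1}(Y)=\Phi_{\rho_2}(Y)$ for every $Y\in\mathfrak Y$. \textbf{Theorem.} Suppose the model is observable. Then the filters $\pi^\rho$ exist for every $\rho\in\mathcal S$. Moreover, let $\rho_1,\rho_2\in\mathcal S$ be such that the law of the observations under $\Phi_{\rho_1}$ is absolutely continuous with respect to that under $\Phi_{\rho_2}$, i.e. every projection $P\in\mathfrak Y$ with $\Phi_{\rho_2}(P)=0$ satisfies $\Phi_{\rho_1}(P)=0$. Then, for any versions of the filters, $$\Phi_{\rho_1}\big(|\pi^{\rho_1}_t(X)-\pi^{\rho_2}_t(X)|\big)\to0\quad\text{as }t\to\infty,\qquad\text{for every }X\in\mathcal A.$$ -/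

import Mathlib

open scoped NNReal ComplexOrder CStarAlgebra BoundedContinuousFunction InnerProductSpace
open Filter Topology

/-! ### States, normal states, and conditional expectations -/

/-- The state space of a unital C*-algebra: the positive unital elements of the dual. -/
def stateSpace (A : Type*) [CStarAlgebra A] : Set (StrongDual ℂ A) :=
  {ρ | (∀ a : A, 0 ≤ ρ (star a * a)) ∧ ρ 1 = 1}

section Operators

variable {H : Type*} [NormedAddCommGroup H] [InnerProductSpace ℂ H] [CompleteSpace H]

/-- `Φ` restricts to a normal state on the von Neumann algebra `N`: it is positive and unital on
`N`, and on `N` it is σ-weakly continuous, that is of the form `X ↦ ∑ₙ ⟪yₙ, X xₙ⟫` with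
`∑ₙ ‖xₙ‖² < ∞` and `∑ₙ ‖yₙ‖² < ∞`.
(Functionals on `N` are represented by linear functionals on all bounded operators; the values
outside `N` are irrelevant.) -/
structure IsNormalState (N : VonNeumannAlgebra H) (Φ : (H →L[ℂ] H) →ₗ[ℂ] ℂ) : Prop where
  nonneg : ∀ X ∈ N, 0 ≤ Φ (star X * X)
  map_one : Φ 1 = 1
  normal : ∃ x y : ℕ → H, Summable (fun n => ‖x n‖ ^ 2) ∧ Summable (fun n => ‖y n‖ ^ 2) ∧
    ∀ X ∈ N, HasSum (fun n => ⟪y n, X (x n)⟫_ℂ) (Φ X)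

/-- `X` and `Y` are `Φ`-indistinguishable: `Φ(|X - Y|²) = 0`. -/
def Indistinguishable (Φ : (H →L[ℂ] H) →ₗ[ℂ] ℂ) (X Y : H →L[ℂ] H) : Prop :=
  Φ (star (X - Y) * (X - Y)) = 0

/-- `E` is (a version of) the conditional expectation from the algebra `𝔄` onto its subalgebra
`𝔄₀` with respect to the state `Φ`.  (The linear map `E : 𝔄 → 𝔄₀` is represented by a linear map
on all bounded operators; its values outside `𝔄` are irrelevant.) -/
structure IsCondExp (Φ : (H →L[ℂ] H) →ₗ[ℂ] ℂ) (𝔄 𝔄₀ : Set (H →L[ℂ] H))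
    (E : (H →L[ℂ] H) →ₗ[ℂ] (H →L[ℂ] H)) : Prop where
  mapsTo : ∀ X ∈ 𝔄, E X ∈ 𝔄₀
  map_one : E 1 = 1
  nonneg : ∀ X ∈ 𝔄, 0 ≤ E (star X * X)
  map_star : ∀ X ∈ 𝔄, E (star X) = star (E X)
  map_mul_mul : ∀ X ∈ 𝔄₀, ∀ Y ∈ 𝔄, ∀ Z ∈ 𝔄₀, E (X * Y * Z) = X * E Y * Z
  state_apply : ∀ X ∈ 𝔄, Φ (E X) = Φ X

/-- The von Neumann algebra `S''` generated by a set `S` of bounded operators (the bicommutant of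
`S ∪ S*`). -/
noncomputable def generatedVNA (S : Set (H →L[ℂ] H)) : VonNeumannAlgebra H where
  toStarSubalgebra :=
    StarSubalgebra.centralizer ℂ (StarSubalgebra.centralizer ℂ S : Set (H →L[ℂ] H))
  centralizer_centralizer' := by
    simp

/-! ### Unbounded self-adjoint operators

Unbounded operators are Mathlib's `LinearPMap`s `H →ₗ.[ℂ] H`, and `IsSelfAdjoint` is Mathlib's
notion (equality with the adjoint, including the domain; it forces a dense domain). -/

/-- The bounded operator `X` commutes with the unbounded operator `T`: `X T ⊆ T X`. -/
def CommutesWithUnbounded (X : H →L[ℂ] H) (T : H →ₗ.[ℂ] H) : Prop :=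
  ∀ v : T.domain, ∃ h : X v ∈ T.domain, T ⟨X v, h⟩ = X (T v)

/-- The unbounded operator `T` is affiliated to the von Neumann algebra `N`: it commutes with
every element of the commutant `N'`. -/
def IsAffiliated (T : H →ₗ.[ℂ] H) (N : VonNeumannAlgebra H) : Prop :=
  ∀ X ∈ N.commutant, CommutesWithUnbounded X T

/-- The von Neumann algebra generated by a set `𝒯` of self-adjoint (possibly unbounded) operators:
the commutant of the set of all bounded operators which, together with their adjoints, commute
with every `T ∈ 𝒯`.  It is the smallest von Neumann algebra to which all `T ∈ 𝒯` are
affiliated. -/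
noncomputable def generatedVNAOfUnbounded (𝒯 : Set (H →ₗ.[ℂ] H)) : VonNeumannAlgebra H where
  toStarSubalgebra := StarSubalgebra.centralizer ℂ
    {X : H →L[ℂ] H | ∀ T ∈ 𝒯, CommutesWithUnbounded X T ∧ CommutesWithUnbounded (star X) T}
  centralizer_centralizer' := by
    simp

/-- `φ` is the bounded continuous functional calculus `f ↦ f(T)` of the self-adjoint operator `T`:
a unital `*`-homomorphism on the bounded continuous functions on `ℝ` such that `T f(T) = g(T)`
whenever `g(x) = x f(x)`, both `f` and `g` being bounded.  For self-adjoint `T` there is exactly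
one such `φ`, namely `f ↦ ∫ f dE` where `E` is the spectral measure of `T`. -/
def IsBoundedFunctionalCalculus (T : H →ₗ.[ℂ] H) (φ : (ℝ →ᵇ ℂ) →⋆ₐ[ℂ] (H →L[ℂ] H)) : Prop :=
  ∀ f g : ℝ →ᵇ ℂ, (∀ x : ℝ, g x = x * f x) →
    ∀ v : H, ∃ h : φ f v ∈ T.domain, T ⟨φ f v, h⟩ = φ g v

/-- A real bounded continuous function viewed as a complex one. -/
noncomputable def toComplexBCF (f : ℝ →ᵇ ℝ) : ℝ →ᵇ ℂ :=
  BoundedContinuousFunction.ofNormedAddCommGroup (fun x => (f x : ℂ))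
    (Complex.continuous_ofReal.comp f.continuous) ‖f‖
    (fun x => by simpa using f.norm_coe_le_norm x)

open scoped Classical in
/-- The bounded operator `f(T)`, for a self-adjoint operator `T` and a bounded continuous function
`f : ℝ → ℝ`. (The junk value `0` is never taken for self-adjoint `T`.) -/
noncomputable def boundedFunction (T : H →ₗ.[ℂ] H) (f : ℝ →ᵇ ℝ) : H →L[ℂ] H :=
  if h : ∃ φ, IsBoundedFunctionalCalculus T φ then h.choose (toComplexBCF f) else 0

/-- `M₀`, with the embedding `j` of the C*-algebra `A`, is the enveloping von Neumann algebra
(the bidual `A**` with its canonical embedding): `j` is injective, `M₀` is generated by `j(A)`,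
and every state of `A` extends along `j` to a normal state on `M₀`. -/
structure IsEnvelopingVNA {A : Type*} [CStarAlgebra A] (M₀ : VonNeumannAlgebra H)
    (j : A →⋆ₐ[ℂ] (H →L[ℂ] H)) : Prop where
  injective : Function.Injective j
  generates : generatedVNA (Set.range j) = M₀
  extends_state : ∀ ρ ∈ stateSpace A, ∃ Ψ : (H →L[ℂ] H) →ₗ[ℂ] ℂ,
    IsNormalState M₀ Ψ ∧ ∀ a, Ψ (j a) = ρ a

end Operators

/-! ### The filtering model -/

/-- The data of a quantum filtering model, with initial system `A`, Hilbert space `H`, and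
`n`-dimensional observations. -/
structure FilteringData (A H : Type*) [CStarAlgebra A] [PartialOrder A] [StarOrderedRing A]
    [NormedAddCommGroup H] [InnerProductSpace ℂ H] [CompleteSpace H] (n : ℕ) where
  /-- the semigroup of completely positive maps on the initial system -/
  P : ℝ≥0 → (A →CP A)
  /-- the universal algebra -/
  M : VonNeumannAlgebra H
  /-- the filtration `𝔐_{t]}` -/
  Mt : ℝ≥0 → VonNeumannAlgebra H
  /-- the normal states `Φ_ρ` on `M`, indexed by the states of `A` -/
  Φ : stateSpace A → (H →L[ℂ] H) →ₗ[ℂ] ℂ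
  /-- the quantum Markov process -/
  j : ℝ≥0 → A →⋆ₐ[ℂ] (H →L[ℂ] H)
  /-- the observation process -/
  Y : ℝ≥0 → Fin n → (H →ₗ.[ℂ] H)

namespace FilteringData

variable {A H : Type*} [CStarAlgebra A] [PartialOrder A] [StarOrderedRing A]
  [NormedAddCommGroup H] [InnerProductSpace ℂ H] [CompleteSpace H] {n : ℕ}

/-- The observation algebra `𝔜_{t]}`, generated by the `Y_s^k` with `s ≤ t`. -/
noncomputable def Yt (D : FilteringData A H n) (t : ℝ≥0) : VonNeumannAlgebra H :=
  generatedVNAOfUnbounded {T | ∃ s ≤ t, ∃ k, T = D.Y s k}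

/-- The observation algebra `𝔜 = (⋃ₜ 𝔜_{t]})''`. -/
noncomputable def Yinf (D : FilteringData A H n) : VonNeumannAlgebra H :=
  generatedVNA (⋃ t, (D.Yt t : Set (H →L[ℂ] H)))

/-- The self-adjoint operator `Y_{s+t}^k - Y_s^k`, i.e. the closure of the difference on the
intersection of the domains. -/
noncomputable def increment (D : FilteringData A H n) (s t : ℝ≥0) (k : Fin n) : H →ₗ.[ℂ] H :=
  (D.Y (s + t) k - D.Y s k).closure

/-- `E` is a version of the conditional expectation `Φ_ρ( · | 𝔐_{t]}) : 𝔐 → 𝔐_{t]}`. -/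
def IsCondExpM (D : FilteringData A H n) (ρ : stateSpace A) (t : ℝ≥0)
    (E : (H →L[ℂ] H) →ₗ[ℂ] (H →L[ℂ] H)) : Prop :=
  IsCondExp (D.Φ ρ) (D.M : Set (H →L[ℂ] H)) (D.Mt t : Set (H →L[ℂ] H)) E

/-- `E` is a version of the conditional expectation `Φ_ρ( · | 𝔜_{t]})`, which is defined on the
relative commutant of `𝔜_{t]}` in `𝔐`. -/
def IsCondExpY (D : FilteringData A H n) (ρ : stateSpace A) (t : ℝ≥0)
    (E : (H →L[ℂ] H) →ₗ[ℂ] (H →L[ℂ] H)) : Prop :=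
  IsCondExp (D.Φ ρ) ((D.M : Set (H →L[ℂ] H)) ∩ ((D.Yt t).commutant : Set (H →L[ℂ] H)))
    (D.Yt t : Set (H →L[ℂ] H)) E

/-- `π` is (a version of) the filter with initial state `ρ`:
`π_t(X) = Φ_ρ(j_t(X) | 𝔜_{t]})`. -/
def IsFilter (D : FilteringData A H n) (ρ : stateSpace A) (π : ℝ≥0 → A → (H →L[ℂ] H)) : Prop :=
  ∀ t, ∃ E, D.IsCondExpY ρ t E ∧ ∀ X, π t X = E (D.j t X)

/-- The standing assumptions on a quantum filtering model.  Identities involving conditional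
expectations hold for every version, up to indistinguishability. -/
structure IsModel (D : FilteringData A H n) : Prop where
  -- The semigroup.
  P_zero : ∀ X, D.P 0 X = X
  P_add : ∀ s t X, D.P (s + t) X = D.P s (D.P t X)
  P_contractive : ∀ t X, ‖D.P t X‖ ≤ ‖X‖
  P_one : ∀ t, D.P t 1 = 1
  -- The filtration.
  Mt_le : ∀ t, D.Mt t ≤ D.M
  Mt_mono : Monotone D.Mt
  Mt_generates : generatedVNA (⋃ t, (D.Mt t : Set (H →L[ℂ] H))) = D.M
  -- The zero-time algebra is the enveloping algebra of `A`, generated by `j₀(A)`.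
  enveloping : IsEnvelopingVNA (D.Mt 0) (D.j 0)
  -- The states, and existence of the conditional expectations onto the filtration.
  normalState : ∀ ρ, IsNormalState D.M (D.Φ ρ)
  exists_condExp : ∀ ρ t, ∃ E, D.IsCondExpM ρ t E
  -- The quantum Markov process.
  j_mem : ∀ t X, D.j t X ∈ D.Mt t
  j_injective : ∀ t, Function.Injective (D.j t)
  markov : ∀ (t s : ℝ≥0) (X : A) (ρ : stateSpace A) E, D.IsCondExpM ρ s E →
    Indistinguishable (D.Φ ρ) (E (D.j (t + s) X)) (D.j s (D.P t X))
  initial : ∀ (X : A) (ρ : stateSpace A), D.Φ ρ (D.j 0 X) = (ρ : StrongDual ℂ A) X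
  -- The observations.
  Y_selfAdjoint : ∀ t k, IsSelfAdjoint (D.Y t k)
  Y_affiliated : ∀ t k, IsAffiliated (D.Y t k) (D.Mt t)
  Y_zero : ∀ k, D.Y 0 k = 0
  selfNondemolition : ∀ t, ∀ X ∈ D.Yt t, ∀ X' ∈ D.Yt t, X * X' = X' * X
  nondemolition : ∀ t X, D.j t X ∈ (D.Yt t).commutant
  -- The Feller-type assumption: `f₁, …, f_m` are applied to arbitrary components of the
  -- observations at times `t₁, …, t_m > 0`.
  feller : ∀ (m : ℕ) (t : Fin m → ℝ≥0) (k : Fin m → Fin n) (f : Fin m → (ℝ →ᵇ ℝ)),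
    (∀ l, 0 < t l) → ∃ Z : A,
      (∀ ρ E, D.IsCondExpM ρ 0 E → Indistinguishable (D.Φ ρ)
        (E (List.ofFn fun l => boundedFunction (D.Y (t l) (k l)) (f l)).prod) (D.j 0 Z)) ∧
      (∀ s ρ E, D.IsCondExpM ρ s E → Indistinguishable (D.Φ ρ)
        (E (List.ofFn fun l => boundedFunction (D.increment s (t l) (k l)) (f l)).prod) (D.j s Z))

/-- Observability: distinct initial states give distinct laws of the observations. -/
def Observable (D : FilteringData A H n) : Prop :=
  ¬ ∃ ρ₁ ρ₂ : stateSpace A, ρ₁ ≠ ρ₂ ∧ ∀ Y ∈ D.Yinf, D.Φ ρ₁ Y = D.Φ ρ₂ Y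

/-- The law of the observations under `ρ₁` is absolutely continuous with respect to the law of the
observations under `ρ₂`. -/
def ObsAbsolutelyContinuous (D : FilteringData A H n) (ρ₁ ρ₂ : stateSpace A) : Prop :=
  ∀ p ∈ D.Yinf, IsStarProjection p → D.Φ ρ₂ p = 0 → D.Φ ρ₁ p = 0

end FilteringData

/-! The Feller-type assumption yields elements Z of `A` for which, at every time s, j_s(Z) has the
same conditional expectation given the past as a bounded function F of the future increments of the
observations. The operator F does not depend on the initial state, and its norm is bounded uniformly
in s. Such elements form `observedElements`. At s = 0 the expectations of observation products are
values ρ(Z), so observability says that these elements separate states. The Hahn-Banach theorem and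
the decomposition of real functionals into positive parts then make them norm dense
(`exists_observedElement_near`). Filters are bounded uniformly in time, so it is enough to treat an
observed Z.

For such Z, both filters are conditional expectations given 𝔜_{t]} of one observable F, under two
laws on the commutative algebra 𝔜. Their merging is an argument in the style of Blackwell and
Dubins. By absolute continuity, Φ_{ρ₁} on 𝔜 is a norm limit of functionals Y ↦ Φ_{ρ₂}(BY) with B in
some 𝔜_{T]} (`exists_approx_density`). Once t ≥ T, B is part of the past and does not affect
conditioning under Φ_{ρ₂}. With W the difference of the filters, Φ_{ρ₁}(W*W) = Φ_{ρ₁}(W*F) −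
Φ_{ρ₁}(W*π₂), and both terms are close to the same number Φ_{ρ₂}(BW*F).

Normal states are handled as vector states on the amplification of H to `Ell2 H`
(`IsNormalState.exists_vector`), which turns absolute continuity and density into Hilbert space
geometry. Filters exist because a conditional expectation onto a commutative algebra is a weak limit
of finite averages over fine partitions of unity (`IsNormalState.exists_isCondExp`). The unbounded
observations enter through their resolvents at ±i. -/

set_option linter.unusedSectionVars false

/-! ### Amplification to square summable sequences and the density theorem. -/

section Amplification

variable {H : Type*} [NormedAddCommGroup H] [InnerProductSpace ℂ H] [CompleteSpace H]

/-- The Hilbert space of square summable sequences in `H`. -/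
abbrev Ell2 (H : Type*) [NormedAddCommGroup H] : Type _ := lp (fun _ : ℕ => H) 2

/-- The amplification of an operator on `H`, acting coordinatewise on `Ell2 H`. -/
noncomputable def amp (X : H →L[ℂ] H) : Ell2 H →L[ℂ] Ell2 H :=
  lp.mapCLM 2 (fun _ : ℕ => X) (norm_nonneg X) (fun _ => le_rfl)

@[simp]
theorem amp_apply (X : H →L[ℂ] H) (x : Ell2 H) (n : ℕ) : amp X x n = X (x n) := rfl

variable (H) in
/-- The amplification as a `*`-homomorphism. -/
noncomputable def ampHom : (H →L[ℂ] H) →⋆ₐ[ℂ] (Ell2 H →L[ℂ] Ell2 H) where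
  toFun := amp
  map_one' := by ext x n; simp
  map_mul' X Y := by ext x n; simp
  map_zero' := by ext x n; simp
  map_add' X Y := by ext x n; simp
  commutes' c := by ext x n; simp [Algebra.algebraMap_eq_smul_one]
  map_star' X := by
    refine (ContinuousLinearMap.eq_adjoint_iff _ _).2 fun x y => ?_
    simp [lp.inner_eq_tsum, ContinuousLinearMap.star_eq_adjoint,
      ContinuousLinearMap.adjoint_inner_left]

theorem ampHom_apply (X : H →L[ℂ] H) : ampHom H X = amp X := rfl

@[simp]
theorem amp_one : amp (1 : H →L[ℂ] H) = 1 := map_one (ampHom H)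

@[simp]
theorem amp_mul (X Y : H →L[ℂ] H) : amp (X * Y) = amp X * amp Y := map_mul (ampHom H) X Y

@[simp]
theorem amp_add (X Y : H →L[ℂ] H) : amp (X + Y) = amp X + amp Y := map_add (ampHom H) X Y

@[simp]
theorem amp_sub (X Y : H →L[ℂ] H) : amp (X - Y) = amp X - amp Y := map_sub (ampHom H) X Y

@[simp]
theorem amp_smul (c : ℂ) (X : H →L[ℂ] H) : amp (c • X) = c • amp X := map_smul (ampHom H) c X

theorem amp_star (X : H →L[ℂ] H) : amp (star X) = star (amp X) := map_star (ampHom H) X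

theorem norm_amp_le (X : H →L[ℂ] H) : ‖amp X‖ ≤ ‖X‖ := lp.norm_mapCLM_le _ _ _ _

theorem norm_amp_apply_le (X : H →L[ℂ] H) (x : Ell2 H) : ‖amp X x‖ ≤ ‖X‖ * ‖x‖ :=
  (amp X).le_of_opNorm_le (norm_amp_le X) x

theorem inner_amp_left (X : H →L[ℂ] H) (x y : Ell2 H) :
    ⟪amp X x, y⟫_ℂ = ⟪x, amp (star X) y⟫_ℂ := by
  rw [amp_star, ContinuousLinearMap.star_eq_adjoint, ContinuousLinearMap.adjoint_inner_right]

theorem amp_single (X : H →L[ℂ] H) (n : ℕ) (v : H) :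
    amp X (lp.single 2 n v) = lp.single 2 n (X v) := by
  ext m
  by_cases h : m = n
  · subst h; simp
  · simp [lp.single_apply, Pi.single_eq_of_ne h]

theorem Submodule.starProjection_apply_commute {K : Type*} [NormedAddCommGroup K]
    [InnerProductSpace ℂ K] [CompleteSpace K] (W : Submodule ℂ K) [W.HasOrthogonalProjection]
    (A : K →L[ℂ] K) (h : ∀ v ∈ W, A v ∈ W) (h' : ∀ v ∈ W, star A v ∈ W) (v : K) :
    W.starProjection (A v) = A (W.starProjection v) := by
  refine Submodule.eq_starProjection_of_mem_of_inner_eq_zero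
    (h _ (W.starProjection_apply_mem v)) fun w hw => ?_
  rw [← map_sub, ← ContinuousLinearMap.adjoint_inner_right]
  exact W.starProjection_inner_eq_zero v _ (h' w hw)

/-- An operator in the bicommutant, once amplified, commutes with every operator commuting with
the amplified algebra. -/
theorem amp_commute_of_mem_bicommutant {S : Set (H →L[ℂ] H)} {T : H →L[ℂ] H}
    (hT : T ∈ Set.centralizer (Set.centralizer S)) (Q : Ell2 H →L[ℂ] Ell2 H)
    (hQ : ∀ A ∈ S, ∀ x, Q (amp A x) = amp A (Q x)) (x : Ell2 H) :
    Q (amp T x) = amp T (Q x) := by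
  -- Every matrix entry of Q commutes with S, hence with T; columns with a single nonzero entry are
  -- total.
  have key (m n : ℕ) (v : H) : Q (lp.single 2 n (T v)) m = T (Q (lp.single 2 n v) m) := by
    let B : H →L[ℂ] H := (lp.evalCLM ℂ (fun _ : ℕ => H) 2 m) ∘L Q ∘L
      (lp.singleContinuousLinearMap ℂ (fun _ : ℕ => H) 2 n)
    have hB : B ∈ Set.centralizer S := by
      intro A hA
      ext v
      have := congrArg (fun y : Ell2 H => y m) (hQ A hA (lp.single 2 n v))
      rw [amp_single] at this
      exact this.symm
    have := DFunLike.congr_fun (hT B hB) v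
    exact this
  have hd : Q ∘L amp T = amp T ∘L Q := by
    refine lp.ext_continuousLinearMap (by simp) fun n => ?_
    ext v m
    simp [amp_single, key]
  exact DFunLike.congr_fun hd x

/-- Von Neumann's density theorem, in the σ-strong form. -/
theorem amp_mem_closure_of_mem_bicommutant (S : StarSubalgebra ℂ (H →L[ℂ] H)) {T : H →L[ℂ] H}
    (hT : T ∈ Set.centralizer (Set.centralizer (S : Set (H →L[ℂ] H)))) (x : Ell2 H) :
    amp T x ∈ closure ((fun A => amp A x) '' (S : Set (H →L[ℂ] H))) := by
  let V : Submodule ℂ (Ell2 H) := (Subalgebra.toSubmodule S.toSubalgebra).map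
    ((ContinuousLinearMap.apply ℂ (Ell2 H) x).toLinearMap ∘ₗ (ampHom H).toAlgHom.toLinearMap)
  have hV : (V : Set (Ell2 H)) = (fun A => amp A x) '' (S : Set (H →L[ℂ] H)) := rfl
  let W := V.topologicalClosure
  have : CompleteSpace W := V.isClosed_topologicalClosure.completeSpace_coe
  have hinv : ∀ A ∈ S, ∀ v ∈ W, amp A v ∈ W := by
    intro A hA v hv
    refine map_mem_closure (amp A).continuous hv ?_
    rintro _ ⟨B, hB, rfl⟩
    exact ⟨A * B, mul_mem (S := StarSubalgebra ℂ (H →L[ℂ] H)) hA hB, by simp [ampHom_apply]⟩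
  have h1 : x ∈ W := V.le_topologicalClosure ⟨1, one_mem S, by simp⟩
  -- The projection onto the closed orbit of x commutes with the amplified S, hence with the
  -- amplified T. Since it fixes x, it fixes the image of x under T.
  have h2 := amp_commute_of_mem_bicommutant hT W.starProjection (fun A hA v =>
    W.starProjection_apply_commute (amp A) (hinv A hA)
      (by rw [← amp_star]; exact hinv _ (star_mem hA)) v) x
  rw [W.starProjection_eq_self_iff.2 h1, W.starProjection_eq_self_iff] at h2
  rw [← hV]
  exact h2

end Amplification

/-! ### Normal states as vector states. -/

section VectorState

variable {K : Type*} [NormedAddCommGroup K] [InnerProductSpace ℂ K] [CompleteSpace K]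

section

variable (S : StarSubalgebra ℂ (K →L[ℂ] K)) (x y : K)

/-- The semi-inner product `⟪A, B⟫ = φ (A* B)` attached to a positive functional `φ`. -/
@[reducible]
noncomputable def positiveFunctionalCore
    (hpos : ∀ X ∈ S, 0 ≤ ⟪y, (star X * X) x⟫_ℂ) : PreInnerProductSpace.Core ℂ S where
  inner A B := ⟪y, (star (A : K →L[ℂ] K) * B) x⟫_ℂ
  conj_inner_symm A B := by
    -- Polarization: the form is real at A + B and at A + iB, which forces Hermitian symmetry.
    have h1 := (Complex.nonneg_iff.1 (hpos _ (A + B).2)).2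
    have h2 := (Complex.nonneg_iff.1 (hpos _ (A + Complex.I • B).2)).2
    have h3 := (Complex.nonneg_iff.1 (hpos _ A.2)).2
    have h4 := (Complex.nonneg_iff.1 (hpos _ B.2)).2
    simp only [AddMemClass.coe_add, star_add, add_mul, mul_add, add_apply,
      inner_add_right, SetLike.val_smul, star_smul, smul_mul_assoc, mul_smul_comm,
      smul_apply, inner_smul_right, Complex.star_def, Complex.conj_I,
      Complex.add_im, Complex.mul_im, Complex.I_re, Complex.I_im, Complex.neg_re, Complex.neg_im,
      Complex.mul_re] at h1 h2 h3 h4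
    refine Complex.ext ?_ ?_
    · simp only [Complex.conj_re]; linarith
    · simp only [Complex.conj_im]; linarith
  re_inner_nonneg A := (Complex.nonneg_iff.1 (hpos _ A.2)).1
  add_left A B C := by simp [add_mul]
  smul_left A B r := by simp

variable {S x y}

theorem conj_inner_apply_of_nonneg (hpos : ∀ X ∈ S, 0 ≤ ⟪y, (star X * X) x⟫_ℂ)
    {A B : K →L[ℂ] K} (hA : A ∈ S) (hB : B ∈ S) :
    starRingEnd ℂ ⟪y, (star B * A) x⟫_ℂ = ⟪y, (star A * B) x⟫_ℂ :=
  (positiveFunctionalCore S x y hpos).conj_inner_symm ⟨A, hA⟩ ⟨B, hB⟩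

/-- Cauchy-Schwarz for the positive form, combined with 4 Re⟪Ay, Ax⟫ = ‖A(x+y)‖² − ‖A(y−x)‖². The
single vector x + y thus dominates the functional. -/
theorem norm_inner_apply_le_of_nonneg (hpos : ∀ X ∈ S, 0 ≤ ⟪y, (star X * X) x⟫_ℂ)
    {A B : K →L[ℂ] K} (hA : A ∈ S) (hB : B ∈ S) :
    ‖⟪y, (star A * B) x⟫_ℂ‖ ≤ ‖A (x + y)‖ * ‖B (x + y)‖ := by
  have key (A : K →L[ℂ] K) : (⟪y, (star A * A) x⟫_ℂ).re ≤ ‖A (x + y)‖ ^ 2 := by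
    have h : ⟪y, (star A * A) x⟫_ℂ = ⟪A y, A x⟫_ℂ := by
      simp [ContinuousLinearMap.star_eq_adjoint, ContinuousLinearMap.adjoint_inner_right]
    have h1 := norm_add_sq (𝕜 := ℂ) (A y) (A x)
    have h2 := norm_sub_sq (𝕜 := ℂ) (A y) (A x)
    simp only [RCLike.re_to_complex] at h1 h2
    rw [h, map_add, add_comm (A x)]
    nlinarith [sq_nonneg ‖A y - A x‖, sq_nonneg ‖A y + A x‖]
  have := @InnerProductSpace.Core.inner_mul_inner_self_le ℂ S _ _ _
    (positiveFunctionalCore S x y hpos) ⟨A, hA⟩ ⟨B, hB⟩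
  have hs := congrArg norm (conj_inner_apply_of_nonneg hpos hA hB)
  rw [RCLike.norm_conj] at hs
  change ‖⟪y, (star A * B) x⟫_ℂ‖ * ‖⟪y, (star B * A) x⟫_ℂ‖ ≤
    (⟪y, (star A * A) x⟫_ℂ).re * (⟪y, (star B * B) x⟫_ℂ).re at this
  rw [hs] at this
  refine le_of_sq_le_sq ?_ (by positivity)
  calc _ ≤ (⟪y, (star A * A) x⟫_ℂ).re * (⟪y, (star B * B) x⟫_ℂ).re := by rw [sq]; exact this
    _ ≤ ‖A (x + y)‖ ^ 2 * ‖B (x + y)‖ ^ 2 :=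
      mul_le_mul (key A) (key B) (Complex.nonneg_iff.1 (hpos _ hB)).1 (by positivity)
    _ = _ := by ring

/-- A positive functional on a `*`-algebra of operators which is dominated by vectors, is a
vector functional. -/
theorem exists_vector_of_nonneg (hpos : ∀ X ∈ S, 0 ≤ ⟪y, (star X * X) x⟫_ℂ) :
    ∃ z : K, ∀ X ∈ S, ⟪y, X x⟫_ℂ = ⟪z, X z⟫_ℂ := by
  set u := x + y with hu
  have bound {A B : K →L[ℂ] K} (hA : A ∈ S) (hB : B ∈ S) :=
    norm_inner_apply_le_of_nonneg hpos hA hB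
  let V : Submodule ℂ K := (Subalgebra.toSubmodule S.toSubalgebra).map
    (ContinuousLinearMap.apply ℂ K u).toLinearMap
  let W := V.topologicalClosure
  have : CompleteSpace W := V.isClosed_topologicalClosure.completeSpace_coe
  have hVW : V ≤ W := V.le_topologicalClosure
  have hV (A : S) : (A : K →L[ℂ] K) u ∈ V := ⟨A, A.2, rfl⟩
  let e : S →ₗ[ℂ] W := LinearMap.codRestrict W
    ((ContinuousLinearMap.apply ℂ K u).toLinearMap ∘ₗ S.toSubalgebra.val.toLinearMap)
    (fun A => hVW (hV A))
  have he (A : S) : (e A : K) = (A : K →L[ℂ] K) u := rfl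
  have hdense : DenseRange e := by
    rintro ⟨v, hv⟩
    rw [closure_subtype]
    refine closure_mono ?_ hv
    rintro _ ⟨A, hA, rfl⟩
    exact ⟨e ⟨A, hA⟩, ⟨⟨A, hA⟩, rfl⟩, rfl⟩
  have hinv : ∀ A ∈ S, ∀ v ∈ W, A v ∈ W := by
    intro A hA v hv
    refine map_mem_closure A.continuous hv ?_
    rintro _ ⟨B, hB, rfl⟩
    exact ⟨A * B, mul_mem (S := StarSubalgebra ℂ (K →L[ℂ] K)) hA hB, by simp⟩
  let φ : S →ₗ[ℂ] ℂ := (innerSL ℂ y).toLinearMap ∘ₗ (ContinuousLinearMap.apply ℂ K x).toLinearMap ∘ₗ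
    S.toSubalgebra.val.toLinearMap
  have hφ (A : S) : φ A = ⟪y, (A : K →L[ℂ] K) x⟫_ℂ := rfl
  have hφb : ∃ C, ∀ A, ‖φ A‖ ≤ C * ‖e A‖ := ⟨‖u‖, fun A => by
    have := bound (one_mem S) A.2
    rw [star_one, one_mul] at this
    exact this⟩
  -- The functional depends on A only through A u, boundedly, so the Riesz theorem on the closed
  -- orbit of u represents it by a vector w.
  obtain ⟨w, hw⟩ := (InnerProductSpace.toDual ℂ W).surjective (φ.extendOfNorm e)
  have hw' (A : K →L[ℂ] K) (hA : A ∈ S) : ⟪(w : K), A u⟫_ℂ = ⟪y, A x⟫_ℂ := by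
    have := LinearMap.extendOfNorm_eq hdense hφb ⟨A, hA⟩
    rw [← hw, InnerProductSpace.toDual_apply_apply] at this
    exact this
  have hw2 (A B : K →L[ℂ] K) (hA : A ∈ S) (hB : B ∈ S) :
      ⟪A u, B w⟫_ℂ = ⟪y, (star A * B) x⟫_ℂ := by
    rw [← conj_inner_apply_of_nonneg hpos hA hB, ← hw' _ (mul_mem (star_mem hB) hA),
      inner_conj_symm]
    simp [ContinuousLinearMap.star_eq_adjoint, ContinuousLinearMap.adjoint_inner_left]
  let g : S →ₗ[ℂ] K := (ContinuousLinearMap.apply ℂ K (w : K)).toLinearMap ∘ₗ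
    S.toSubalgebra.val.toLinearMap
  have hgb : ∃ C, ∀ A, ‖g A‖ ≤ C * ‖e A‖ := by
    refine ⟨1, fun B => ?_⟩
    change ‖(B : K →L[ℂ] K) w‖ ≤ 1 * ‖(B : K →L[ℂ] K) u‖
    have h (v : W) : ‖⟪(v : K), (B : K →L[ℂ] K) w⟫_ℂ‖ ≤ ‖(v : K)‖ * ‖(B : K →L[ℂ] K) u‖ := by
      induction v using hdense.induction_on with
      | hp => exact isClosed_le (by fun_prop) (by fun_prop)
      | ih A => rw [he, hw2 _ _ A.2 B.2]; exact bound A.2 B.2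
    have h1 := h ⟨_, hinv _ B.2 _ w.2⟩
    simp only [inner_self_eq_norm_sq_to_K, norm_pow, Complex.coe_algebraMap, Complex.norm_real,
      norm_norm] at h1
    by_cases h0 : ‖(B : K →L[ℂ] K) w‖ = 0
    · rw [h0]; positivity
    · rw [sq] at h1
      rw [one_mul]
      exact le_of_mul_le_mul_left h1 (lt_of_le_of_ne (norm_nonneg _) (Ne.symm h0))
  let T₀ : W →L[ℂ] K := g.extendOfNorm e
  have hT₀ (A : S) : T₀ (e A) = (A : K →L[ℂ] K) w := LinearMap.extendOfNorm_eq hdense hgb A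
  have hT₀W (v : W) : T₀ v ∈ W := by
    induction v using hdense.induction_on with
    | hp => exact V.isClosed_topologicalClosure.preimage T₀.continuous
    | ih A => rw [hT₀]; exact hinv _ A.2 _ w.2
  -- T is the Radon-Nikodym operator A u ↦ A w, extended by zero. It is positive, commutes with S
  -- and sends u to w, so z = √T u satisfies ⟪z, X z⟫ = ⟪u, X T u⟫ = ⟪u, X w⟫.
  let T : K →L[ℂ] K := T₀ ∘L W.orthogonalProjectionOnto
  have hTpos : 0 ≤ T := by
    rw [ContinuousLinearMap.nonneg_iff_isPositive, ContinuousLinearMap.isPositive_iff']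
    have key (v : W) : 0 ≤ ⟪(v : K), T₀ v⟫_ℂ := by
      induction v using hdense.induction_on with
      | hp => exact isClosed_le (by fun_prop) (by fun_prop)
      | ih A => rw [hT₀, he, hw2 _ _ A.2 A.2]; exact hpos _ A.2
    have h (v : K) : 0 ≤ ⟪v, T v⟫_ℂ := by
      change 0 ≤ ⟪v, T₀ (W.orthogonalProjectionOnto v)⟫_ℂ
      rw [← W.starProjection_eq_self_iff.2 (hT₀W (W.orthogonalProjectionOnto v)),
        ← Submodule.inner_starProjection_left_eq_right]
      exact key _
    have h' (v : K) : ⟪T v, v⟫_ℂ = ⟪v, T v⟫_ℂ := by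
      rw [← inner_conj_symm, Complex.conj_eq_iff_im]
      exact (Complex.nonneg_iff.1 (h v)).2.symm
    refine ⟨?_, fun v => h' v ▸ h v⟩
    rw [ContinuousLinearMap.isSelfAdjoint_iff_isSymmetric,
      LinearMap.isSymmetric_iff_inner_map_self_real]
    intro v
    change starRingEnd ℂ ⟪T v, v⟫_ℂ = ⟪T v, v⟫_ℂ
    rw [inner_conj_symm, h' v]
  have hTcomm (B : K →L[ℂ] K) (hB : B ∈ S) : Commute T B := by
    have key (v : W) : T₀ ⟨B v, hinv B hB v v.2⟩ = B (T₀ v) := by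
      induction v using hdense.induction_on with
      | hp => exact isClosed_eq (by fun_prop) (by fun_prop)
      | ih A => 
        rw [hT₀]
        exact hT₀ (⟨B, hB⟩ * A)
    ext v
    have h := W.starProjection_apply_commute B (hinv B hB) (hinv _ (star_mem hB)) v
    change T₀ (W.orthogonalProjectionOnto (B v)) = B (T₀ (W.orthogonalProjectionOnto v))
    rw [← key]
    congr 1
    exact Subtype.ext h
  have hTu : T u = w := by
    have h1 := hT₀ 1
    have h2 : e 1 = W.orthogonalProjectionOnto u :=
      Subtype.ext ((W.starProjection_eq_self_iff.2 (hVW (hV 1))).symm)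
    rw [h2] at h1
    exact h1
  have hsq : CFC.sqrt T * CFC.sqrt T = T := CFC.sqrt_mul_sqrt_self T hTpos
  refine ⟨CFC.sqrt T u, fun X hX => ?_⟩
  have hc : Commute (CFC.sqrt T) X := by
    rw [CFC.sqrt_eq_real_sqrt T hTpos]
    exact (hTcomm X hX).cfcₙ_real _
  have hsa : star (CFC.sqrt T) = CFC.sqrt T := (CFC.sqrt_nonneg T).isSelfAdjoint
  have h1 : ⟪CFC.sqrt T u, X (CFC.sqrt T u)⟫_ℂ = ⟪u, X w⟫_ℂ := by
    rw [← ContinuousLinearMap.adjoint_inner_right, ← ContinuousLinearMap.star_eq_adjoint, hsa]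
    congr 1
    change (CFC.sqrt T * (X * CFC.sqrt T)) u = _
    rw [← mul_assoc, hc.eq, mul_assoc, hsq, ← hTu]
    rfl
  rw [h1]
  simpa using (hw2 1 X (one_mem S) hX).symm

end

variable {H : Type*} [NormedAddCommGroup H] [InnerProductSpace ℂ H] [CompleteSpace H]

/-- σ-weak continuity gives a functional with two different vectors on the amplified algebra;
positivity lets `exists_vector_of_nonneg` replace them by one. -/
theorem IsNormalState.exists_vector {N : VonNeumannAlgebra H} {Φ : (H →L[ℂ] H) →ₗ[ℂ] ℂ}
    (h : IsNormalState N Φ) : ∃ z : Ell2 H, ‖z‖ = 1 ∧ ∀ X ∈ N, Φ X = ⟪z, amp X z⟫_ℂ := by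
  obtain ⟨x, y, hx, hy, hxy⟩ := h.normal
  let x' : Ell2 H := ⟨x, memℓp_gen (by simpa using hx)⟩
  let y' : Ell2 H := ⟨y, memℓp_gen (by simpa using hy)⟩
  have key : ∀ X ∈ N, Φ X = ⟪y', amp X x'⟫_ℂ := fun X hX =>
    (hxy X hX).unique (lp.hasSum_inner y' (amp X x'))
  obtain ⟨z, hz⟩ := exists_vector_of_nonneg (S := N.toStarSubalgebra.map (ampHom H))
    (x := x') (y := y') (by
      rintro _ ⟨X, hX, rfl⟩
      have := h.nonneg X hX
      rw [key _ (mul_mem (star_mem hX : star X ∈ N) hX)] at this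
      rw [amp_mul, amp_star] at this
      exact this)
  have hz' : ∀ X ∈ N, Φ X = ⟪z, amp X z⟫_ℂ := fun X hX =>
    (key X hX).trans (hz _ ⟨X, hX, rfl⟩)
  refine ⟨z, ?_, hz'⟩
  have h1 := h.map_one
  rw [hz' 1 (one_mem N), amp_one] at h1
  change ⟪z, z⟫_ℂ = 1 at h1
  have h2 := inner_self_eq_norm_sq (𝕜 := ℂ) z
  rw [h1] at h2
  rw [RCLike.one_re] at h2
  nlinarith [norm_nonneg z]

end VectorState

/-! ### Absolute continuity and approximate densities. -/

section RadonNikodym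

variable {H : Type*} [NormedAddCommGroup H] [InnerProductSpace ℂ H] [CompleteSpace H]

/-- The commutant is closed under adjoints, so an invariant subspace is reducing and its projection
lies in the bicommutant. -/
theorem VonNeumannAlgebra.starProjection_mem (N : VonNeumannAlgebra H) (W : Submodule ℂ H)
    [W.HasOrthogonalProjection] (hW : ∀ T ∈ N.commutant, ∀ v ∈ W, T v ∈ W) :
    W.starProjection ∈ N := by
  rw [← N.commutant_commutant, VonNeumannAlgebra.mem_commutant_iff]
  intro T hT
  ext v
  exact (W.starProjection_apply_commute T (hW T hT) (hW _ (star_mem hT)) v).symm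

/-- If `z₁` is killed by every projection of `N` that kills `z₂`, then its components lie in the
closed subspace generated by the action of the commutant on the components of `z₂`. -/
theorem VonNeumannAlgebra.mem_closure_span_commutant (N : VonNeumannAlgebra H) (z₁ z₂ : Ell2 H)
    (hac : ∀ p ∈ N, IsStarProjection p → amp p z₂ = 0 → amp p z₁ = 0) (n : ℕ) :
    z₁ n ∈ (Submodule.span ℂ
      {v | ∃ T ∈ N.commutant, ∃ m, v = T (z₂ m)}).topologicalClosure := by
  set V := Submodule.span ℂ {v | ∃ T ∈ N.commutant, ∃ m, v = T (z₂ m)} with hV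
  let W := V.topologicalClosure
  have : CompleteSpace W := V.isClosed_topologicalClosure.completeSpace_coe
  have hVW : V ≤ W := V.le_topologicalClosure
  have hinv : ∀ T ∈ N.commutant, ∀ v ∈ W, T v ∈ W := by
    intro T hT v hv
    refine map_mem_closure T.continuous hv fun v hv => ?_
    induction hv using Submodule.span_induction with
    | mem v hv =>
      obtain ⟨A, hA, m, rfl⟩ := hv
      exact Submodule.subset_span ⟨T * A, mul_mem hT hA, m, rfl⟩
    | zero => simp
    | add x y _ _ hx hy => rw [map_add]; exact V.add_mem hx hy
    | smul c x _ hx => rw [map_smul]; exact V.smul_mem c hx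
  have hP := N.starProjection_mem W hinv
  have h2 : amp (1 - W.starProjection) z₂ = 0 := by
    ext m
    have : z₂ m ∈ W := hVW (Submodule.subset_span ⟨1, one_mem _, m, rfl⟩)
    simp [(W.starProjection_eq_self_iff).2 this]
  have h1 := hac _ (sub_mem (one_mem N) hP) isStarProjection_starProjection.one_sub h2
  have h3 := congrArg (fun y : Ell2 H => y n) h1
  exact W.starProjection_eq_self_iff.1 (sub_eq_zero.1 (by simpa using h3)).symm

/-- An approximate Radon-Nikodym theorem: if every projection of `N` that is null for the vector
state `z₂` is null for the vector state `z₁`, then, on `N`, the latter is a norm limit of the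
functionals `Y ↦ ⟪z₂, B Y z₂⟫` with `B` in a given dense `*`-subalgebra of `N`. -/
theorem VonNeumannAlgebra.exists_approx_density (N : VonNeumannAlgebra H)
    (S : StarSubalgebra ℂ (H →L[ℂ] H))
    (hS : Set.centralizer (Set.centralizer (S : Set (H →L[ℂ] H))) = N) (z₁ z₂ : Ell2 H)
    (hac : ∀ p ∈ N, IsStarProjection p → amp p z₂ = 0 → amp p z₁ = 0) {ε : ℝ} (hε : 0 < ε) :
    ∃ B ∈ S, ∀ Y ∈ N, ‖⟪z₁, amp Y z₁⟫_ℂ - ⟪z₂, amp (B * Y) z₂⟫_ℂ‖ ≤ ε * ‖Y‖ := by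
  -- G consists of the g for which Y ↦ ⟪z₁, Y g⟫ is already a functional of Y z₂. An element of the
  -- commutant moves past Y and over to z₁, so G contains the columns built from T (z₂ m); absolute
  -- continuity then makes z₁ a limit of elements of G.
  let G : Submodule ℂ (Ell2 H) :=
    { carrier := {g | ∃ w, ∀ Y ∈ N, ⟪z₁, amp Y g⟫_ℂ = ⟪w, amp Y z₂⟫_ℂ}
      add_mem' := by
        rintro a b ⟨w, hw⟩ ⟨w', hw'⟩
        exact ⟨w + w', fun Y hY => by
          rw [map_add, inner_add_right, inner_add_left, hw Y hY, hw' Y hY]⟩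
      zero_mem' := ⟨0, by simp⟩
      smul_mem' := by
        rintro c a ⟨w, hw⟩
        exact ⟨starRingEnd ℂ c • w, fun Y hY => by
          rw [map_smul, inner_smul_right, inner_smul_left, hw Y hY, Complex.conj_conj]⟩ }
  have hG (n m : ℕ) (T : H →L[ℂ] H) (hT : T ∈ N.commutant) : lp.single 2 n (T (z₂ m)) ∈ G := by
    refine ⟨lp.single 2 m (star T (z₁ n)), fun Y hY => ?_⟩
    have hc : Y * T = T * Y := VonNeumannAlgebra.mem_commutant_iff.1 hT Y hY
    rw [amp_single, lp.inner_single_right, lp.inner_single_left, amp_apply,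
      ContinuousLinearMap.star_eq_adjoint, ContinuousLinearMap.adjoint_inner_left]
    exact congrArg (fun A : H →L[ℂ] H => ⟪z₁ n, A (z₂ m)⟫_ℂ) hc
  have hG' (n : ℕ) (v : H) (hv : v ∈ (Submodule.span ℂ
      {v | ∃ T ∈ N.commutant, ∃ m, v = T (z₂ m)}).topologicalClosure) :
      lp.single 2 n v ∈ G.topologicalClosure := by
    refine map_mem_closure (lp.singleContinuousLinearMap ℂ (fun _ : ℕ => H) 2 n).continuous hv
      fun v hv => ?_
    change v ∈ G.comap (lp.singleContinuousLinearMap ℂ (fun _ : ℕ => H) 2 n).toLinearMap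
    refine Submodule.span_le.2 ?_ hv
    rintro _ ⟨T, hT, m, rfl⟩
    exact hG n m T hT
  have hz : z₁ ∈ G.topologicalClosure :=
    G.isClosed_topologicalClosure.mem_of_tendsto (lp.hasSum_single (by simp) z₁)
      (Eventually.of_forall fun s => sum_mem fun n _ =>
        hG' n _ (N.mem_closure_span_commutant z₁ z₂ hac n))
  obtain ⟨δ, hδ, hδε⟩ : ∃ δ : ℝ, 0 < δ ∧ ‖z₁‖ * δ + δ * ‖z₂‖ ≤ ε :=
    ⟨ε / (‖z₁‖ + ‖z₂‖ + 1), by positivity, by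
      rw [mul_comm, ← mul_add, div_mul_eq_mul_div, div_le_iff₀ (by positivity)]
      nlinarith⟩
  obtain ⟨g, ⟨w, hw⟩, hg⟩ := Metric.mem_closure_iff.1 hz δ hδ
  let V : Submodule ℂ (Ell2 H) := (Subalgebra.toSubmodule S.toSubalgebra).map
    ((ContinuousLinearMap.apply ℂ (Ell2 H) z₂).toLinearMap ∘ₗ (ampHom H).toAlgHom.toLinearMap)
  -- Y z₂ lies in the closed orbit Q of z₂ under S, so only the component of w in Q matters, and
  -- that component is approximated by some B z₂ with B in S.
  let Q := V.topologicalClosure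
  have : CompleteSpace Q := V.isClosed_topologicalClosure.completeSpace_coe
  obtain ⟨_, ⟨B, hB, rfl⟩, hBw⟩ := Metric.mem_closure_iff.1 (Q.starProjection_apply_mem w) δ hδ
  change dist _ (amp B z₂) < δ at hBw
  refine ⟨star B, star_mem (S := StarSubalgebra ℂ (H →L[ℂ] H)) hB, fun Y hY => ?_⟩
  have hYQ : amp Y z₂ ∈ Q := amp_mem_closure_of_mem_bicommutant S (hS ▸ hY) z₂
  have e1 : ⟪z₂, amp (star B * Y) z₂⟫_ℂ = ⟪amp B z₂, amp Y z₂⟫_ℂ := by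
    rw [inner_amp_left, amp_mul]; rfl
  have e2 : ⟪w, amp Y z₂⟫_ℂ = ⟪Q.starProjection w, amp Y z₂⟫_ℂ := by
    rw [Submodule.inner_starProjection_left_eq_right, Q.starProjection_eq_self_iff.2 hYQ]
  have e3 : ⟪z₁, amp Y z₁⟫_ℂ - ⟪z₂, amp (star B * Y) z₂⟫_ℂ =
      ⟪z₁, amp Y (z₁ - g)⟫_ℂ + ⟪Q.starProjection w - amp B z₂, amp Y z₂⟫_ℂ := by
    rw [map_sub, inner_sub_right, inner_sub_left, hw Y hY, e2, e1]; ring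
  rw [e3]
  rw [dist_eq_norm] at hg hBw
  calc _ ≤ ‖z₁‖ * (‖Y‖ * δ) + δ * (‖Y‖ * ‖z₂‖) := by
        refine (norm_add_le _ _).trans (add_le_add ((norm_inner_le_norm _ _).trans ?_)
          ((norm_inner_le_norm _ _).trans ?_))
        · gcongr
          exact (norm_amp_apply_le _ _).trans (by gcongr)
        · gcongr
          exact norm_amp_apply_le _ _
    _ = (‖z₁‖ * δ + δ * ‖z₂‖) * ‖Y‖ := by ring
    _ ≤ _ := by gcongr

end RadonNikodym

/-! ### Resolvents of self-adjoint operators at imaginary points. -/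

section Resolvent

variable {H : Type*} [NormedAddCommGroup H] [InnerProductSpace ℂ H] [CompleteSpace H]

/-- `R` is a right inverse of `T - c`. -/
def IsResolvent (T : H →ₗ.[ℂ] H) (c : ℂ) (R : H →L[ℂ] H) : Prop :=
  ∀ v, ∃ h : R v ∈ T.domain, T ⟨R v, h⟩ = v + c • R v

variable {T : H →ₗ.[ℂ] H} {c : ℂ}

/-- ⟪Ta, a⟫ is real and c is purely imaginary, so the cross term vanishes. Injectivity, lower bounds
and the resolvent estimate all follow from this identity. -/
theorem LinearPMap.IsFormalAdjoint.norm_sub_smul_sq (hT : T.IsFormalAdjoint T)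
    (hc : starRingEnd ℂ c = -c) (a : T.domain) :
    ‖T a - c • (a : H)‖ ^ 2 = ‖T a‖ ^ 2 + ‖c‖ ^ 2 * ‖(a : H)‖ ^ 2 := by
  have h0 : (⟪T a, (a : H)⟫_ℂ).im = 0 := by
    have h1 := inner_conj_symm (𝕜 := ℂ) (T a) (a : H)
    rw [← hT a a] at h1
    exact Complex.conj_eq_iff_im.1 h1
  have hre : c.re = 0 := by
    have := congrArg Complex.re hc
    simp at this
    linarith
  have h := norm_sub_sq (𝕜 := ℂ) (T a) (c • (a : H))
  rw [inner_smul_right, norm_smul, mul_pow] at h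
  rw [h]
  simp [h0, hre]

theorem LinearPMap.IsFormalAdjoint.eq_of_sub_smul_eq (hT : T.IsFormalAdjoint T)
    (hc : starRingEnd ℂ c = -c) (hc0 : c ≠ 0) {a b : T.domain}
    (h : T a - c • (a : H) = T b - c • (b : H)) : a = b := by
  have h1 := hT.norm_sub_smul_sq hc (a - b)
  have h2 : T (a - b) - c • ((a - b : T.domain) : H) = 0 := by
    rw [LinearPMap.map_sub, Submodule.coe_sub, smul_sub, sub_sub_sub_comm, h, sub_self]
  rw [h2, norm_zero] at h1
  have h3 : ‖c‖ ^ 2 * ‖((a - b : T.domain) : H)‖ ^ 2 = 0 := by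
    nlinarith [sq_nonneg ‖T (a - b)‖,
      mul_nonneg (sq_nonneg ‖c‖) (sq_nonneg ‖((a - b : T.domain) : H)‖)]
  have h4 : (a - b : T.domain) = 0 := by
    have h5 : ((a - b : T.domain) : H) = 0 := by 
      have := (mul_eq_zero.1 h3).resolve_left (by positivity)
      exact norm_eq_zero.1 (pow_eq_zero_iff two_ne_zero |>.1 this)
    exact Subtype.ext h5
  exact sub_eq_zero.1 h4

theorem IsSelfAdjoint.isFormalAdjoint (hT : IsSelfAdjoint T) : T.IsFormalAdjoint T := by
  have h := LinearPMap.adjoint_isFormalAdjoint (T := T) hT.dense_domain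
  rwa [LinearPMap.isSelfAdjoint_def.1 hT] at h

namespace IsResolvent

variable {R : H →L[ℂ] H}

theorem mem (hR : IsResolvent T c R) (v : H) : R v ∈ T.domain := (hR v).1

theorem apply (hR : IsResolvent T c R) (v : H) : T ⟨R v, hR.mem v⟩ = v + c • R v := (hR v).2

theorem apply_sub (hR : IsResolvent T c R) (hT : T.IsFormalAdjoint T)
    (hc : starRingEnd ℂ c = -c) (hc0 : c ≠ 0) (a : T.domain) : R (T a - c • (a : H)) = a := by
  have h := hT.eq_of_sub_smul_eq hc hc0 (a := ⟨_, hR.mem (T a - c • (a : H))⟩) (b := a)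
    (by rw [hR.apply]; exact add_sub_cancel_right _ _)
  exact congrArg Subtype.val h

theorem denseRange (hR : IsResolvent T c R) (hT : T.IsFormalAdjoint T)
    (hc : starRingEnd ℂ c = -c) (hc0 : c ≠ 0) (hd : Dense (T.domain : Set H)) : DenseRange R :=
  hd.mono fun a ha => ⟨_, hR.apply_sub hT hc hc0 ⟨a, ha⟩⟩

theorem comm_apply (hR : IsResolvent T c R) (hT : T.IsFormalAdjoint T)
    (hc : starRingEnd ℂ c = -c) (hc0 : c ≠ 0) {X : H →L[ℂ] H} (hX : CommutesWithUnbounded X T)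
    (v : H) : X (R v) = R (X v) := by
  obtain ⟨h, hh⟩ := hX ⟨R v, hR.mem v⟩
  have h1 := hR.apply_sub hT hc hc0 ⟨X (R v), h⟩
  rw [hh, hR.apply, map_add, map_smul, add_sub_cancel_right] at h1
  exact h1.symm

theorem commute (hR : IsResolvent T c R) (hT : T.IsFormalAdjoint T)
    (hc : starRingEnd ℂ c = -c) (hc0 : c ≠ 0) {X : H →L[ℂ] H} (hX : CommutesWithUnbounded X T) :
    Commute X R :=
  ContinuousLinearMap.ext (hR.comm_apply hT hc hc0 hX)

theorem commutesWithUnbounded (hR : IsResolvent T c R) (hT : T.IsFormalAdjoint T)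
    (hc : starRingEnd ℂ c = -c) (hc0 : c ≠ 0) {X : H →L[ℂ] H} (hX : Commute X R) :
    CommutesWithUnbounded X T := by
  intro a
  have hX' (v : H) : X (R v) = R (X v) := DFunLike.congr_fun hX.eq v
  set w := T a - c • (a : H) with hw
  have ha : (a : H) = R w := (hR.apply_sub hT hc hc0 a).symm
  have hXa : X a = R (X w) := by rw [ha, hX']
  refine ⟨hXa ▸ hR.mem _, ?_⟩
  have h1 := hR.apply (X w)
  have h2 : T a = w + c • (a : H) := by rw [hw, sub_add_cancel]
  simp only [hXa]
  rw [h1, h2, map_add, map_smul, hXa]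

theorem star_eq {R' : H →L[ℂ] H} (hR : IsResolvent T c R) (hR' : IsResolvent T (-c) R')
    (hT : T.IsFormalAdjoint T) (hc : starRingEnd ℂ c = -c) : star R = R' := by
  refine ((ContinuousLinearMap.eq_adjoint_iff _ _).2 fun v w => ?_).symm
  have h := hT ⟨R' v, hR'.mem v⟩ ⟨R w, hR.mem w⟩
  rw [hR.apply, hR'.apply] at h
  simp only [inner_add_left, inner_add_right, inner_smul_left, inner_smul_right, map_neg, hc,
    neg_neg] at h
  linear_combination -h

/-- For c = i this identity places the spectrum of R on the circle Im z = |z|², the image of the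
real line under x ↦ (x − i)⁻¹ with 0 added. -/
theorem sub_star (hR : IsResolvent T c R) (hT : T.IsFormalAdjoint T)
    (hc : starRingEnd ℂ c = -c) : R - star R = (2 * c) • (star R * R) := by
  ext w
  refine ext_inner_left ℂ fun v => ?_
  have h := hT ⟨R v, hR.mem v⟩ ⟨R w, hR.mem w⟩
  rw [hR.apply, hR.apply] at h
  simp only [inner_add_left, inner_add_right, inner_smul_left, inner_smul_right, hc] at h
  simp only [sub_apply, inner_sub_right, ContinuousLinearMap.star_eq_adjoint,
    ContinuousLinearMap.adjoint_inner_right, smul_apply, inner_smul_right,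
    mul_apply_eq_comp]
  linear_combination h

end IsResolvent

/-- T − c is bounded below on its complete graph, so its range is closed. A vector orthogonal to the
range lies in the domain of T* = T and satisfies Ty = −cy; symmetry then gives y = 0. -/
theorem IsSelfAdjoint.range_sub_smul (hT : IsSelfAdjoint T) (hc : starRingEnd ℂ c = -c)
    (hc0 : c ≠ 0) (u : H) : ∃ a : T.domain, T a - c • (a : H) = u := by
  have hs := hT.isFormalAdjoint
  let L : T.graph →L[ℂ] H :=
    (ContinuousLinearMap.snd ℂ H H - c • ContinuousLinearMap.fst ℂ H H) ∘L T.graph.subtypeL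
  have hLapp (a : T.domain) : L ⟨(a, T a), T.mem_graph a⟩ = T a - c • (a : H) := rfl
  have hgraph (g : T.graph) : ∃ a : T.domain, g = ⟨(a, T a), T.mem_graph a⟩ := by
    obtain ⟨a, h1, h2⟩ := T.mem_graph_iff.1 g.2
    exact ⟨a, Subtype.ext (Prod.ext h1.symm h2.symm)⟩
  have : CompleteSpace T.graph := hT.isClosed.completeSpace_coe
  have hcpos : 0 < ‖c‖ := norm_pos_iff.2 hc0
  have hanti : AntilipschitzWith (1 + ‖c‖⁻¹).toNNReal L := by
    refine AddMonoidHomClass.antilipschitz_of_bound L fun g => ?_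
    obtain ⟨a, rfl⟩ := hgraph g
    rw [hLapp, Real.coe_toNNReal _ (by positivity)]
    have h := hs.norm_sub_smul_sq hc a
    have h1 : ‖T a‖ ≤ ‖T a - c • (a : H)‖ :=
      le_of_sq_le_sq (by rw [h]; nlinarith [sq_nonneg (‖c‖ * ‖(a : H)‖)]) (norm_nonneg _)
    have h2 : ‖c‖ * ‖(a : H)‖ ≤ ‖T a - c • (a : H)‖ :=
      le_of_sq_le_sq (by rw [h]; nlinarith [sq_nonneg ‖T a‖]) (norm_nonneg _)
    have h3 : ‖(a : H)‖ ≤ ‖c‖⁻¹ * ‖T a - c • (a : H)‖ := by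
      rwa [← div_eq_inv_mul, le_div_iff₀' hcpos]
    have h0 := norm_nonneg (T a - c • (a : H))
    have h4 : 0 ≤ ‖c‖⁻¹ * ‖T a - c • (a : H)‖ := by positivity
    refine (max_le ?_ ?_ : ‖((a : H), T a)‖ ≤ _)
    · change ‖(a : H)‖ ≤ _
      rw [add_mul, one_mul]; linarith
    · change ‖T a‖ ≤ _
      rw [add_mul, one_mul]; linarith
  have hclosed : IsClosed (L.range : Set H) := by
    have h : IsClosed (Set.range L) := hanti.isClosed_range L.uniformContinuous
    exact h
  have hbot : L.rangeᗮ = ⊥ := by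
    rw [Submodule.eq_bot_iff]
    intro y hy
    have hy' (a : T.domain) : ⟪(-c) • y, (a : H)⟫_ℂ = ⟪y, T a⟫_ℂ := by
      have h : ⟪y, L ⟨(a, T a), T.mem_graph a⟩⟫_ℂ = 0 :=
        Submodule.inner_left_of_mem_orthogonal (LinearMap.mem_range_self L.toLinearMap _) hy
      rw [hLapp, inner_sub_right, inner_smul_right] at h
      rw [inner_smul_left, map_neg, hc]
      linear_combination -h
    have hdom : y ∈ T.domain := by
      rw [← LinearPMap.isSelfAdjoint_def.1 hT]
      exact LinearPMap.mem_adjoint_domain_of_exists y ⟨_, hy'⟩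
    have h1 := hs ⟨y, hdom⟩ ⟨y, hdom⟩
    have hTy : T ⟨y, hdom⟩ = (-c) • y := by
      refine hT.dense_domain.eq_of_inner_left (𝕜 := ℂ) fun v hv => ?_
      rw [hy' ⟨v, hv⟩, hs ⟨y, hdom⟩ ⟨v, hv⟩]
    rw [hTy, inner_smul_left, inner_smul_right, map_neg, hc] at h1
    have h2 : c * ⟪y, y⟫_ℂ = 0 := by linear_combination h1 / 2
    simpa [hc0] using h2
  have htop : L.range = ⊤ := by
    have : CompleteSpace L.range := hclosed.completeSpace_coe
    exact Submodule.orthogonal_eq_bot_iff.1 hbot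
  obtain ⟨g, hg⟩ := (htop ▸ Submodule.mem_top : u ∈ L.range)
  obtain ⟨a, rfl⟩ := hgraph g
  exact ⟨a, hg⟩

theorem IsSelfAdjoint.exists_isResolvent (hT : IsSelfAdjoint T) (hc : starRingEnd ℂ c = -c)
    (hc0 : c ≠ 0) : ∃ R, IsResolvent T c R := by
  choose r hr using hT.range_sub_smul hc hc0
  have hs := hT.isFormalAdjoint
  let R₀ : H →ₗ[ℂ] H :=
    { toFun := fun u => r u
      map_add' := fun u v => by
        rw [← Submodule.coe_add]
        congr 1
        refine hs.eq_of_sub_smul_eq hc hc0 ?_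
        rw [hr, LinearPMap.map_add, Submodule.coe_add, smul_add, add_sub_add_comm, hr, hr]
      map_smul' := fun k u => by
        rw [RingHom.id_apply, ← Submodule.coe_smul]
        congr 1
        refine hs.eq_of_sub_smul_eq hc hc0 ?_
        rw [hr, LinearPMap.map_smul, Submodule.coe_smul, smul_comm c k, ← smul_sub, hr] }
  have hcpos : 0 < ‖c‖ := norm_pos_iff.2 hc0
  refine ⟨R₀.mkContinuous ‖c‖⁻¹ fun u => ?_, fun u => ⟨(r u).2, ?_⟩⟩
  · have h := hs.norm_sub_smul_sq hc (r u)
    rw [← div_eq_inv_mul, le_div_iff₀' hcpos]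
    rw [hr] at h
    change ‖c‖ * ‖(r u : H)‖ ≤ ‖u‖
    exact le_of_sq_le_sq (by rw [h]; nlinarith [sq_nonneg ‖T (r u)‖]) (norm_nonneg _)
  · exact eq_add_of_sub_eq (hr u)

end Resolvent

/-! ### Construction of the bounded functional calculus. -/

section FunctionalCalculus

/-- The function `x ↦ (x - i)⁻¹` on the real line. -/
noncomputable def resolventFunction : ℝ →ᵇ ℂ :=
  BoundedContinuousFunction.ofNormedAddCommGroup (fun x : ℝ => ((x : ℂ) - Complex.I)⁻¹)
    (Continuous.inv₀ (by fun_prop) fun x h => by simpa using congrArg Complex.im h) 1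
    (fun x => by
      rw [norm_inv]
      refine inv_le_one_of_one_le₀ ?_
      simpa using Complex.abs_im_le_norm ((x : ℂ) - Complex.I))

theorem resolventFunction_apply (x : ℝ) : resolventFunction x = ((x : ℂ) - Complex.I)⁻¹ := rfl

/-- The function which, at `z = (x - i)⁻¹`, takes the value `(x - i)⁻¹ h x`. -/
noncomputable def cayleyCutoff (h : ℝ →ᵇ ℂ) (z : ℂ) : ℂ := z * h (z⁻¹).re

/-- The point z = 0 stands for x = ±∞, where h need not have a limit; the factor z restores
continuity there. -/
theorem continuous_cayleyCutoff (h : ℝ →ᵇ ℂ) : Continuous (cayleyCutoff h) := by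
  rw [continuous_iff_continuousAt]
  intro z
  by_cases hz : z = 0
  · subst hz
    rw [ContinuousAt]
    have h0 : cayleyCutoff h 0 = 0 := by simp [cayleyCutoff]
    rw [h0]
    refine squeeze_zero_norm (a := fun z : ℂ => ‖z‖ * ‖h‖) (fun z => ?_) ?_
    · rw [cayleyCutoff, norm_mul]
      gcongr
      exact h.norm_coe_le_norm _
    · exact (Continuous.tendsto' (by fun_prop) _ _ (by simp))
  · exact continuousAt_id.mul (h.continuous.continuousAt.comp
      (Complex.continuous_re.continuousAt.comp (continuousAt_inv₀ hz)))

@[fun_prop]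
theorem continuousOn_cayleyCutoff (h : ℝ →ᵇ ℂ) (s : Set ℂ) : ContinuousOn (cayleyCutoff h) s :=
  (continuous_cayleyCutoff h).continuousOn

variable {H : Type*} [NormedAddCommGroup H] [InnerProductSpace ℂ H] [CompleteSpace H]

section

variable {R : H →L[ℂ] H}

theorem cayleyCutoff_add (h k : ℝ →ᵇ ℂ) :
    cfc (cayleyCutoff (h + k)) R = cfc (cayleyCutoff h) R + cfc (cayleyCutoff k) R := by
  rw [← cfc_add (a := R) _ _]
  congr 1; ext z; simp [cayleyCutoff, mul_add]

theorem cayleyCutoff_smul (c : ℂ) (h : ℝ →ᵇ ℂ) :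
    cfc (cayleyCutoff (c • h)) R = c • cfc (cayleyCutoff h) R := by
  rw [← cfc_smul c _ R]
  congr 1; ext z; simp [cayleyCutoff]; ring

theorem cayleyCutoff_one (hn : IsStarNormal R) : cfc (cayleyCutoff 1) R = R := by
  conv_rhs => rw [← cfc_id' ℂ R]
  congr 1; ext z; simp [cayleyCutoff]

theorem cayleyCutoff_mul (hn : IsStarNormal R) (h k : ℝ →ᵇ ℂ) :
    cfc (cayleyCutoff h) R * cfc (cayleyCutoff k) R = cfc (cayleyCutoff (h * k)) R * R := by
  conv_rhs => rw [← cayleyCutoff_one hn]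
  conv_rhs => rw [cayleyCutoff_one hn]; rhs; rw [← cfc_id' ℂ R]
  rw [← cfc_mul _ _ R, ← cfc_mul _ _ R]
  congr 1; ext z; simp [cayleyCutoff]; ring

theorem cayleyCutoff_star (hn : IsStarNormal R) (h : ℝ →ᵇ ℂ) :
    star (cfc (cayleyCutoff h) R) * R = star R * cfc (cayleyCutoff (star h)) R := by
  conv_lhs => rhs; rw [← cfc_id' ℂ R]
  conv_rhs => lhs; rw [← cfc_id' ℂ R]
  rw [← cfc_star, ← cfc_star, ← cfc_mul _ _ R, ← cfc_mul _ _ R]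
  congr 1; ext z; simp [cayleyCutoff]; ring

theorem commute_cayleyCutoff (hn : IsStarNormal R) (h : ℝ →ᵇ ℂ) :
    Commute (cfc (cayleyCutoff h) R) R := by
  have := cfc_commute_cfc (cayleyCutoff h) (fun z => z) R
  rwa [cfc_id' ℂ R] at this

/-- Writing ‖h‖² − |h|² as |k|² exhibits ‖h‖² R*R minus the square of the cutoff of h as another
square. Hence R v ↦ (cutoff of h)(R) v is well defined and bounded. -/
theorem norm_cayleyCutoff_le (hn : IsStarNormal R) (h : ℝ →ᵇ ℂ) (v : H) :
    ‖cfc (cayleyCutoff h) R v‖ ≤ ‖h‖ * ‖R v‖ := by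
  let k : ℝ →ᵇ ℂ := BoundedContinuousFunction.ofNormedAddCommGroup
    (fun x => (Real.sqrt (‖h‖ ^ 2 - ‖h x‖ ^ 2) : ℂ)) (by fun_prop) ‖h‖ (fun x => by
      rw [Complex.norm_real, Real.norm_of_nonneg (Real.sqrt_nonneg _)]
      exact Real.sqrt_le_iff.2 ⟨norm_nonneg _, by nlinarith [sq_nonneg ‖h x‖]⟩)
  have hk (x : ℝ) : star (k x) * k x = (‖h‖ : ℂ) ^ 2 - star (h x) * h x := by
    have h1 : k x = (Real.sqrt (‖h‖ ^ 2 - ‖h x‖ ^ 2) : ℂ) := rfl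
    have h2 : 0 ≤ ‖h‖ ^ 2 - ‖h x‖ ^ 2 := by
      have := h.norm_coe_le_norm x
      nlinarith [norm_nonneg (h x)]
    rw [h1, Complex.star_def, Complex.conj_ofReal, ← Complex.ofReal_mul,
      Real.mul_self_sqrt h2, Complex.conj_mul']
    push_cast
    rfl
  have e : star (cfc (cayleyCutoff h) R) * cfc (cayleyCutoff h) R +
      star (cfc (cayleyCutoff k) R) * cfc (cayleyCutoff k) R = ((‖h‖ : ℂ) ^ 2) • (star R * R) := by
    conv_rhs => rw [← cfc_id' ℂ R]
    rw [← cfc_star, ← cfc_star, ← cfc_star, ← cfc_mul _ _ R, ← cfc_mul _ _ R, ← cfc_mul _ _ R,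
      ← cfc_smul _ _ R, ← cfc_add (a := R) _ _]
    congr 1; ext z
    simp only [cayleyCutoff, star_mul', smul_eq_mul]
    linear_combination (star z * z) * hk (z⁻¹).re
  have e1 := congrArg (fun A : H →L[ℂ] H => (⟪v, A v⟫_ℂ).re) e
  simp only [add_apply, inner_add_right, smul_apply, inner_smul_right, mul_apply_eq_comp,
    ContinuousLinearMap.star_eq_adjoint, ContinuousLinearMap.adjoint_inner_right,
    inner_self_eq_norm_sq_to_K, Complex.coe_algebraMap, ← Complex.ofReal_pow,
    ← Complex.ofReal_mul, ← Complex.ofReal_add, Complex.ofReal_re] at e1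
  refine le_of_sq_le_sq ?_ (by positivity)
  nlinarith [sq_nonneg ‖cfc (cayleyCutoff k) R v‖]

/-- On the spectrum, Im z⁻¹ = −1 for z ≠ 0, so z⁻¹ = Re z⁻¹ − i and the resolvent function at Re z⁻¹
returns z. -/
theorem cayleyCutoff_resolventFunction (hn : IsStarNormal R)
    (hR : R - star R = (2 * Complex.I) • (star R * R)) :
    cfc (cayleyCutoff resolventFunction) R = R * R := by
  have h1 : (spectrum ℂ R).EqOn (fun z => z - star z)
      (fun z => (2 * Complex.I) • (star z * z)) := by
    rw [← cfc_eq_cfc_iff_eqOn (R := ℂ) (a := R) (p := IsStarNormal)]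
    rw [cfc_smul _ _ R, cfc_mul _ _ R, cfc_sub _ _ R, cfc_star, cfc_id' ℂ R, hR]
  conv_rhs => rw [← cfc_id' ℂ R]
  rw [← cfc_mul _ _ R]
  refine cfc_congr fun z hz => ?_
  by_cases h0 : z = 0
  · simp [h0, cayleyCutoff]
  · have h2 := h1 hz
    have h3 : ((z⁻¹).re : ℂ) - Complex.I = z⁻¹ := by
      have h4 : z.im = Complex.normSq z := by
        have := congrArg Complex.im h2
        simp [Complex.normSq_apply] at this ⊢
        linarith
      have h5 : (z⁻¹).im = -1 := by
        rw [Complex.inv_im, h4, neg_div, div_self (by simpa using h0)]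
      apply Complex.ext <;> simp [-Complex.inv_re, -Complex.inv_im, h5]
    simp only [cayleyCutoff, resolventFunction_apply, h3, inv_inv]

/-- The bounded functional calculus of an unbounded operator with resolvent `R`, in terms of
the continuous functional calculus of `R`. -/
noncomputable def resolventCalculus (R : H →L[ℂ] H) (h : ℝ →ᵇ ℂ) : H →L[ℂ] H :=
  (cfc (cayleyCutoff h) R).toLinearMap.extendOfNorm R.toLinearMap

theorem resolventCalculus_apply (hn : IsStarNormal R) (hd : DenseRange R) (h : ℝ →ᵇ ℂ) (v : H) :
    resolventCalculus R h (R v) = cfc (cayleyCutoff h) R v :=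
  LinearMap.extendOfNorm_eq (f := (cfc (cayleyCutoff h) R).toLinearMap) (e := R.toLinearMap) hd
    ⟨‖h‖, norm_cayleyCutoff_le hn h⟩ v

theorem resolventCalculus_mul_self (hn : IsStarNormal R) (hd : DenseRange R) (h : ℝ →ᵇ ℂ) :
    resolventCalculus R h * R = cfc (cayleyCutoff h) R :=
  ContinuousLinearMap.ext (resolventCalculus_apply hn hd h)

theorem ContinuousLinearMap.eq_of_mul_eq_of_denseRange {A B : H →L[ℂ] H} (hd : DenseRange R)
    (h : A * R = B * R) : A = B :=
  DFunLike.coe_injective (hd.equalizer A.continuous B.continuous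
    (funext fun v => DFunLike.congr_fun h v))

/-- `resolventCalculus` as a `*`-homomorphism. -/
noncomputable def resolventCalculusHom (hn : IsStarNormal R) (hd : DenseRange R) :
    (ℝ →ᵇ ℂ) →⋆ₐ[ℂ] (H →L[ℂ] H) :=
  have hmul := resolventCalculus_mul_self hn hd
  have hone : resolventCalculus R 1 = 1 :=
    ContinuousLinearMap.eq_of_mul_eq_of_denseRange hd (by rw [hmul, cayleyCutoff_one hn, one_mul])
  have hadd (h k : ℝ →ᵇ ℂ) :
      resolventCalculus R (h + k) = resolventCalculus R h + resolventCalculus R k :=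
    ContinuousLinearMap.eq_of_mul_eq_of_denseRange hd (by
      rw [add_mul, hmul, hmul, hmul, cayleyCutoff_add])
  have hsmul (c : ℂ) (h : ℝ →ᵇ ℂ) : resolventCalculus R (c • h) = c • resolventCalculus R h :=
    ContinuousLinearMap.eq_of_mul_eq_of_denseRange hd (by
      rw [smul_mul_assoc, hmul, hmul, cayleyCutoff_smul])
  { toFun := resolventCalculus R
    map_one' := hone
    map_mul' := fun h k => by
      -- R is cancelled twice on the right, since each factor needs its own R to become a cutoff.
      refine ContinuousLinearMap.eq_of_mul_eq_of_denseRange hd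
        (ContinuousLinearMap.eq_of_mul_eq_of_denseRange hd ?_)
      rw [hmul, mul_assoc (resolventCalculus R h), hmul, mul_assoc,
        (commute_cayleyCutoff hn k).eq, ← mul_assoc, hmul, cayleyCutoff_mul hn]
    map_zero' := by simpa using hsmul 0 0
    map_add' := hadd
    commutes' := fun c => by
      rw [Algebra.algebraMap_eq_smul_one, Algebra.algebraMap_eq_smul_one, hsmul, hone]
    map_star' := fun h => by
      -- R is cancelled on the right by density of its range, and R* on the left by testing against
      -- vectors R w.
      have e : star R * resolventCalculus R (star h) * R =
          star R * star (resolventCalculus R h) * R := by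
        rw [mul_assoc, hmul, ← cayleyCutoff_star hn, ← star_mul, hmul]
      refine ContinuousLinearMap.eq_of_mul_eq_of_denseRange hd ?_
      ext v
      refine hd.eq_of_inner_right (𝕜 := ℂ) fun w => ?_
      have := congrArg (fun A : H →L[ℂ] H => ⟪w, A v⟫_ℂ) e
      simp only [mul_assoc] at this
      rw [mul_apply_eq_comp, mul_apply_eq_comp (star R), ContinuousLinearMap.star_eq_adjoint R,
        ContinuousLinearMap.adjoint_inner_right, ContinuousLinearMap.adjoint_inner_right] at this
      exact this }

theorem resolventCalculusHom_apply (hn : IsStarNormal R) (hd : DenseRange R) (h : ℝ →ᵇ ℂ) :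
    resolventCalculusHom hn hd h = resolventCalculus R h := rfl

theorem resolventCalculusHom_resolventFunction (hn : IsStarNormal R) (hd : DenseRange R)
    (hR : R - star R = (2 * Complex.I) • (star R * R)) :
    resolventCalculusHom hn hd resolventFunction = R :=
  ContinuousLinearMap.eq_of_mul_eq_of_denseRange hd (by
    rw [resolventCalculusHom_apply, resolventCalculus_mul_self hn hd,
      cayleyCutoff_resolventFunction hn hR])

end

variable {T : H →ₗ.[ℂ] H}

/-- The calculus of the bounded normal operator R = (T − i)⁻¹ is transported to T. If g(x) = x f(x)
and k = g − if, then f is k times the resolvent function, so f(T) = R k(T) maps into the domain and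
T f(T) = (1 + iR) k(T) = g(T). -/
theorem IsSelfAdjoint.exists_isBoundedFunctionalCalculus (hT : IsSelfAdjoint T) :
    ∃ φ, IsBoundedFunctionalCalculus T φ := by
  have hs := hT.isFormalAdjoint
  have hc : starRingEnd ℂ Complex.I = -Complex.I := Complex.conj_I
  have hc' : starRingEnd ℂ (-Complex.I) = -(-Complex.I) := by simp
  obtain ⟨R, hR⟩ := hT.exists_isResolvent hc Complex.I_ne_zero
  obtain ⟨R', hR'⟩ := hT.exists_isResolvent hc' (neg_ne_zero.2 Complex.I_ne_zero)
  have hst := hR.star_eq hR' hs hc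
  have h1 := hR.sub_star hs hc
  have h2 := hR'.sub_star hs hc'
  rw [← hst, star_star] at h2
  -- R* is the resolvent at −i; comparing the two identities for R − R* gives R*R = RR*.
  have hn : IsStarNormal R := ⟨by
    have h3 : (2 * Complex.I) • (star R * R) = (2 * Complex.I) • (R * star R) := by
      rw [← h1, ← neg_sub, h2, mul_neg, neg_smul, neg_neg]
    exact smul_right_injective _ (by simp : (2 * Complex.I) ≠ 0) h3⟩
  have hd := hR.denseRange hs hc Complex.I_ne_zero hT.dense_domain
  refine ⟨resolventCalculusHom hn hd, fun f g hfg v => ?_⟩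
  have hr := resolventCalculusHom_resolventFunction hn hd h1
  set φ := resolventCalculusHom hn hd
  set k : ℝ →ᵇ ℂ := g - Complex.I • f with hk
  have hf : f = resolventFunction * k := by
    ext x
    have hx : (x : ℂ) - Complex.I ≠ 0 := fun h => by simpa using congrArg Complex.im h
    simp only [BoundedContinuousFunction.mul_apply, resolventFunction_apply, hk,
      BoundedContinuousFunction.sub_apply, BoundedContinuousFunction.smul_apply, smul_eq_mul, hfg,
      ← sub_mul]
    field_simp
  have hfv : φ f v = R (φ k v) := by
    conv_lhs => rw [hf]
    rw [map_mul, hr]; rfl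
  have hg : g = k + Complex.I • f := by rw [hk, sub_add_cancel]
  refine ⟨hfv ▸ hR.mem _, ?_⟩
  have h4 := hR.apply (φ k v)
  simp only [hfv]
  rw [h4, ← hfv]
  conv_rhs => rw [hg]
  rw [map_add, map_smul]; rfl

end FunctionalCalculus

/-! ### Commutation with bounded functions of an operator. -/

section FunctionalCalculusCommute

theorem BoundedContinuousFunction.cfc_apply {f : ℂ → ℂ} (hf : Continuous f) (a : ℝ →ᵇ ℂ) (x : ℝ) :
    cfc f a x = f (a x) := by
  let ev : (ℝ →ᵇ ℂ) →⋆ₐ[ℂ] ℂ :=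
    { toFun := fun g => g x
      map_one' := rfl
      map_mul' := fun _ _ => rfl
      map_zero' := rfl
      map_add' := fun _ _ => rfl
      commutes' := fun _ => rfl
      map_star' := fun _ => rfl }
  have h := StarAlgHomClass.map_cfc ev f a hf.continuousOn
    (map_continuous ev)
  have h2 := cfc_algebraMap (A := ℂ) (a x) f
  simp only [Algebra.algebraMap_self, RingHom.id_apply] at h2
  exact h.trans h2

variable {H : Type*} [NormedAddCommGroup H] [InnerProductSpace ℂ H] [CompleteSpace H]
  {T : H →ₗ.[ℂ] H} {φ : (ℝ →ᵇ ℂ) →⋆ₐ[ℂ] (H →L[ℂ] H)}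

theorem cayleyCutoff_apply_resolventFunction (h : ℝ →ᵇ ℂ) :
    cfc (cayleyCutoff h) resolventFunction = h * resolventFunction := by
  ext x
  rw [BoundedContinuousFunction.cfc_apply (continuous_cayleyCutoff h)]
  simp [cayleyCutoff, resolventFunction_apply, mul_comm]

theorem resolventFunction_ne (x : ℝ) : (x : ℂ) - Complex.I ≠ 0 :=
  fun h => by simpa using congrArg Complex.im h

theorem resolventFunction_ne' (x : ℝ) : (x : ℂ) + Complex.I ≠ 0 :=
  fun h => by simpa using congrArg Complex.im h

namespace IsBoundedFunctionalCalculus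

theorem isResolvent (hφ : IsBoundedFunctionalCalculus T φ) :
    IsResolvent T Complex.I (φ resolventFunction) := by
  intro v
  obtain ⟨h, h'⟩ := hφ resolventFunction (1 + Complex.I • resolventFunction) (fun x => by
    have := resolventFunction_ne x
    simp [resolventFunction_apply]
    field_simp
    ring) v
  refine ⟨h, ?_⟩
  rw [h', map_add, map_one, map_smul]; rfl

theorem isResolvent_star (hφ : IsBoundedFunctionalCalculus T φ) :
    IsResolvent T (-Complex.I) (φ (star resolventFunction)) := by
  intro v
  obtain ⟨h, h'⟩ := hφ (star resolventFunction) (1 + (-Complex.I) • star resolventFunction)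
    (fun x => by
      have := resolventFunction_ne' x
      simp [resolventFunction_apply]
      field_simp
      ring) v
  refine ⟨h, ?_⟩
  rw [h', map_add, map_one, map_smul]; rfl

/-- The calculus inside `boundedFunction` is an arbitrary choice, so any φ has to be covered. With r
the resolvent function, φ(h r) is a continuous function of R = φ(r). An operator commuting with R
and R* therefore commutes with φ(h) R, and R has dense range. -/
theorem commute (hφ : IsBoundedFunctionalCalculus T φ) (hT : T.IsFormalAdjoint T)
    (hd : Dense (T.domain : Set H)) {X : H →L[ℂ] H} (hX : CommutesWithUnbounded X T)
    (h : ℝ →ᵇ ℂ) : Commute X (φ h) := by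
  have hI : starRingEnd ℂ Complex.I = -Complex.I := Complex.conj_I
  have h1 := hφ.isResolvent.commute hT hI Complex.I_ne_zero hX
  have h2 := hφ.isResolvent_star.commute hT (by simp) (neg_ne_zero.2 Complex.I_ne_zero) hX
  have hdr := hφ.isResolvent.denseRange hT hI Complex.I_ne_zero hd
  have h3 : φ (h * resolventFunction) = cfc (cayleyCutoff h) (φ resolventFunction) := by
    rw [← cayleyCutoff_apply_resolventFunction]
    exact StarAlgHomClass.map_cfc φ _ _ (continuousOn_cayleyCutoff h _)
      (map_continuous φ)
  have h4 : Commute X (φ (h * resolventFunction)) := by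
    rw [h3]
    rw [map_star] at h2
    exact (h1.symm.cfc (by simpa using h2.symm) _).symm
  refine ContinuousLinearMap.eq_of_mul_eq_of_denseRange hdr ?_
  rw [mul_assoc, ← map_mul, h4.eq, map_mul, mul_assoc, mul_assoc, h1.eq]

end IsBoundedFunctionalCalculus

theorem isBoundedFunctionalCalculus_choose (h : ∃ φ, IsBoundedFunctionalCalculus T φ) (f : ℝ →ᵇ ℝ) :
    boundedFunction T f = h.choose (toComplexBCF f) := by
  rw [boundedFunction, dif_pos h]

theorem norm_toComplexBCF_le (f : ℝ →ᵇ ℝ) : ‖toComplexBCF f‖ ≤ ‖f‖ :=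
  BoundedContinuousFunction.norm_ofNormedAddCommGroup_le _ (norm_nonneg f) _

theorem norm_boundedFunction_le (f : ℝ →ᵇ ℝ) : ‖boundedFunction T f‖ ≤ ‖f‖ := by
  by_cases h : ∃ φ, IsBoundedFunctionalCalculus T φ
  · rw [isBoundedFunctionalCalculus_choose h]
    exact (NonUnitalStarAlgHom.norm_apply_le h.choose _).trans (norm_toComplexBCF_le f)
  · rw [boundedFunction, dif_neg h, norm_zero]
    exact norm_nonneg f

theorem star_toComplexBCF (f : ℝ →ᵇ ℝ) : star (toComplexBCF f) = toComplexBCF f := by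
  ext x
  exact Complex.conj_ofReal _

theorem isSelfAdjoint_boundedFunction (f : ℝ →ᵇ ℝ) : IsSelfAdjoint (boundedFunction T f) := by
  by_cases h : ∃ φ, IsBoundedFunctionalCalculus T φ
  · rw [isBoundedFunctionalCalculus_choose h, IsSelfAdjoint, ← map_star, star_toComplexBCF]
  · rw [boundedFunction, dif_neg h]
    exact IsSelfAdjoint.zero _

/-- Only symmetry and a dense domain are required, because this is applied to closures of
differences. If there is no calculus, the default value 0 commutes with everything. -/
theorem commute_boundedFunction (hT : T.IsFormalAdjoint T) (hd : Dense (T.domain : Set H))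
    {X : H →L[ℂ] H} (hX : CommutesWithUnbounded X T) (f : ℝ →ᵇ ℝ) :
    Commute X (boundedFunction T f) := by
  by_cases h : ∃ φ, IsBoundedFunctionalCalculus T φ
  · rw [isBoundedFunctionalCalculus_choose h]
    exact h.choose_spec.commute hT hd hX _
  · rw [boundedFunction, dif_neg h]
    exact Commute.zero_right X

/-- An operator commuting with all bounded continuous functions of a self-adjoint operator
commutes with that operator. -/
theorem IsSelfAdjoint.commutesWithUnbounded_of_commute (hT : IsSelfAdjoint T) {X : H →L[ℂ] H}
    (hX : ∀ f : ℝ →ᵇ ℝ, Commute X (boundedFunction T f)) : CommutesWithUnbounded X T := by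
  have h := hT.exists_isBoundedFunctionalCalculus
  have hφ := h.choose_spec
  simp only [isBoundedFunctionalCalculus_choose h] at hX
  refine hφ.isResolvent.commutesWithUnbounded hT.isFormalAdjoint Complex.conj_I
    Complex.I_ne_zero ?_
  -- `boundedFunction` takes real functions only, so the resolvent function is split into real and
  -- imaginary parts.
  let u : ℝ →ᵇ ℝ := BoundedContinuousFunction.ofNormedAddCommGroup
    (fun x => (resolventFunction x).re)
    (Complex.continuous_re.comp resolventFunction.continuous) ‖resolventFunction‖
    (fun x => (Complex.abs_re_le_norm _).trans (resolventFunction.norm_coe_le_norm x))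
  let v : ℝ →ᵇ ℝ := BoundedContinuousFunction.ofNormedAddCommGroup
    (fun x => (resolventFunction x).im)
    (Complex.continuous_im.comp resolventFunction.continuous) ‖resolventFunction‖
    (fun x => (Complex.abs_im_le_norm _).trans (resolventFunction.norm_coe_le_norm x))
  have e : resolventFunction = toComplexBCF u + Complex.I • toComplexBCF v := by
    ext x
    have := Complex.re_add_im (resolventFunction x)
    rw [mul_comm] at this
    exact this.symm
  rw [e, map_add, map_smul]
  exact (hX u).add_right ((hX v).smul_right _)

end FunctionalCalculusCommute

/-! ### Generated von Neumann algebras and commutants. -/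

section GeneratedAlgebra

variable {H : Type*} [NormedAddCommGroup H] [InnerProductSpace ℂ H] [CompleteSpace H]

theorem mem_generatedVNAOfUnbounded {𝒯 : Set (H →ₗ.[ℂ] H)} {Z : H →L[ℂ] H} :
    Z ∈ generatedVNAOfUnbounded 𝒯 ↔ ∀ X : H →L[ℂ] H,
      (∀ T ∈ 𝒯, CommutesWithUnbounded X T ∧ CommutesWithUnbounded (star X) T) →
        X * Z = Z * X := by
  change Z ∈ StarSubalgebra.centralizer ℂ _ ↔ _
  rw [StarSubalgebra.mem_centralizer_iff]
  refine ⟨fun h X hX => (h X hX).1, fun h X hX => ⟨h X hX, h _ fun T hT => ?_⟩⟩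
  rw [star_star]
  exact (hX T hT).symm

/-- The resolvents of `T ∈ 𝒯` belong to the algebra generated by `𝒯`. -/
theorem IsResolvent.mem_generatedVNAOfUnbounded {𝒯 : Set (H →ₗ.[ℂ] H)} {T : H →ₗ.[ℂ] H}
    (hT : T.IsFormalAdjoint T) (hT𝒯 : T ∈ 𝒯) {c : ℂ} (hc : starRingEnd ℂ c = -c) (hc0 : c ≠ 0)
    {R : H →L[ℂ] H} (hR : IsResolvent T c R) : R ∈ generatedVNAOfUnbounded 𝒯 :=
  _root_.mem_generatedVNAOfUnbounded.2 fun _ hX => hR.commute hT hc hc0 (hX T hT𝒯).1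

theorem commutesWithUnbounded_of_mem_commutant {𝒯 : Set (H →ₗ.[ℂ] H)} {T : H →ₗ.[ℂ] H}
    (hT : IsSelfAdjoint T) (hT𝒯 : T ∈ 𝒯) {X : H →L[ℂ] H}
    (hX : X ∈ (generatedVNAOfUnbounded 𝒯).commutant) : CommutesWithUnbounded X T := by
  obtain ⟨R, hR⟩ := hT.exists_isResolvent Complex.conj_I Complex.I_ne_zero
  refine hR.commutesWithUnbounded hT.isFormalAdjoint Complex.conj_I Complex.I_ne_zero ?_
  exact (VonNeumannAlgebra.mem_commutant_iff.1 hX R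
    (hR.mem_generatedVNAOfUnbounded hT.isFormalAdjoint hT𝒯 Complex.conj_I Complex.I_ne_zero)).symm

/-- Closure of S under adjoints identifies the star-centralizer with the plain centralizer, so the
plain bicommutant can be used. -/
theorem mem_generatedVNA {S : Set (H →L[ℂ] H)} (hS : ∀ X ∈ S, star X ∈ S) {Z : H →L[ℂ] H} :
    Z ∈ generatedVNA S ↔ Z ∈ Set.centralizer (Set.centralizer S) := by
  have h : (StarSubalgebra.centralizer ℂ S : Set (H →L[ℂ] H)) = Set.centralizer S := by
    ext X
    rw [SetLike.mem_coe, StarSubalgebra.mem_centralizer_iff]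
    exact ⟨fun h A hA => (h A hA).1, fun h A hA => ⟨h A hA, h _ (hS A hA)⟩⟩
  change Z ∈ StarSubalgebra.centralizer ℂ _ ↔ _
  rw [StarSubalgebra.mem_centralizer_iff, ← h]
  exact ⟨fun h A hA => (h A hA).1, fun h A hA => ⟨h A hA, h _ (star_mem hA)⟩⟩

theorem subset_generatedVNA (S : Set (H →L[ℂ] H)) {X : H →L[ℂ] H} (hX : X ∈ S) :
    X ∈ generatedVNA S := by
  change X ∈ StarSubalgebra.centralizer ℂ _
  rw [StarSubalgebra.mem_centralizer_iff]
  intro A hA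
  have h := (StarSubalgebra.mem_centralizer_iff ℂ).1 hA X hX
  have h' := (StarSubalgebra.mem_centralizer_iff ℂ).1 (star_mem hA) X hX
  exact ⟨h.1.symm, h'.1.symm⟩

theorem generatedVNA_le {S : Set (H →L[ℂ] H)} {N : VonNeumannAlgebra H}
    (hS : ∀ X ∈ S, X ∈ N) : generatedVNA S ≤ N := by
  intro Z hZ
  rw [← N.commutant_commutant, VonNeumannAlgebra.mem_commutant_iff]
  intro A hA
  have hZ' := (StarSubalgebra.mem_centralizer_iff ℂ).1 hZ A
  refine (hZ' ?_).1
  refine (StarSubalgebra.mem_centralizer_iff ℂ).2 fun X hX => ?_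
  exact ⟨VonNeumannAlgebra.mem_commutant_iff.1 hA X (hS X hX),
    VonNeumannAlgebra.mem_commutant_iff.1 hA _ (star_mem (hS X hX))⟩

end GeneratedAlgebra

/-! ### Closures of differences of unbounded operators. -/

section ClosureOfDifference

variable {H : Type*} [NormedAddCommGroup H] [InnerProductSpace ℂ H] [CompleteSpace H]
  {T T₁ T₂ : H →ₗ.[ℂ] H}

theorem commutesWithUnbounded_iff_graph {X : H →L[ℂ] H} :
    CommutesWithUnbounded X T ↔ ∀ p ∈ T.graph, (X p.1, X p.2) ∈ T.graph := by
  constructor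
  · rintro h ⟨a, b⟩ hp
    obtain ⟨v, rfl, rfl⟩ := T.mem_graph_iff.1 hp
    obtain ⟨h1, h2⟩ := h v
    exact T.mem_graph_iff.2 ⟨⟨X v, h1⟩, rfl, h2⟩
  · intro h v
    obtain ⟨w, hw, hw'⟩ := T.mem_graph_iff.1 (h _ (T.mem_graph v))
    dsimp only at hw hw'
    refine ⟨hw ▸ w.2, ?_⟩
    rw [← hw']
    congr 1
    exact Subtype.ext hw.symm

theorem LinearPMap.IsFormalAdjoint.isClosable (hT : T.IsFormalAdjoint T)
    (hd : Dense (T.domain : Set H)) : T.IsClosable :=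
  (LinearPMap.adjoint_isClosed hd).isClosable.leIsClosable (hT.le_adjoint hd)

/-- Symmetry is a closed condition on pairs of points of the graph. -/
theorem isFormalAdjoint_closure (hT : T.IsFormalAdjoint T)
    (hd : Dense (T.domain : Set H)) : T.closure.IsFormalAdjoint T.closure := by
  have hg := (hT.isClosable hd).graph_closure_eq_closure_graph
  have key : ∀ p ∈ closure (T.graph : Set (H × H)), ∀ q ∈ closure (T.graph : Set (H × H)),
      ⟪p.2, q.1⟫_ℂ = ⟪p.1, q.2⟫_ℂ := by
    intro p hp q hq
    have hpq : (p, q) ∈ closure ((T.graph : Set (H × H)) ×ˢ (T.graph : Set (H × H))) := by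
      rw [closure_prod_eq]; exact ⟨hp, hq⟩
    have hcl : IsClosed {r : (H × H) × (H × H) | ⟪r.1.2, r.2.1⟫_ℂ = ⟪r.1.1, r.2.2⟫_ℂ} :=
      isClosed_eq (by fun_prop) (by fun_prop)
    refine hcl.closure_subset_iff.2 ?_ hpq
    rintro ⟨⟨a, b⟩, ⟨c, d⟩⟩ ⟨h1, h2⟩
    obtain ⟨v, rfl, rfl⟩ := T.mem_graph_iff.1 h1
    obtain ⟨w, rfl, rfl⟩ := T.mem_graph_iff.1 h2
    exact hT v w
  intro v w
  have hv := T.closure.mem_graph v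
  have hw := T.closure.mem_graph w
  rw [← hg] at hv hw
  exact key _ hv _ hw

theorem LinearPMap.dense_domain_closure (hd : Dense (T.domain : Set H)) :
    Dense (T.closure.domain : Set H) :=
  hd.mono T.le_closure.1

theorem CommutesWithUnbounded.closure {X : H →L[ℂ] H} (h : CommutesWithUnbounded X T)
    (hT : T.IsClosable) : CommutesWithUnbounded X T.closure := by
  rw [commutesWithUnbounded_iff_graph, ← hT.graph_closure_eq_closure_graph]
  rw [commutesWithUnbounded_iff_graph] at h
  intro p hp
  exact map_mem_closure (f := fun p : H × H => (X p.1, X p.2)) (by fun_prop) hp h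

theorem CommutesWithUnbounded.sub {X : H →L[ℂ] H} (h₁ : CommutesWithUnbounded X T₁)
    (h₂ : CommutesWithUnbounded X T₂) : CommutesWithUnbounded X (T₁ - T₂) := by
  intro v
  obtain ⟨a, ha⟩ := h₁ ⟨v, v.2.1⟩
  obtain ⟨b, hb⟩ := h₂ ⟨v, v.2.2⟩
  refine ⟨⟨a, b⟩, ?_⟩
  rw [LinearPMap.sub_apply, LinearPMap.sub_apply, map_sub]
  exact congrArg₂ _ ha hb

theorem LinearPMap.IsFormalAdjoint.sub (h₁ : T₁.IsFormalAdjoint T₁)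
    (h₂ : T₂.IsFormalAdjoint T₂) : (T₁ - T₂).IsFormalAdjoint (T₁ - T₂) := by
  intro v w
  rw [LinearPMap.sub_apply, LinearPMap.sub_apply, inner_sub_left, inner_sub_right]
  exact congrArg₂ _ (h₁ ⟨v, v.2.1⟩ ⟨w, w.2.1⟩) (h₂ ⟨v, v.2.2⟩ ⟨w, w.2.2⟩)

/-- The range of R₁R₂ = R₂R₁ lies in both domains and is dense. -/
theorem IsResolvent.dense_domain_sub {c : ℂ} {R₁ R₂ : H →L[ℂ] H} (hR₁ : IsResolvent T₁ c R₁)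
    (hR₂ : IsResolvent T₂ c R₂) (hcomm : R₁ * R₂ = R₂ * R₁) (hd₁ : DenseRange R₁)
    (hd₂ : DenseRange R₂) : Dense ((T₁ - T₂).domain : Set H) := by
  refine (hd₁.comp hd₂ R₁.continuous).mono ?_
  rintro _ ⟨v, rfl⟩
  refine ⟨hR₁.mem _, ?_⟩
  have : (R₁ ∘ R₂) v = R₂ (R₁ v) := DFunLike.congr_fun hcomm v
  rw [this]
  exact hR₂.mem _

end ClosureOfDifference

/-! ### Structure of the observation algebras. -/

namespace FilteringData

variable {A H : Type*} [CStarAlgebra A] [PartialOrder A] [StarOrderedRing A]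
  [NormedAddCommGroup H] [InnerProductSpace ℂ H] [CompleteSpace H] {n : ℕ}
  {D : FilteringData A H n}

theorem Yt_mono (D : FilteringData A H n) {s t : ℝ≥0} (h : s ≤ t) : D.Yt s ≤ D.Yt t := by
  intro Z hZ
  refine mem_generatedVNAOfUnbounded.2 fun X hX => mem_generatedVNAOfUnbounded.1 hZ X ?_
  rintro T ⟨r, hr, k, rfl⟩
  exact hX _ ⟨r, hr.trans h, k, rfl⟩

theorem Yt_le_Yinf (D : FilteringData A H n) (t : ℝ≥0) : D.Yt t ≤ D.Yinf := fun _ hX =>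
  subset_generatedVNA _ (Set.mem_iUnion.2 ⟨t, hX⟩)

namespace IsModel

theorem commutesWithUnbounded_of_mem_commutant_Yt (hD : D.IsModel) {t : ℝ≥0} {X : H →L[ℂ] H}
    (hX : X ∈ (D.Yt t).commutant) {s : ℝ≥0} (hs : s ≤ t) (k : Fin n) :
    CommutesWithUnbounded X (D.Y s k) :=
  commutesWithUnbounded_of_mem_commutant (𝒯 := {T | ∃ s ≤ t, ∃ k, T = D.Y s k})
    (hD.Y_selfAdjoint s k) ⟨s, hs, k, rfl⟩ hX

theorem commutant_Yinf_le (D : FilteringData A H n) (t : ℝ≥0) {X : H →L[ℂ] H}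
    (hX : X ∈ D.Yinf.commutant) : X ∈ (D.Yt t).commutant :=
  VonNeumannAlgebra.mem_commutant_iff.2 fun _ hZ =>
    VonNeumannAlgebra.mem_commutant_iff.1 hX _ (D.Yt_le_Yinf t hZ)

theorem Yt_le_Mt (hD : D.IsModel) (t : ℝ≥0) : D.Yt t ≤ D.Mt t := by
  intro Z hZ
  rw [← (D.Mt t).commutant_commutant, VonNeumannAlgebra.mem_commutant_iff]
  have key : ∀ X ∈ (D.Mt t).commutant, ∀ s ≤ t, ∀ k, CommutesWithUnbounded X (D.Y s k) :=
    fun X hX s hs k => hD.Y_affiliated s k X (VonNeumannAlgebra.mem_commutant_iff.2 fun _ hW =>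
      VonNeumannAlgebra.mem_commutant_iff.1 hX _ (hD.Mt_mono hs hW))
  intro X hX
  refine mem_generatedVNAOfUnbounded.1 hZ X ?_
  rintro T ⟨s, hs, k, rfl⟩
  exact ⟨key X hX s hs k, key _ (star_mem hX) s hs k⟩

theorem Yt_le_M (hD : D.IsModel) (t : ℝ≥0) : D.Yt t ≤ D.M :=
  (hD.Yt_le_Mt t).trans (hD.Mt_le t)

theorem Yinf_le_M (hD : D.IsModel) : D.Yinf ≤ D.M :=
  generatedVNA_le fun X hX => by
    obtain ⟨t, ht⟩ := Set.mem_iUnion.1 hX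
    exact hD.Yt_le_M t ht

/-- The observations up to some finite time form a `*`-algebra. -/
def finiteTimeObservations (D : FilteringData A H n) : StarSubalgebra ℂ (H →L[ℂ] H) where
  carrier := ⋃ t, (D.Yt t : Set (H →L[ℂ] H))
  mul_mem' := by
    intro X Y hX hY
    obtain ⟨s, hs⟩ := Set.mem_iUnion.1 hX
    obtain ⟨t, ht⟩ := Set.mem_iUnion.1 hY
    exact Set.mem_iUnion.2 ⟨max s t, mul_mem (D.Yt_mono (le_max_left s t) hs)
      (D.Yt_mono (le_max_right s t) ht)⟩
  add_mem' := by
    intro X Y hX hY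
    obtain ⟨s, hs⟩ := Set.mem_iUnion.1 hX
    obtain ⟨t, ht⟩ := Set.mem_iUnion.1 hY
    exact Set.mem_iUnion.2 ⟨max s t, add_mem (D.Yt_mono (le_max_left s t) hs)
      (D.Yt_mono (le_max_right s t) ht)⟩
  algebraMap_mem' c := Set.mem_iUnion.2 ⟨0, (D.Yt 0).toStarSubalgebra.algebraMap_mem' c⟩
  star_mem' := by
    intro X hX
    obtain ⟨s, hs⟩ := Set.mem_iUnion.1 hX
    exact Set.mem_iUnion.2 ⟨s, star_mem (show X ∈ D.Yt s from hs)⟩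

theorem centralizer_centralizer_finiteTimeObservations (D : FilteringData A H n) :
    Set.centralizer (Set.centralizer (finiteTimeObservations D : Set (H →L[ℂ] H))) = D.Yinf := by
  ext Z
  exact (mem_generatedVNA (fun X hX => star_mem (S := StarSubalgebra ℂ (H →L[ℂ] H))
    (s := finiteTimeObservations D) hX)).symm

/-- For a commutative S, S ⊆ S' gives S'' ⊆ S''' = S', so S'' is commutative. -/
theorem commute_Yinf (hD : D.IsModel) {X Y : H →L[ℂ] H} (hX : X ∈ D.Yinf) (hY : Y ∈ D.Yinf) :
    X * Y = Y * X := by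
  have h1 : (finiteTimeObservations D : Set (H →L[ℂ] H)) ⊆
      Set.centralizer (finiteTimeObservations D : Set (H →L[ℂ] H)) := by
    intro X hX Y hY
    obtain ⟨s, hs⟩ := Set.mem_iUnion.1 hX
    obtain ⟨t, ht⟩ := Set.mem_iUnion.1 hY
    exact hD.selfNondemolition (max s t) _ (D.Yt_mono (le_max_right s t) ht) _
      (D.Yt_mono (le_max_left s t) hs)
  have h2 := centralizer_centralizer_finiteTimeObservations D
  have h3 : X ∈ Set.centralizer (finiteTimeObservations D : Set (H →L[ℂ] H)) := by
    rw [← Set.centralizer_centralizer_centralizer]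
    exact Set.centralizer_subset (Set.centralizer_subset h1) (h2 ▸ hX)
  exact (((h2 ▸ hY : Y ∈ Set.centralizer (Set.centralizer _)) X h3))

/-- Both resolvents lie in the commutative algebra 𝔜_{s+t]}, so the difference is densely defined
and its closure symmetric. The commutant of 𝔜 commutes with both observations, hence with the closed
difference and its bounded functions; the bicommutant theorem concludes. -/
theorem boundedFunction_increment_mem_Yinf (hD : D.IsModel) (s t : ℝ≥0) (k : Fin n)
    (f : ℝ →ᵇ ℝ) : boundedFunction (D.increment s t k) f ∈ D.Yinf := by
  have hT₁ := hD.Y_selfAdjoint (s + t) k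
  have hT₂ := hD.Y_selfAdjoint s k
  have hsym := hT₁.isFormalAdjoint.sub hT₂.isFormalAdjoint
  have hI := Complex.conj_I
  have hI0 := Complex.I_ne_zero
  have hd : Dense ((D.Y (s + t) k - D.Y s k).domain : Set H) := by
    obtain ⟨R₁, hR₁⟩ := hT₁.exists_isResolvent hI hI0
    obtain ⟨R₂, hR₂⟩ := hT₂.exists_isResolvent hI hI0
    refine hR₁.dense_domain_sub hR₂ (hD.selfNondemolition (s + t) _ ?_ _ ?_)
      (hR₁.denseRange hT₁.isFormalAdjoint hI hI0 hT₁.dense_domain)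
      (hR₂.denseRange hT₂.isFormalAdjoint hI hI0 hT₂.dense_domain)
    · exact hR₁.mem_generatedVNAOfUnbounded (𝒯 := {T | ∃ r ≤ s + t, ∃ k, T = D.Y r k})
        hT₁.isFormalAdjoint ⟨s + t, le_rfl, k, rfl⟩ hI hI0
    · exact hR₂.mem_generatedVNAOfUnbounded (𝒯 := {T | ∃ r ≤ s + t, ∃ k, T = D.Y r k})
        hT₂.isFormalAdjoint
        ⟨s, le_self_add, k, rfl⟩ hI hI0
  rw [← D.Yinf.commutant_commutant, VonNeumannAlgebra.mem_commutant_iff]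
  intro X hX
  have hX' := commutant_Yinf_le D (s + t) hX
  refine (commute_boundedFunction (isFormalAdjoint_closure hsym hd)
    (LinearPMap.dense_domain_closure hd)
    (CommutesWithUnbounded.closure ?_ (hsym.isClosable hd)) f).eq
  exact (hD.commutesWithUnbounded_of_mem_commutant_Yt hX' le_rfl k).sub
    (hD.commutesWithUnbounded_of_mem_commutant_Yt hX' le_self_add k)

theorem boundedFunction_Y_mem_Yt (hD : D.IsModel) (t : ℝ≥0) (k : Fin n) (f : ℝ →ᵇ ℝ) :
    boundedFunction (D.Y t k) f ∈ D.Yt t :=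
  mem_generatedVNAOfUnbounded.2 fun _ hX =>
    (commute_boundedFunction (hD.Y_selfAdjoint t k).isFormalAdjoint
      (hD.Y_selfAdjoint t k).dense_domain (hX _ ⟨t, le_rfl, k, rfl⟩).1 f).eq

end IsModel

end FilteringData

/-! ### Quadratic partitions of unity in commutative algebras. -/

section PartitionOfUnity

/-- Fine quadratic partitions of unity: given finitely many functions `a`, there are finitely
many `g i` with `∑ (g i)² = 1` such that each `a` is almost constant on the support of `g i`. -/
theorem ContinuousMap.exists_quadratic_partition {Ω : Type*} [TopologicalSpace Ω] [CompactSpace Ω]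
    [T2Space Ω] {κ : Type*} (F : Finset κ) (a : κ → C(Ω, ℂ)) {δ : ℝ} (hδ : 0 < δ) :
    ∃ (m : ℕ) (g : Fin m → C(Ω, ℂ)) (c : Fin m → κ → ℂ), (∀ i, star (g i) = g i) ∧
      ∑ i, g i * g i = 1 ∧ ∀ i, ∀ l ∈ F, ∃ k : C(Ω, ℂ), star k * k +
        star ((a l - c i l • 1) * g i) * ((a l - c i l • 1) * g i) =
          ((δ ^ 2 : ℝ) : ℂ) • (star (g i) * g i) := by
  let U : Ω → Set Ω := fun x => ⋂ l ∈ F, {y | ‖a l y - a l x‖ < δ}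
  have hUo (x : Ω) : IsOpen (U x) :=
    isOpen_biInter_finset fun l _ => isOpen_lt (by fun_prop) continuous_const
  have hUx (x : Ω) : x ∈ U x := Set.mem_iInter₂.2 fun l _ => by simpa using hδ
  obtain ⟨t, ht⟩ := CompactSpace.elim_nhds_subcover U fun x => (hUo x).mem_nhds (hUx x)
  let e : Fin t.card ≃ t := t.equivFin.symm
  obtain ⟨f, hf⟩ := PartitionOfUnity.exists_isSubordinate (s := (Set.univ : Set Ω)) isClosed_univ
    (fun i => U (e i)) (fun i => hUo _) (fun y _ => by
      have hy : y ∈ ⋃ x ∈ t, U x := ht ▸ Set.mem_univ y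
      obtain ⟨x, hx, hxy⟩ := Set.mem_iUnion₂.1 hy
      exact Set.mem_iUnion.2 ⟨e.symm ⟨x, hx⟩, by simpa using hxy⟩)
  have hsum (y : Ω) : ∑ i, f i y = 1 := by
    rw [← finsum_eq_sum_of_fintype]; exact f.sum_eq_one (Set.mem_univ y)
  have hfU (i : Fin t.card) (y : Ω) (h : f i y ≠ 0) : y ∈ U (e i) :=
    hf i (subset_tsupport _ h)
  refine ⟨t.card, fun i => ⟨fun y => (Real.sqrt (f i y) : ℂ), by fun_prop⟩,
    fun i l => a l (e i), fun i => ?_, ?_, fun i l hl => ?_⟩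
  · ext y
    exact Complex.conj_ofReal _
  · ext y
    simp only [ContinuousMap.sum_apply, ContinuousMap.mul_apply, ContinuousMap.coe_mk,
      ContinuousMap.one_apply, ← Complex.ofReal_mul, Real.mul_self_sqrt (f.nonneg _ y)]
    exact_mod_cast hsum y
  -- k is the square root of (δ² − |a − c|²) g², nonnegative wherever g ≠ 0. It certifies |(a − c)
  -- g|² ≤ δ² |g|² by an algebraic identity, which a `*`-homomorphism preserves.
  · refine ⟨⟨fun y => ((Real.sqrt (δ ^ 2 - ‖a l y - a l (e i)‖ ^ 2) * Real.sqrt (f i y) : ℝ) : ℂ),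
      by fun_prop⟩, ?_⟩
    ext y
    simp only [ContinuousMap.add_apply, ContinuousMap.mul_apply, ContinuousMap.star_apply,
      ContinuousMap.coe_mk, ContinuousMap.smul_apply, ContinuousMap.sub_apply,
      ContinuousMap.one_apply, Complex.star_def, Complex.conj_mul', norm_mul,
      Complex.norm_real, smul_eq_mul, mul_one, Real.norm_eq_abs, mul_pow, sq_abs,
      ← Complex.ofReal_pow, ← Complex.ofReal_mul, ← Complex.ofReal_add]
    norm_cast
    by_cases h0 : f i y = 0
    · simp [h0]
    · have h1 := Set.mem_iInter₂.1 (hfU i y h0) l hl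
      have h2 : 0 ≤ δ ^ 2 - ‖a l y - a l (e i)‖ ^ 2 := by
        have : ‖a l y - a l (e i)‖ < δ := h1
        nlinarith [norm_nonneg (a l y - a l (e i))]
      rw [Real.sq_sqrt h2]
      ring

universe u

variable {H : Type u} [NormedAddCommGroup H] [InnerProductSpace ℂ H] [CompleteSpace H]

theorem VonNeumannAlgebra.isClosed (N : VonNeumannAlgebra H) : IsClosed (N : Set (H →L[ℂ] H)) := by
  rw [← N.centralizer_centralizer]
  exact Set.isClosed_centralizer _

theorem VonNeumannAlgebra.smul_mem (N : VonNeumannAlgebra H) (c : ℂ) {X : H →L[ℂ] H} (hX : X ∈ N) :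
    c • X ∈ N :=
  N.toStarSubalgebra.toSubalgebra.smul_mem hX c

/-- A commutative von Neumann algebra is the image of some `C(Ω, ℂ)`. -/
theorem VonNeumannAlgebra.exists_gelfand {N : VonNeumannAlgebra H}
    (hN : ∀ X ∈ N, ∀ Y ∈ N, X * Y = Y * X) :
    ∃ (Ω : Type u) (_ : TopologicalSpace Ω) (_ : CompactSpace Ω) (_ : T2Space Ω)
      (Γ : C(Ω, ℂ) →⋆ₐ[ℂ] (H →L[ℂ] H)), (∀ f, Γ f ∈ N) ∧ ∀ X ∈ N, ∃ f, Γ f = X := by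
  let S := N.toStarSubalgebra
  have : CompleteSpace S := N.isClosed.completeSpace_coe
  let _ : CommCStarAlgebra S := { (inferInstance : NormedRing S) with
    mul_comm := fun X Y => Subtype.ext (hN X X.2 Y Y.2)
    norm_mul_self_le := fun X => CStarRing.norm_mul_self_le X
    complete := CompleteSpace.complete
    __ := (inferInstance : NormedAlgebra ℂ S)
    __ := (inferInstance : StarRing S)
    __ := (inferInstance : StarModule ℂ S) }
  refine ⟨WeakDual.characterSpace ℂ S, inferInstance, inferInstance, inferInstance,
    S.subtype.comp (gelfandStarTransform S).symm, fun f => ((gelfandStarTransform S).symm f).2,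
    fun X hX => ⟨gelfandStarTransform S ⟨X, hX⟩, ?_⟩⟩
  simp

/-- The Gelfand image of the sum-of-squares identity, evaluated at a vector v, is the norm
inequality. -/
theorem VonNeumannAlgebra.exists_quadratic_partition {N : VonNeumannAlgebra H}
    (hN : ∀ X ∈ N, ∀ Y ∈ N, X * Y = Y * X) (F : Finset (H →L[ℂ] H)) {δ : ℝ} (hδ : 0 < δ) :
    ∃ (m : ℕ) (G : Fin m → H →L[ℂ] H) (c : Fin m → (H →L[ℂ] H) → ℂ),
      (∀ i, G i ∈ N) ∧ (∀ i, star (G i) = G i) ∧ ∑ i, G i * G i = 1 ∧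
      ∀ i, ∀ X ∈ F, X ∈ N → ∀ v, ‖(X - c i X • (1 : H →L[ℂ] H)) (G i v)‖ ≤ δ * ‖G i v‖ := by
  obtain ⟨Ω, _, _, _, Γ, hΓ, hΓ'⟩ := VonNeumannAlgebra.exists_gelfand hN
  have hsel : ∀ X : H →L[ℂ] H, ∃ f, X ∈ N → Γ f = X := fun X => by
    by_cases hX : X ∈ N
    · obtain ⟨f, hf⟩ := hΓ' X hX
      exact ⟨f, fun _ => hf⟩
    · exact ⟨0, fun h => absurd h hX⟩
  choose a ha using hsel
  obtain ⟨m, g, c, h1, h2, h3⟩ := ContinuousMap.exists_quadratic_partition F a hδ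
  refine ⟨m, fun i => Γ (g i), c, fun i => hΓ _, fun i => by rw [← map_star, h1], ?_,
    fun i X hX hXN v => ?_⟩
  · have := congrArg Γ h2
    simpa using this
  · obtain ⟨k, hk⟩ := h3 i X hX
    have e := congrArg (fun f => (⟪v, Γ f v⟫_ℂ).re) hk
    simp only [map_add, map_mul, map_star, map_sub, map_smul, map_one, ha X hXN] at e
    set W := X - c i X • (1 : H →L[ℂ] H)
    simp only [add_apply, inner_add_right, smul_apply, inner_smul_right, mul_apply_eq_comp,
      ContinuousLinearMap.star_eq_adjoint, ContinuousLinearMap.adjoint_inner_right, star_mul,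
      inner_self_eq_norm_sq_to_K, Complex.coe_algebraMap, ← Complex.ofReal_pow,
      ← Complex.ofReal_mul, ← Complex.ofReal_add, Complex.ofReal_re] at e
    refine le_of_sq_le_sq ?_ (by positivity)
    rw [mul_pow]
    linarith [sq_nonneg ‖Γ k v‖]

end PartitionOfUnity

/-! ### Conditional expectations onto commutative subalgebras. -/

section ConditionalExpectation

variable {H : Type*} [NormedAddCommGroup H] [InnerProductSpace ℂ H] [CompleteSpace H]

theorem ContinuousLinearMap.opNorm_le_of_inner_le {X : H →L[ℂ] H} {M : ℝ} (hM : 0 ≤ M)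
    (h : ∀ u v, ‖⟪u, X v⟫_ℂ‖ ≤ M * (‖u‖ ^ 2 + ‖v‖ ^ 2)) : ‖X‖ ≤ 2 * M := by
  refine X.opNorm_le_bound (by positivity) fun v => ?_
  by_cases h0 : ‖X v‖ = 0
  · rw [h0]; positivity
  -- The test vector is X v rescaled to norm ‖v‖, which balances the two squares.
  · have h1 := h (((‖v‖ / ‖X v‖ : ℝ) : ℂ) • X v) v
    rw [inner_smul_left, Complex.conj_ofReal, norm_mul, norm_smul, Complex.norm_real,
      Real.norm_of_nonneg (by positivity), div_mul_cancel₀ _ h0, show ‖⟪X v, X v⟫_ℂ‖ = ‖X v‖ ^ 2 by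
        rw [inner_self_eq_norm_sq_to_K]; simp,
      div_mul_eq_mul_div, sq ‖X v‖, ← mul_assoc, mul_div_cancel_right₀ _ h0] at h1
    by_cases h2 : ‖v‖ = 0
    · rw [norm_eq_zero.1 h2]; simp
    · refine le_of_mul_le_mul_left ?_ (lt_of_le_of_ne (norm_nonneg v) (Ne.symm h2))
      linarith

theorem Complex.inner_self_nonneg {K : Type*} [NormedAddCommGroup K] [InnerProductSpace ℂ K]
    (v : K) : 0 ≤ ⟪v, v⟫_ℂ :=
  Complex.nonneg_iff.2 ⟨_root_.inner_self_nonneg (𝕜 := ℂ), (inner_self_im (𝕜 := ℂ) v).symm⟩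

theorem Complex.inner_self_of_norm_eq_one {K : Type*} [NormedAddCommGroup K]
    [InnerProductSpace ℂ K] {v : K} (hv : ‖v‖ = 1) : ⟪v, v⟫_ℂ = 1 := by
  rw [inner_self_eq_norm_sq_to_K, hv]; simp

theorem Ell2.norm_le_of_forall_le {x y : Ell2 H} {δ : ℝ} (hδ : 0 ≤ δ)
    (h : ∀ n, ‖x n‖ ≤ δ * ‖y n‖) : ‖x‖ ≤ δ * ‖y‖ := by
  have e : ‖(δ : ℂ)‖ = δ := by rw [Complex.norm_real, Real.norm_of_nonneg hδ]
  have h1 : ‖x‖ ≤ ‖((δ : ℂ) • y : Ell2 H)‖ := lp.norm_mono (by simp) fun n => by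
    change ‖x n‖ ≤ ‖(δ : ℂ) • y n‖
    rw [norm_smul, e]
    exact h n
  rwa [norm_smul, e] at h1

theorem inner_amp_star_mul_self (X : H →L[ℂ] H) (x : Ell2 H) :
    ⟪x, amp (star X * X) x⟫_ℂ = ⟪amp X x, amp X x⟫_ℂ := by
  rw [inner_amp_left, amp_mul]; rfl

/-- A map into a commutative von Neumann algebra which is approximately a conditional
expectation. -/
theorem VonNeumannAlgebra.exists_approx_condExp {C : VonNeumannAlgebra H}
    (hC : ∀ X ∈ C, ∀ Y ∈ C, X * Y = Y * X) {z : Ell2 H} (hz : ‖z‖ = 1)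
    (F : Finset (H →L[ℂ] H)) {δ : ℝ} (hδ : 0 < δ) :
    ∃ E : (H →L[ℂ] H) →ₗ[ℂ] (H →L[ℂ] H), (∀ X, E X ∈ C) ∧ E 1 = 1 ∧
      (∀ X v, 0 ≤ ⟪v, E (star X * X) v⟫_ℂ) ∧ (∀ X, E (star X) = star (E X)) ∧
      (∀ X, ‖E X‖ ≤ 2 * ‖X‖) ∧
      (∀ Y ∈ F, Y ∈ C → ∀ X ∈ C.commutant, ‖E (X * Y) - E X * Y‖ ≤ 4 * δ * ‖X‖) ∧
      ∀ X ∈ C.commutant, ⟪z, amp (E X) z⟫_ℂ = ⟪z, amp X z⟫_ℂ := by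
  obtain ⟨m, G, c, hG, hGs, hG1, hGc⟩ := VonNeumannAlgebra.exists_quadratic_partition hC F hδ
  have hGin (i : Fin m) (u v : H) : ⟪u, (G i * G i) v⟫_ℂ = ⟪G i u, G i v⟫_ℂ := by
    rw [mul_apply_eq_comp, ← ContinuousLinearMap.adjoint_inner_left,
      ← ContinuousLinearMap.star_eq_adjoint, hGs]
  have hsumsq (v : H) : ∑ i, ‖G i v‖ ^ 2 = ‖v‖ ^ 2 := by
    have e := congrArg (fun X : H →L[ℂ] H => (⟪v, X v⟫_ℂ).re) hG1
    simp only [sum_apply, inner_sum, Complex.re_sum, hGin] at e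
    change _ = (⟪v, v⟫_ℂ).re at e
    have h (w : H) : (⟪w, w⟫_ℂ).re = ‖w‖ ^ 2 := inner_self_eq_norm_sq (𝕜 := ℂ) w
    simpa only [h] using e
  have hnormalize (i : Fin m) (η : Ell2 H) (hη : amp (G i) η ≠ 0) :
      ∃ ζ : Ell2 H, ζ = ((‖amp (G i) η‖⁻¹ : ℝ) : ℂ) • amp (G i) η ∧ ‖ζ‖ = 1 ∧
        ∀ Y ∈ F, Y ∈ C → ‖amp (Y - c i Y • (1 : H →L[ℂ] H)) ζ‖ ≤ δ := by
    have h0 : ‖amp (G i) η‖ ≠ 0 := norm_ne_zero_iff.2 hη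
    refine ⟨_, rfl, ?_, fun Y hYF hYC => ?_⟩
    · rw [norm_smul, Complex.norm_real, norm_inv, norm_norm, inv_mul_cancel₀ h0]
    · rw [map_smul, norm_smul, Complex.norm_real, norm_inv, norm_norm,
        inv_mul_le_iff₀ (lt_of_le_of_ne (norm_nonneg _) (Ne.symm h0)), mul_comm]
      exact Ell2.norm_le_of_forall_le hδ.le fun k => hGc i Y hYF hYC (η k)
  -- ζ i is G i z normalized. If G i z = 0 the weight vanishes, so the state condition is vacuous
  -- and any unit vector in the range of G i keeps the elements of F nearly scalar; if G i = 0, z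
  -- itself serves.
  have hζ (i : Fin m) : ∃ ζ : Ell2 H, ‖ζ‖ = 1 ∧
      (∀ X : H →L[ℂ] H, X ∈ C.commutant →
        ⟪ζ, amp X ζ⟫_ℂ * ⟪amp (G i) z, amp (G i) z⟫_ℂ = ⟪amp (G i) z, amp X (amp (G i) z)⟫_ℂ) ∧
      (G i = 0 ∨ ∀ Y ∈ F, Y ∈ C → ‖amp (Y - c i Y • (1 : H →L[ℂ] H)) ζ‖ ≤ δ) := by
    by_cases hw : amp (G i) z = 0
    · by_cases hGi : G i = 0
      · exact ⟨z, hz, fun X _ => by simp [hw], Or.inl hGi⟩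
      · obtain ⟨v, hv⟩ : ∃ v, G i v ≠ 0 := by
          by_contra! h
          exact hGi (ContinuousLinearMap.ext h)
        obtain ⟨ζ, -, h1, h2⟩ := hnormalize i (lp.single 2 0 v) fun h => hv (by
          have := congrArg (fun y : Ell2 H => y 0) h
          simpa using this)
        exact ⟨ζ, h1, fun X _ => by simp [hw], Or.inr h2⟩
    · obtain ⟨ζ, h0, h1, h2⟩ := hnormalize i z hw
      refine ⟨ζ, h1, fun X _ => ?_, Or.inr h2⟩
      have hw' : ((‖amp (G i) z‖ : ℝ) : ℂ) ≠ 0 := by simpa using hw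
      rw [h0, map_smul, inner_smul_left, inner_smul_right, Complex.conj_ofReal,
        inner_self_eq_norm_sq_to_K, Complex.ofReal_inv]
      generalize ⟪amp (G i) z, amp X (amp (G i) z)⟫_ℂ = r
      change _ * ((‖amp (G i) z‖ : ℝ) : ℂ) ^ 2 = r
      field_simp
  choose ζ hζ1 hζz hζF using hζ
  let E : (H →L[ℂ] H) →ₗ[ℂ] (H →L[ℂ] H) :=
    { toFun := fun X => ∑ i, ⟪ζ i, amp X (ζ i)⟫_ℂ • (G i * G i)
      map_add' := fun X Y => by
        simp only [amp_add, add_apply, inner_add_right, add_smul, Finset.sum_add_distrib]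
      map_smul' := fun k X => by
        simp only [amp_smul, smul_apply, inner_smul_right, mul_smul, Finset.smul_sum,
          RingHom.id_apply] }
  have hE (X : H →L[ℂ] H) : E X = ∑ i, ⟪ζ i, amp X (ζ i)⟫_ℂ • (G i * G i) := rfl
  have hinner (X : H →L[ℂ] H) (u v : H) :
      ⟪u, E X v⟫_ℂ = ∑ i, ⟪ζ i, amp X (ζ i)⟫_ℂ * ⟪G i u, G i v⟫_ℂ := by
    rw [hE, sum_apply, inner_sum]
    simp only [smul_apply, inner_smul_right, hGin]
  have hωle (i : Fin m) (X : H →L[ℂ] H) : ‖⟪ζ i, amp X (ζ i)⟫_ℂ‖ ≤ ‖X‖ := by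
    refine (norm_inner_le_norm _ _).trans ?_
    have := norm_amp_apply_le X (ζ i)
    rw [hζ1, mul_one] at this
    rwa [hζ1, one_mul]
  have hsum_le (M : ℝ) (hM : 0 ≤ M) (u v : H) (a : Fin m → ℂ)
      (ha : ∀ i, ‖a i‖ ≤ M * (‖G i u‖ * ‖G i v‖)) : ‖∑ i, a i‖ ≤ M * (‖u‖ ^ 2 + ‖v‖ ^ 2) := by
    rw [← hsumsq u, ← hsumsq v, ← Finset.sum_add_distrib, Finset.mul_sum]
    refine (norm_sum_le _ _).trans (Finset.sum_le_sum fun i _ => (ha i).trans ?_)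
    gcongr
    nlinarith [sq_nonneg (‖G i u‖ - ‖G i v‖), sq_nonneg (‖G i u‖), sq_nonneg ‖G i v‖]
  refine ⟨E, fun X => ?_, ?_, fun X v => ?_, fun X => ?_, fun X => ?_, fun Y hYF hYC X hX => ?_,
    fun X hX => ?_⟩
  · rw [hE]
    exact sum_mem fun i _ => C.smul_mem _ (mul_mem (hG i) (hG i))
  · rw [hE]
    conv_rhs => rw [← hG1]
    refine Finset.sum_congr rfl fun i _ => ?_
    rw [amp_one, show (1 : Ell2 H →L[ℂ] Ell2 H) (ζ i) = ζ i from rfl,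
      Complex.inner_self_of_norm_eq_one (hζ1 i), one_smul]
  · rw [hinner]
    refine Finset.sum_nonneg fun i _ => mul_nonneg ?_ ?_
    · rw [inner_amp_star_mul_self]
      exact Complex.inner_self_nonneg _
    · exact Complex.inner_self_nonneg _
  · rw [hE, hE, star_sum]
    refine Finset.sum_congr rfl fun i _ => ?_
    rw [star_smul, star_mul, hGs, ← inner_amp_left, Complex.star_def, inner_conj_symm]
  · refine ContinuousLinearMap.opNorm_le_of_inner_le (norm_nonneg _) fun u v => ?_
    rw [hinner]
    refine hsum_le _ (norm_nonneg _) u v _ fun i => ?_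
    rw [norm_mul]
    exact mul_le_mul (hωle i X) (norm_inner_le_norm _ _) (norm_nonneg _) (norm_nonneg _)
  · have : 4 * δ * ‖X‖ = 2 * (2 * δ * ‖X‖) := by ring
    rw [this]
    refine ContinuousLinearMap.opNorm_le_of_inner_le (by positivity) fun u v => ?_
    -- Y is nearly the scalar c i Y both on ζ i and on the range of G i, so subtracting this scalar
    -- in both places leaves two errors of order δ.
    have e : ⟪u, (E (X * Y) - E X * Y) v⟫_ℂ = ∑ i, (⟪ζ i, amp (X * (Y - c i Y • 1)) (ζ i)⟫_ℂ *
        ⟪G i u, G i v⟫_ℂ - ⟪ζ i, amp X (ζ i)⟫_ℂ *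
          ⟪G i u, (Y - c i Y • (1 : H →L[ℂ] H)) (G i v)⟫_ℂ) := by
      rw [sub_apply, inner_sub_right, hinner, mul_apply_eq_comp, hinner, ← Finset.sum_sub_distrib]
      refine Finset.sum_congr rfl fun i _ => ?_
      have h1 : G i (Y v) = Y (G i v) := DFunLike.congr_fun (hC _ (hG i) _ hYC) v
      rw [h1, mul_sub, mul_smul_comm, mul_one, amp_sub, amp_smul, sub_apply, smul_apply, sub_apply,
        smul_apply, inner_sub_right, inner_sub_right, inner_smul_right, inner_smul_right]
      change _ = _ - _ * (_ - _ * ⟪G i u, G i v⟫_ℂ)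
      ring
    rw [e]
    refine hsum_le _ (by positivity) u v _ fun i => ?_
    rcases hζF i with h0 | h0
    · simp [h0]
    · have h1 : ‖⟪ζ i, amp (X * (Y - c i Y • 1)) (ζ i)⟫_ℂ‖ ≤ ‖X‖ * δ := by
        refine (norm_inner_le_norm _ _).trans ?_
        rw [hζ1, one_mul, amp_mul, mul_apply_eq_comp]
        exact (norm_amp_apply_le _ _).trans (by gcongr; exact h0 Y hYF hYC)
      have h2 : ‖⟪G i u, (Y - c i Y • (1 : H →L[ℂ] H)) (G i v)⟫_ℂ‖ ≤ ‖G i u‖ * (δ * ‖G i v‖) :=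
        (norm_inner_le_norm _ _).trans (by gcongr; exact hGc i Y hYF hYC v)
      calc _ ≤ (‖X‖ * δ) * (‖G i u‖ * ‖G i v‖) + ‖X‖ * (‖G i u‖ * (δ * ‖G i v‖)) := by
            refine (norm_sub_le _ _).trans (add_le_add ?_ ?_)
            · rw [norm_mul]
              exact mul_le_mul h1 (norm_inner_le_norm _ _) (norm_nonneg _) (by positivity)
            · rw [norm_mul]
              exact mul_le_mul (hωle i X) h2 (norm_nonneg _) (norm_nonneg _)
        _ = _ := by ring
  · have h1 : amp (E X) = ∑ i, ⟪ζ i, amp X (ζ i)⟫_ℂ • (amp (G i) * amp (G i)) := by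
      rw [hE, ← ampHom_apply, map_sum]
      simp only [ampHom_apply, amp_smul, amp_mul]
    -- X commutes with the G i, so X = ∑ G i X G i.
    have h2 : amp X = ∑ i, amp (G i) * (amp X * amp (G i)) := by
      conv_lhs => rw [← mul_one X, ← hG1, Finset.mul_sum, ← ampHom_apply, map_sum]
      refine Finset.sum_congr rfl fun i _ => ?_
      rw [ampHom_apply, ← mul_assoc, ← VonNeumannAlgebra.mem_commutant_iff.1 hX _ (hG i), amp_mul,
        amp_mul, mul_assoc]
    have h3 (i : Fin m) (x y : Ell2 H) : ⟪x, amp (G i) y⟫_ℂ = ⟪amp (G i) x, y⟫_ℂ := by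
      rw [inner_amp_left, hGs]
    conv_rhs => rw [h2]
    rw [h1, sum_apply, sum_apply, inner_sum, inner_sum]
    refine Finset.sum_congr rfl fun i _ => ?_
    rw [smul_apply, inner_smul_right, mul_apply_eq_comp, h3, hζz i X hX, mul_apply_eq_comp, h3,
      mul_apply_eq_comp]

/-- Bounded families of operators converge weakly along ultrafilters. -/
theorem ContinuousLinearMap.exists_weak_limit {ι : Type*} (U : Ultrafilter ι)
    (T : ι → H →L[ℂ] H) {M : ℝ} (hM : ∀ k, ‖T k‖ ≤ M) :
    ∃ S : H →L[ℂ] H, ∀ u v, Tendsto (fun k => ⟪u, T k v⟫_ℂ) U (𝓝 ⟪u, S v⟫_ℂ) := by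
  have hM0 : 0 ≤ M := by
    obtain ⟨k⟩ : Nonempty ι := U.nonempty_of_mem univ_mem |>.elim fun k _ => ⟨k⟩
    exact (norm_nonneg _).trans (hM k)
  have hb (u v : H) (k : ι) : ‖⟪u, T k v⟫_ℂ‖ ≤ M * ‖u‖ * ‖v‖ := by
    refine (norm_inner_le_norm _ _).trans ?_
    have := (T k).le_of_opNorm_le (hM k) v
    nlinarith [norm_nonneg u]
  have hlim (u v : H) : ∃ l : ℂ, ‖l‖ ≤ M * ‖u‖ * ‖v‖ ∧
      Tendsto (fun k => ⟪u, T k v⟫_ℂ) U (𝓝 l) := by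
    obtain ⟨l, hl, hl'⟩ := (isCompact_closedBall (0 : ℂ) (M * ‖u‖ * ‖v‖)).ultrafilter_le_nhds
      (U.map fun k => ⟪u, T k v⟫_ℂ) (by
        rw [le_principal_iff]
        exact Filter.Eventually.of_forall (f := (U : Filter ι)) fun k => by simpa using hb u v k)
    exact ⟨l, by simpa using hl, hl'⟩
  choose ℓ hℓ hℓ' using hlim
  let B : H →L⋆[ℂ] H →L[ℂ] ℂ := LinearMap.mkContinuous₂
    (LinearMap.mk₂'ₛₗ (starRingEnd ℂ) (RingHom.id ℂ) ℓ
      (fun u u' v => tendsto_nhds_unique (hℓ' _ _) (by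
        simpa only [inner_add_left] using (hℓ' u v).add (hℓ' u' v)))
      (fun c u v => tendsto_nhds_unique (hℓ' _ _) (by
        simpa only [inner_smul_left, smul_eq_mul] using (hℓ' u v).const_mul (starRingEnd ℂ c)))
      (fun u v v' => tendsto_nhds_unique (hℓ' _ _) (by
        simpa only [map_add, inner_add_right] using (hℓ' u v).add (hℓ' u v')))
      (fun c u v => tendsto_nhds_unique (hℓ' _ _) (by
        simpa only [map_smul, inner_smul_right, smul_eq_mul, RingHom.id_apply] using
          (hℓ' u v).const_mul c))) M
    (fun u v => hℓ u v)
  refine ⟨star (InnerProductSpace.continuousLinearMapOfBilin B), fun u v => ?_⟩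
  rw [ContinuousLinearMap.star_eq_adjoint, ContinuousLinearMap.adjoint_inner_right,
    InnerProductSpace.continuousLinearMapOfBilin_apply]
  exact hℓ' u v

/-- Boundedness upgrades weak to σ-weak convergence, by dominated convergence over the coordinates.
State preservation thereby passes to the limit. -/
theorem tendsto_inner_amp {ι : Type*} {l : Filter ι} [l.NeBot] {T : ι → H →L[ℂ] H} {M : ℝ}
    (hM : ∀ k, ‖T k‖ ≤ M) {S : H →L[ℂ] H}
    (hT : ∀ u v, Tendsto (fun k => ⟪u, T k v⟫_ℂ) l (𝓝 ⟪u, S v⟫_ℂ)) (z : Ell2 H) :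
    Tendsto (fun k => ⟪z, amp (T k) z⟫_ℂ) l (𝓝 ⟪z, amp S z⟫_ℂ) := by
  simp only [lp.inner_eq_tsum]
  refine tendsto_tsum_of_dominated_convergence (bound := fun n => M * ‖z n‖ ^ 2) ?_
    (fun n => hT _ _) (Eventually.of_forall fun k n => ?_)
  · have := (lp.memℓp z).summable (by simp)
    simp only [ENNReal.toReal_ofNat, Real.rpow_ofNat] at this
    exact this.mul_left M
  · refine (norm_inner_le_norm _ _).trans ?_
    rw [amp_apply]
    have := (T k).le_of_opNorm_le (hM k) (z n)
    nlinarith [norm_nonneg (z n)]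

/-- The conditional expectation of a normal state onto a commutative von Neumann subalgebra
exists, on the relative commutant of the latter. -/
theorem IsNormalState.exists_isCondExp {N C : VonNeumannAlgebra H} {Φ : (H →L[ℂ] H) →ₗ[ℂ] ℂ}
    (hΦ : IsNormalState N Φ) (hC : ∀ X ∈ C, ∀ Y ∈ C, X * Y = Y * X) (hCN : C ≤ N) :
    ∃ E, IsCondExp Φ ((N : Set (H →L[ℂ] H)) ∩ (C.commutant : Set (H →L[ℂ] H)))
      (C : Set (H →L[ℂ] H)) E := by
  classical
  obtain ⟨z, hz, hΦz⟩ := hΦ.exists_vector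
  have hδ (k : Finset (H →L[ℂ] H) × ℕ) : (0 : ℝ) < 1 / ((k.2 : ℝ) + 1) := by positivity
  choose E hEC hE1 hEpos hEstar hEnorm hEmod hEz using
    fun k : Finset (H →L[ℂ] H) × ℕ =>
      VonNeumannAlgebra.exists_approx_condExp hC hz k.1 (hδ k)
  -- Along this ultrafilter every fixed Y eventually belongs to the finite set and the precision
  -- tends to 0, so the approximate module property becomes exact.
  let U : Ultrafilter (Finset (H →L[ℂ] H) × ℕ) := 
    Ultrafilter.of (atTop : Filter (Finset (H →L[ℂ] H) × ℕ))
  have hU : (U : Filter (Finset (H →L[ℂ] H) × ℕ)) ≤ atTop := Ultrafilter.of_le _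
  choose L hL using fun X : H →L[ℂ] H =>
    ContinuousLinearMap.exists_weak_limit U (fun k => E k X) (fun k => hEnorm k X)
  have huniq {X Y : H →L[ℂ] H} (h : ∀ u v, ⟪u, X v⟫_ℂ = ⟪u, Y v⟫_ℂ) : X = Y :=
    ContinuousLinearMap.ext fun v => ext_inner_left ℂ fun u => h u v
  let F : (H →L[ℂ] H) →ₗ[ℂ] (H →L[ℂ] H) :=
    { toFun := L
      map_add' := fun X Y => huniq fun u v => tendsto_nhds_unique (hL _ u v) (by
        simpa only [map_add, add_apply, inner_add_right] using (hL X u v).add (hL Y u v))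
      map_smul' := fun c X => huniq fun u v => tendsto_nhds_unique (hL _ u v) (by
        simpa only [map_smul, smul_apply, inner_smul_right, RingHom.id_apply, smul_eq_mul] using
          (hL X u v).const_mul c) }
  have hF (X : H →L[ℂ] H) : F X = L X := rfl
  have hFC (X : H →L[ℂ] H) : F X ∈ C := by
    rw [← C.commutant_commutant, VonNeumannAlgebra.mem_commutant_iff]
    intro S hS
    refine huniq fun u v => ?_
    have h1 := hL X (star S u) v
    have h2 := hL X u (S v)
    have e (k) : ⟪star S u, E k X v⟫_ℂ = ⟪u, E k X (S v)⟫_ℂ := by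
      rw [ContinuousLinearMap.star_eq_adjoint, ContinuousLinearMap.adjoint_inner_left]
      exact congrArg (fun A : H →L[ℂ] H => ⟪u, A v⟫_ℂ)
        (VonNeumannAlgebra.mem_commutant_iff.1 hS _ (hEC k X)).symm
    simp only [e] at h1
    have h3 := tendsto_nhds_unique h1 h2
    rwa [ContinuousLinearMap.star_eq_adjoint, ContinuousLinearMap.adjoint_inner_left] at h3
  have hFmod (X Y : H →L[ℂ] H) (hX : X ∈ C.commutant) (hY : Y ∈ C) : F (X * Y) = F X * Y := by
    refine huniq fun u v => ?_
    have h1 := (hL (X * Y) u v).sub (hL X u (Y v))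
    have hsmall : Tendsto (fun k : Finset (H →L[ℂ] H) × ℕ =>
        ‖u‖ * ((4 * (1 / ((k.2 : ℝ) + 1)) * ‖X‖) * ‖v‖)) U (𝓝 0) := by
      have h2 : Tendsto (fun k : Finset (H →L[ℂ] H) × ℕ => 1 / ((k.2 : ℝ) + 1)) U (𝓝 0) :=
        (tendsto_one_div_add_atTop_nhds_zero_nat (𝕜 := ℝ)).comp
          (tendsto_snd.comp ((prod_atTop_atTop_eq (α := Finset (H →L[ℂ] H)) (β := ℕ)).symm ▸ hU))
      simpa using (((h2.const_mul 4).mul_const ‖X‖).mul_const ‖v‖).const_mul ‖u‖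
    have h3 : Tendsto (fun k => ⟪u, E k (X * Y) v⟫_ℂ - ⟪u, E k X (Y v)⟫_ℂ) U (𝓝 0) := by
      refine squeeze_zero_norm' ?_ hsmall
      have hev : ∀ᶠ k : Finset (H →L[ℂ] H) × ℕ in U, Y ∈ k.1 :=
        hU ((eventually_ge_atTop ({Y}, 0)).mono fun k hk => hk.1 (Finset.mem_singleton_self Y))
      filter_upwards [hev] with k hk
      have e : ⟪u, E k (X * Y) v⟫_ℂ - ⟪u, E k X (Y v)⟫_ℂ = ⟪u, (E k (X * Y) - E k X * Y) v⟫_ℂ := by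
        rw [sub_apply, inner_sub_right]; rfl
      rw [e]
      refine (norm_inner_le_norm _ _).trans ?_
      gcongr
      exact ContinuousLinearMap.le_of_opNorm_le _ (hEmod k Y hk hY X hX) v
    exact sub_eq_zero.1 (tendsto_nhds_unique h1 h3)
  refine ⟨F, fun X _ => hFC X, ?_, fun X _ => ?_, fun X _ => ?_, fun X hX Y hY Z hZ => ?_,
    fun X hX => ?_⟩
  · refine huniq fun u v => tendsto_nhds_unique (hL 1 u v) ?_
    simp only [hE1]
    exact tendsto_const_nhds
  · rw [ContinuousLinearMap.nonneg_iff_isPositive, ContinuousLinearMap.isPositive_iff_complex]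
    intro v
    have h1 : 0 ≤ ⟪v, F (star X * X) v⟫_ℂ :=
      ge_of_tendsto' (hL (star X * X) v v) fun k => hEpos k X v
    rw [Complex.nonneg_iff] at h1
    have h2 : ⟪v, F (star X * X) v⟫_ℂ = ((⟪v, F (star X * X) v⟫_ℂ).re : ℂ) :=
      Complex.ext rfl h1.2.symm
    generalize (⟪v, F (star X * X) v⟫_ℂ).re = r at h1 h2
    rw [← inner_conj_symm, h2, Complex.conj_ofReal]
    exact ⟨rfl, by exact_mod_cast h1.1⟩
  · refine huniq fun u v => tendsto_nhds_unique (hL (star X) u v) ?_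
    have h1 := (Complex.continuous_conj.tendsto _).comp (hL X v u)
    rw [ContinuousLinearMap.star_eq_adjoint (F X), ContinuousLinearMap.adjoint_inner_right,
      ← inner_conj_symm]
    refine h1.congr fun k => ?_
    rw [hEstar, ContinuousLinearMap.star_eq_adjoint, ContinuousLinearMap.adjoint_inner_right,
      Function.comp_apply, inner_conj_symm]
  -- Y commutes with C, so the two-sided module property reduces to the right-sided one.
  · have e : X * Y * Z = Y * (X * Z) := by
      rw [VonNeumannAlgebra.mem_commutant_iff.1 hY.2 X hX, mul_assoc]
    rw [e, hFmod _ _ hY.2 (mul_mem (show X ∈ C from hX) hZ), ← mul_assoc, hC _ (hFC Y) _ hX]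
  · rw [hΦz _ (hCN (hFC X)), hΦz _ hX.1]
    refine tendsto_nhds_unique (tendsto_inner_amp (fun k => hEnorm k X) (hL X) z) ?_
    simp only [hEz _ X hX.2]
    exact tendsto_const_nhds

end ConditionalExpectation

/-! ### Subspaces separating the states are dense. -/

section StateSeparation

variable {A : Type*} [CStarAlgebra A] [PartialOrder A] [StarOrderedRing A]

theorem selfAdjoint.le_norm_smul_one (a : selfAdjoint A) : a ≤ ‖a‖ • (1 : selfAdjoint A) := by
  have := IsSelfAdjoint.le_algebraMap_norm_self a.2
  rw [Algebra.algebraMap_eq_smul_one] at this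
  exact this

theorem selfAdjoint.abs_le_of_nonneg {g : selfAdjoint A →ₗ[ℝ] ℝ} (hg : ∀ a, 0 ≤ a → 0 ≤ g a)
    (a : selfAdjoint A) : |g a| ≤ g 1 * ‖a‖ := by
  have h1 := hg _ (sub_nonneg.2 (selfAdjoint.le_norm_smul_one a))
  have h2 := hg _ (sub_nonneg.2 (selfAdjoint.le_norm_smul_one (-a)))
  simp only [map_sub, map_smul, map_neg, norm_neg, smul_eq_mul] at h1 h2
  rw [abs_le]
  constructor <;> linarith

theorem selfAdjoint.one_nonneg : (0 : selfAdjoint A) ≤ 1 :=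
  zero_le_one (α := A)

theorem selfAdjoint.smul_nonneg {c : ℝ} (hc : 0 ≤ c) {a : selfAdjoint A} (ha : 0 ≤ a) :
    0 ≤ c • a :=
  _root_.smul_nonneg (β := A) hc ha

/-- A positive unital functional on the self-adjoint part extends to a state. -/
theorem exists_mem_stateSpace_of_nonneg {g : selfAdjoint A →ₗ[ℝ] ℝ} (hg : ∀ a, 0 ≤ a → 0 ≤ g a)
    (hg1 : g 1 = 1) : ∃ ρ ∈ stateSpace A,
      ∀ a : A, ρ a = g (realPart a) + Complex.I * g (imaginaryPart a) := by
  let f : StrongDual ℝ A := LinearMap.mkContinuous (g.comp realPart) 1 fun a => by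
    have := selfAdjoint.abs_le_of_nonneg hg (realPart a)
    rw [hg1] at this
    exact this.trans (mul_le_mul_of_nonneg_left (realPart.norm_le a) zero_le_one)
  have hf (a : A) : (f.extendRCLike : StrongDual ℂ A) a =
      g (realPart a) + Complex.I * g (imaginaryPart a) := by
    rw [StrongDual.extendRCLike_apply]
    change ((g (realPart a) : ℝ) : ℂ) - Complex.I * ((g (realPart (Complex.I • a)) : ℝ) : ℂ) = _
    rw [realPart_I_smul, map_neg]
    push_cast
    ring
  have hsa (a : selfAdjoint A) : (f.extendRCLike : StrongDual ℂ A) a = g a := by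
    rw [hf, selfAdjoint.realPart_coe, selfAdjoint.imaginaryPart_coe]
    simp
  refine ⟨f.extendRCLike, ⟨fun a => ?_, ?_⟩, hf⟩
  · have h := hsa ⟨star a * a, .star_mul_self a⟩
    simp only at h
    rw [h]
    exact_mod_cast hg _ (star_mul_self_nonneg a)
  · have h := hsa 1
    rw [hg1] at h
    exact_mod_cast h

/-- Every bounded functional on the self-adjoint part is a difference of positive ones. -/
theorem selfAdjoint.exists_nonneg_sub_nonneg (φ : StrongDual ℝ (selfAdjoint A)) :
    ∃ g₁ g₂ : selfAdjoint A →ₗ[ℝ] ℝ, (∀ a, 0 ≤ a → 0 ≤ g₁ a) ∧ (∀ a, 0 ≤ a → 0 ≤ g₂ a) ∧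
      ∀ a, φ a = g₁ a - g₂ a := by
  rcases subsingleton_or_nontrivial (selfAdjoint A) with hA | hA
  · exact ⟨0, 0, by simp, by simp, fun a => by simp [Subsingleton.elim a 0]⟩
  have h10 : (1 : selfAdjoint A) ≠ 0 := by
    intro h
    obtain ⟨a, ha⟩ := exists_ne (0 : selfAdjoint A)
    have h' : (1 : A) = 0 := congrArg Subtype.val h
    exact ha (Subtype.ext (by rw [← mul_one (a : A), h', mul_zero]; rfl))
  obtain ⟨ψ, hψ⟩ := SeparatingDual.exists_eq_one (R := ℝ) h10
  -- A Riesz extension on pairs. On pairs with a + b = c·1 the functional F is φ(a) + ‖φ‖c, which is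
  -- positive because 0 ≤ a ≤ c·1 forces ‖a‖ ≤ c. The two components of the extension are g₁ and g₂,
  -- and the pairs (a, −a) give φ = g₁ − g₂.
  let S : Submodule ℝ (selfAdjoint A × selfAdjoint A) :=
    (Submodule.span ℝ {(1 : selfAdjoint A)}).comap (LinearMap.fst ℝ _ _ + LinearMap.snd ℝ _ _)
  have hS (p) : p ∈ S ↔ ∃ c : ℝ, c • (1 : selfAdjoint A) = p.1 + p.2 := by
    simp [S, Submodule.mem_span_singleton]
  let F : selfAdjoint A × selfAdjoint A →ₗ[ℝ] ℝ :=
    (φ : selfAdjoint A →ₗ[ℝ] ℝ).comp (LinearMap.fst ℝ _ _) +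
      ‖φ‖ • (ψ : selfAdjoint A →ₗ[ℝ] ℝ).comp (LinearMap.fst ℝ _ _ + LinearMap.snd ℝ _ _)
  have hF (p) : F p = φ p.1 + ‖φ‖ * ψ (p.1 + p.2) := rfl
  let K : PointedCone ℝ (selfAdjoint A × selfAdjoint A) :=
    { carrier := {p | 0 ≤ p.1 ∧ 0 ≤ p.2}
      add_mem' := fun hp hq => ⟨add_nonneg hp.1 hq.1, add_nonneg hp.2 hq.2⟩
      zero_mem' := ⟨le_rfl, le_rfl⟩
      smul_mem' := fun c p hp =>
        ⟨selfAdjoint.smul_nonneg c.2 hp.1, selfAdjoint.smul_nonneg c.2 hp.2⟩ }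
  obtain ⟨g, hg, hg0⟩ := riesz_extension K ⟨S, F.comp S.subtype⟩ (by
      rintro ⟨p, hp⟩ hpos
      obtain ⟨c, hc⟩ := (hS p).1 hp
      have hpos' : 0 ≤ p.1 ∧ 0 ≤ p.2 := hpos
      change 0 ≤ F p
      rw [hF, ← hc, map_smul, hψ, smul_eq_mul, mul_one]
      have hc0 : 0 ≤ c := by
        by_contra! hneg
        have h1 : 0 ≤ c • (1 : selfAdjoint A) := hc ▸ add_nonneg hpos'.1 hpos'.2
        have h2 := selfAdjoint.smul_nonneg (neg_nonneg.2 hneg.le) (selfAdjoint.one_nonneg (A := A))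
        rw [neg_smul, neg_nonneg] at h2
        exact (smul_ne_zero hneg.ne h10) (le_antisymm h2 h1)
      have hle : p.1 ≤ c • (1 : selfAdjoint A) := by
        rw [hc]
        exact le_add_of_nonneg_right hpos'.2
      have hp1 : ‖p.1‖ ≤ c := by
        have h1 : ‖(p.1 : A)‖ ≤ ‖c • (1 : A)‖ :=
          CStarAlgebra.norm_le_norm_of_nonneg_of_le hpos'.1 hle
        rw [norm_smul, Real.norm_of_nonneg hc0] at h1
        have : Nontrivial A := Subtype.val_injective.nontrivial (α := selfAdjoint A)
        rwa [CStarRing.norm_one, mul_one] at h1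
      have h2 := (abs_le.1 (φ.le_opNorm_of_le hp1)).1
      linarith) (by
      rintro ⟨a, b⟩
      have key (a : selfAdjoint A) {r : ℝ} (hr : ‖a‖ ≤ r) :
          0 ≤ r • (1 : selfAdjoint A) + a := by
        have h1 := selfAdjoint.le_norm_smul_one (-a)
        have h2 := selfAdjoint.smul_nonneg (sub_nonneg.2 hr) (selfAdjoint.one_nonneg (A := A))
        rw [norm_neg] at h1
        rw [sub_smul] at h2
        have h3 := add_nonneg (sub_nonneg.2 h1) h2
        have e : ‖a‖ • (1 : selfAdjoint A) - -a + (r • 1 - ‖a‖ • 1) = r • 1 + a := by abel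
        rwa [e] at h3
      exact ⟨⟨(max ‖a‖ ‖b‖ • 1, max ‖a‖ ‖b‖ • 1), (hS _).2
        ⟨max ‖a‖ ‖b‖ + max ‖a‖ ‖b‖, add_smul _ _ _⟩⟩,
        key a (le_max_left _ _), key b (le_max_right _ _)⟩)
  refine ⟨g.comp (LinearMap.inl ℝ _ _), g.comp (LinearMap.inr ℝ _ _),
    fun a ha => hg0 _ ⟨ha, le_rfl⟩, fun a ha => hg0 _ ⟨le_rfl, ha⟩, fun a => ?_⟩
  have h := hg ⟨(a, -a), (hS _).2 ⟨0, by simp⟩⟩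
  change g (a, -a) = F (a, -a) at h
  rw [hF] at h
  simp only [add_neg_cancel, map_zero, mul_zero, add_zero] at h
  rw [← h, LinearMap.comp_apply, LinearMap.comp_apply, ← map_sub]
  congr 1
  simp

/-- A subspace of self-adjoint elements which separates the states is dense. -/
theorem selfAdjoint.dense_of_separates_states (W : Submodule ℝ (selfAdjoint A)) (h1 : 1 ∈ W)
    (h : ∀ ρ₁ ∈ stateSpace A, ∀ ρ₂ ∈ stateSpace A,
      (∀ a ∈ W, ρ₁ (a : A) = ρ₂ (a : A)) → ρ₁ = ρ₂) (x : selfAdjoint A) :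
    x ∈ closure (W : Set (selfAdjoint A)) := by
  by_contra hx
  obtain ⟨φ, u, hφ, hu⟩ := geometric_hahn_banach_closed_point
    W.topologicalClosure.convex W.isClosed_topologicalClosure hx
  have hφW (a) (ha : a ∈ W) : φ a = 0 := by
    by_contra h0
    -- A functional bounded above on a subspace vanishes there: rescaling a would attain the strict
    -- bound u.
    have := hφ ((u / φ a) • a) (W.le_topologicalClosure (W.smul_mem _ ha))
    rw [map_smul, smul_eq_mul, div_mul_cancel₀ _ h0] at this
    exact lt_irrefl _ this
  have hφx : φ x ≠ 0 := by
    have := hφ 0 (Submodule.zero_mem _)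
    rw [map_zero] at this
    exact (this.trans hu).ne'
  obtain ⟨g₁, g₂, hg₁, hg₂, hg⟩ := selfAdjoint.exists_nonneg_sub_nonneg φ
  -- Since φ kills 1, the two positive parts have equal mass. Normalized, they are states that agree
  -- on W and differ at x.
  have hg12 : g₁ 1 = g₂ 1 := by linarith [hg 1, hφW 1 h1]
  have hg0 : g₁ 1 ≠ 0 := by
    intro h0
    have e1 := selfAdjoint.abs_le_of_nonneg hg₁ x
    have e2 := selfAdjoint.abs_le_of_nonneg hg₂ x
    rw [← hg12, h0, zero_mul, abs_nonpos_iff] at e2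
    rw [h0, zero_mul, abs_nonpos_iff] at e1
    exact hφx (by rw [hg, e1, e2, sub_zero])
  have hc : 0 ≤ (g₁ 1)⁻¹ := inv_nonneg.2 (hg₁ 1 selfAdjoint.one_nonneg)
  obtain ⟨ρ₁, hρ₁, e₁⟩ := exists_mem_stateSpace_of_nonneg (g := (g₁ 1)⁻¹ • g₁)
    (fun a ha => mul_nonneg hc (hg₁ a ha)) (inv_mul_cancel₀ hg0)
  obtain ⟨ρ₂, hρ₂, e₂⟩ := exists_mem_stateSpace_of_nonneg (g := (g₁ 1)⁻¹ • g₂)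
    (fun a ha => mul_nonneg hc (hg₂ a ha)) (by
      change (g₁ 1)⁻¹ * g₂ 1 = 1
      rw [← hg12, inv_mul_cancel₀ hg0])
  have hsa (a : selfAdjoint A) : ρ₁ (a : A) - ρ₂ (a : A) = (((g₁ 1)⁻¹ * φ a : ℝ) : ℂ) := by
    rw [e₁, e₂, selfAdjoint.realPart_coe, selfAdjoint.imaginaryPart_coe, hg]
    simp
    ring
  have := h ρ₁ hρ₁ ρ₂ hρ₂ fun a ha => sub_eq_zero.1 (by rw [hsa, hφW a ha]; simp)
  have h2 := hsa x
  rw [this, sub_self] at h2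
  have h3 : (g₁ 1)⁻¹ * φ x = 0 := by exact_mod_cast h2.symm
  exact mul_ne_zero (inv_ne_zero hg0) hφx h3

/-- A star-closed subspace which contains the unit and separates the states is dense. -/
theorem exists_norm_sub_lt_of_separates_states (V : Submodule ℂ A) (hstar : ∀ a ∈ V, star a ∈ V)
    (h1 : 1 ∈ V)
    (h : ∀ ρ₁ ∈ stateSpace A, ∀ ρ₂ ∈ stateSpace A, (∀ a ∈ V, ρ₁ a = ρ₂ a) → ρ₁ = ρ₂)
    (x : A) {ε : ℝ} (hε : 0 < ε) : ∃ a ∈ V, ‖x - a‖ < ε := by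
  let W : Submodule ℝ (selfAdjoint A) :=
    (V.restrictScalars ℝ).comap (selfAdjoint.submodule ℝ A).subtype
  have hVW (a : A) (ha : a ∈ V) : realPart a ∈ W := by
    change (realPart a : A) ∈ V
    rw [realPart_apply_coe]
    exact (V.restrictScalars ℝ).smul_mem _ (V.add_mem ha (hstar a ha))
  have hW := selfAdjoint.dense_of_separates_states W h1 fun ρ₁ hρ₁ ρ₂ hρ₂ hρ =>
    h ρ₁ hρ₁ ρ₂ hρ₂ fun a ha => by
      rw [← realPart_add_I_smul_imaginaryPart a]
      have hi : imaginaryPart a ∈ W := by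
        have := hVW _ (V.smul_mem (-Complex.I) ha)
        rwa [neg_smul, map_neg, realPart_I_smul, neg_neg] at this
      simp only [map_add, map_smul]
      rw [hρ _ (hVW a ha), hρ _ hi]
  obtain ⟨b, hb, hxb⟩ := Metric.mem_closure_iff.1 (hW (realPart x)) _ (half_pos hε)
  obtain ⟨c, hc, hxc⟩ := Metric.mem_closure_iff.1 (hW (imaginaryPart x)) _ (half_pos hε)
  refine ⟨(b : A) + Complex.I • (c : A), V.add_mem hb (V.smul_mem _ hc), ?_⟩
  have e : x - (b + Complex.I • (c : A)) = ((realPart x - b : selfAdjoint A) : A) +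
      Complex.I • ((imaginaryPart x - c : selfAdjoint A) : A) := by
    conv_lhs => rw [← realPart_add_I_smul_imaginaryPart x]
    simp only [AddSubgroupClass.coe_sub, smul_sub]
    abel
  rw [dist_eq_norm] at hxb hxc
  rw [e]
  refine (norm_add_le _ _).trans_lt ?_
  rw [norm_smul, Complex.norm_I, one_mul]
  exact (add_lt_add hxb hxc).trans_eq (add_halves ε)

end StateSeparation

/-! ### Further properties of normal states and norm bounds for expectations. -/

section NormalStates

variable {H : Type*} [NormedAddCommGroup H] [InnerProductSpace ℂ H] [CompleteSpace H]

theorem VonNeumannAlgebra.sqrt_mem {N : VonNeumannAlgebra H} {X : H →L[ℂ] H} (hX : X ∈ N)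
    (hX0 : 0 ≤ X) : CFC.sqrt X ∈ N := by
  rw [← N.commutant_commutant, VonNeumannAlgebra.mem_commutant_iff]
  intro T hT
  rw [CFC.sqrt_eq_real_sqrt X hX0]
  have hc : Commute X T := VonNeumannAlgebra.mem_commutant_iff.1 hT X hX
  exact (hc.cfcₙ_real _).eq.symm

theorem VonNeumannAlgebra.abs_mem {N : VonNeumannAlgebra H} {X : H →L[ℂ] H} (hX : X ∈ N) :
    CFC.abs X ∈ N :=
  VonNeumannAlgebra.sqrt_mem (mul_mem (star_mem hX) hX) (star_mul_self_nonneg X)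

/-- Both squared norms come from |X|² = X*X. This reduces the estimate of Φ(|X|) to an L² norm. -/
theorem norm_amp_abs_apply (X : H →L[ℂ] H) (x : Ell2 H) : ‖amp (CFC.abs X) x‖ = ‖amp X x‖ := by
  have h : ⟪amp (CFC.abs X) x, amp (CFC.abs X) x⟫_ℂ = ⟪amp X x, amp X x⟫_ℂ := by
    rw [← inner_amp_star_mul_self, ← inner_amp_star_mul_self,
      (CFC.abs_nonneg X).isSelfAdjoint.star_eq, CFC.abs_mul_abs]
  rw [inner_self_eq_norm_sq_to_K, inner_self_eq_norm_sq_to_K] at h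
  have h' : ‖amp (CFC.abs X) x‖ ^ 2 = ‖amp X x‖ ^ 2 := by exact_mod_cast h
  exact (pow_left_inj₀ (norm_nonneg _) (norm_nonneg _) two_ne_zero).1 h'

/-- A sum of two vector functionals is a vector functional. -/
theorem Ell2.exists_inner_amp_add (x₁ x₂ y₁ y₂ : Ell2 H) : ∃ x y : Ell2 H, ∀ X : H →L[ℂ] H,
    ⟪y, amp X x⟫_ℂ = ⟪y₁, amp X x₁⟫_ℂ + ⟪y₂, amp X x₂⟫_ℂ := by
  have key (x₁ x₂ : Ell2 H) : ∃ x : Ell2 H, ∀ n, x (2 * n) = x₁ n ∧ x (2 * n + 1) = x₂ n := by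
    -- The two sequences are interleaved on even and odd indices.
    let x : ℕ → H := fun n => if Even n then x₁ (n / 2) else x₂ (n / 2)
    have h0 (n) : x (2 * n) = x₁ n := by simp [x]
    have h1 (n) : x (2 * n + 1) = x₂ n := by
      have : (2 * n + 1) / 2 = n := by omega
      simp [x, this]
    have hs (z : Ell2 H) : Summable fun n => ‖z n‖ ^ 2 := by
      simpa using (lp.memℓp z).summable (by simp)
    refine ⟨⟨x, memℓp_gen ?_⟩, fun n => ⟨h0 n, h1 n⟩⟩
    simp only [ENNReal.toReal_ofNat, Real.rpow_ofNat]
    have he : HasSum (fun n => ‖x (2 * n)‖ ^ 2) (∑' n, ‖x₁ n‖ ^ 2) := by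
      simpa only [h0] using (hs x₁).hasSum
    have ho : HasSum (fun n => ‖x (2 * n + 1)‖ ^ 2) (∑' n, ‖x₂ n‖ ^ 2) := by
      simpa only [h1] using (hs x₂).hasSum
    exact (HasSum.even_add_odd (f := fun n => ‖x n‖ ^ 2) he ho).summable
  obtain ⟨x, hx⟩ := key x₁ x₂
  obtain ⟨y, hy⟩ := key y₁ y₂
  refine ⟨x, y, fun X => (lp.hasSum_inner y (amp X x)).unique (HasSum.even_add_odd ?_ ?_)⟩
  · convert lp.hasSum_inner y₁ (amp X x₁) using 2 with n
    rw [amp_apply, amp_apply, (hx n).1, (hy n).1]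
  · convert lp.hasSum_inner y₂ (amp X x₂) using 2 with n
    rw [amp_apply, amp_apply, (hx n).2, (hy n).2]

/-- Two normal states which agree on a `*`-algebra agree on its bicommutant. -/
theorem IsNormalState.eq_of_mem_bicommutant {N : VonNeumannAlgebra H}
    {Φ₁ Φ₂ : (H →L[ℂ] H) →ₗ[ℂ] ℂ} (h₁ : IsNormalState N Φ₁) (h₂ : IsNormalState N Φ₂)
    (S : StarSubalgebra ℂ (H →L[ℂ] H)) (hSN : ∀ X ∈ S, X ∈ N) (hS : ∀ X ∈ S, Φ₁ X = Φ₂ X)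
    {X : H →L[ℂ] H} (hX : X ∈ Set.centralizer (Set.centralizer (S : Set (H →L[ℂ] H))))
    (hXN : X ∈ N) : Φ₁ X = Φ₂ X := by
  obtain ⟨z₁, -, hz₁⟩ := h₁.exists_vector
  obtain ⟨z₂, -, hz₂⟩ := h₂.exists_vector
  -- The difference of the states becomes one vector functional, to which the density theorem
  -- applies at a single vector.
  obtain ⟨x, y, hxy⟩ := Ell2.exists_inner_amp_add z₁ z₂ z₁ (-z₂)
  have h0 (X) (hX : X ∈ N) : ⟪y, amp X x⟫_ℂ = Φ₁ X - Φ₂ X := by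
    rw [hxy, hz₁ X hX, hz₂ X hX, inner_neg_left, sub_eq_add_neg]
  have hcl : IsClosed {v : Ell2 H | ⟪y, v⟫_ℂ = 0} :=
    isClosed_eq (by fun_prop) continuous_const
  have : ⟪y, amp X x⟫_ℂ = 0 := hcl.closure_subset_iff.2 (by
    rintro _ ⟨A, hA, rfl⟩
    change ⟪y, amp A x⟫_ℂ = 0
    rw [h0 A (hSN A hA), hS A hA, sub_self]) (amp_mem_closure_of_mem_bicommutant S hX x)
  rw [h0 X hXN] at this
  exact sub_eq_zero.1 this

theorem IsNormalState.map_star {N : VonNeumannAlgebra H} {Φ : (H →L[ℂ] H) →ₗ[ℂ] ℂ}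
    (h : IsNormalState N Φ) {X : H →L[ℂ] H} (hX : X ∈ N) :
    Φ (star X) = starRingEnd ℂ (Φ X) := by
  obtain ⟨z, -, hz⟩ := h.exists_vector
  rw [hz _ (star_mem hX), hz X hX, ← inner_amp_left, inner_conj_symm]

/-- Indistinguishable operators have the same expectation, also after multiplication from the
left. -/
theorem IsNormalState.apply_mul_eq_of_indistinguishable {N : VonNeumannAlgebra H}
    {Φ : (H →L[ℂ] H) →ₗ[ℂ] ℂ} (h : IsNormalState N Φ) {U X Y : H →L[ℂ] H} (hU : U ∈ N)
    (hX : X ∈ N) (hY : Y ∈ N) (hXY : Indistinguishable Φ X Y) : Φ (U * X) = Φ (U * Y) := by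
  obtain ⟨z, -, hz⟩ := h.exists_vector
  have hsub : X - Y ∈ N := sub_mem hX hY
  rw [Indistinguishable, hz _ (mul_mem (star_mem hsub) hsub), inner_amp_star_mul_self,
    inner_self_eq_zero] at hXY
  rw [← sub_eq_zero, ← map_sub, ← mul_sub, hz _ (mul_mem hU hsub), amp_mul,
    mul_apply_eq_comp, hXY, map_zero, inner_zero_right]

variable {N C : VonNeumannAlgebra H} {𝔄₀ : Set (H →L[ℂ] H)} {Φ : (H →L[ℂ] H) →ₗ[ℂ] ℂ}
  {E : (H →L[ℂ] H) →ₗ[ℂ] (H →L[ℂ] H)}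

/-- E is positive and unital, so 0 ≤ X ≤ ‖X‖·1 is preserved. Square roots remain in both algebras,
which gives positivity on all positive elements of the domain. -/
theorem IsCondExp.norm_apply_le_of_nonneg
    (hE : IsCondExp Φ ((N : Set (H →L[ℂ] H)) ∩ (C : Set (H →L[ℂ] H))) 𝔄₀ E)
    {X : H →L[ℂ] H} (hXN : X ∈ N) (hXC : X ∈ C) (hX : 0 ≤ X) : ‖E X‖ ≤ ‖X‖ := by
  have hpos {X : H →L[ℂ] H} (hXN : X ∈ N) (hXC : X ∈ C) (hX : 0 ≤ X) : 0 ≤ E X := by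
    have := hE.nonneg (CFC.sqrt X)
      ⟨VonNeumannAlgebra.sqrt_mem hXN hX, VonNeumannAlgebra.sqrt_mem hXC hX⟩
    rwa [(CFC.sqrt_nonneg X).isSelfAdjoint.star_eq, CFC.sqrt_mul_sqrt_self X hX] at this
  have h1 : X ≤ (‖X‖ : ℂ) • (1 : H →L[ℂ] H) := by
    have := IsSelfAdjoint.le_algebraMap_norm_self (IsSelfAdjoint.of_nonneg hX)
    rwa [Algebra.algebraMap_eq_smul_one] at this
  have h2 := hpos (sub_mem (VonNeumannAlgebra.smul_mem N _ (one_mem N)) hXN)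
    (sub_mem (VonNeumannAlgebra.smul_mem C _ (one_mem C)) hXC) (sub_nonneg.2 h1)
  rw [map_sub, map_smul, hE.map_one, sub_nonneg] at h2
  refine (CStarAlgebra.norm_le_norm_of_nonneg_of_le (hpos hXN hXC hX) h2).trans ?_
  rw [norm_smul, Complex.norm_real, norm_norm]
  exact mul_le_of_le_one_right (norm_nonneg _) ContinuousLinearMap.norm_id_le

theorem IsCondExp.norm_apply_le_of_isSelfAdjoint
    (hE : IsCondExp Φ ((N : Set (H →L[ℂ] H)) ∩ (C : Set (H →L[ℂ] H))) 𝔄₀ E)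
    {X : H →L[ℂ] H} (hXN : X ∈ N) (hXC : X ∈ C) (hX : IsSelfAdjoint X) : ‖E X‖ ≤ 3 * ‖X‖ := by
  have h1 : 0 ≤ X + (‖X‖ : ℂ) • (1 : H →L[ℂ] H) := by
    have := hX.neg_algebraMap_norm_le_self
    rw [Algebra.algebraMap_eq_smul_one, neg_le_iff_add_nonneg] at this
    exact this
  have hb : ‖(‖X‖ : ℂ) • (1 : H →L[ℂ] H)‖ ≤ ‖X‖ := by
    rw [norm_smul, Complex.norm_real, norm_norm]
    exact mul_le_of_le_one_right (norm_nonneg _) ContinuousLinearMap.norm_id_le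
  have h2 := hE.norm_apply_le_of_nonneg
    (add_mem hXN (VonNeumannAlgebra.smul_mem N _ (one_mem N)))
    (add_mem hXC (VonNeumannAlgebra.smul_mem C _ (one_mem C))) h1
  have h3 : E X = E (X + (‖X‖ : ℂ) • (1 : H →L[ℂ] H)) - (‖X‖ : ℂ) • (1 : H →L[ℂ] H) := by
    rw [map_add, map_smul, hE.map_one, add_sub_cancel_right]
  rw [h3]
  linarith [norm_sub_le (E (X + (‖X‖ : ℂ) • (1 : H →L[ℂ] H))) ((‖X‖ : ℂ) • (1 : H →L[ℂ] H)),
    norm_add_le X ((‖X‖ : ℂ) • (1 : H →L[ℂ] H))]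

/-- Each of the two self-adjoint parts contributes 3, by shifting it by its norm to a positive
element. The constant is not sharp; only uniformity is needed. -/
theorem IsCondExp.norm_apply_le
    (hE : IsCondExp Φ ((N : Set (H →L[ℂ] H)) ∩ (C : Set (H →L[ℂ] H))) 𝔄₀ E)
    {X : H →L[ℂ] H} (hXN : X ∈ N) (hXC : X ∈ C) : ‖E X‖ ≤ 6 * ‖X‖ := by
  have hre {N : VonNeumannAlgebra H} {X : H →L[ℂ] H} (hX : X ∈ N) :
      (realPart X : H →L[ℂ] H) ∈ N := by
    rw [realPart_apply_coe]
    have := VonNeumannAlgebra.smul_mem N ((2 : ℝ)⁻¹ : ℂ) (add_mem hX (star_mem hX))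
    exact_mod_cast this
  have him {N : VonNeumannAlgebra H} {X : H →L[ℂ] H} (hX : X ∈ N) :
      (imaginaryPart X : H →L[ℂ] H) ∈ N := by
    have := hre (VonNeumannAlgebra.smul_mem N (-Complex.I) hX)
    rwa [neg_smul, map_neg, realPart_I_smul, neg_neg] at this
  have h1 := hE.norm_apply_le_of_isSelfAdjoint (hre hXN) (hre hXC) (realPart X).2
  have h2 := hE.norm_apply_le_of_isSelfAdjoint (him hXN) (him hXC) (imaginaryPart X).2
  have h3 : E X = E (realPart X) + Complex.I • E (imaginaryPart X) := by
    rw [← map_smul, ← map_add, realPart_add_I_smul_imaginaryPart]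
  rw [h3]
  refine (norm_add_le _ _).trans ?_
  rw [norm_smul, Complex.norm_I, one_mul]
  have h4 : ‖(realPart X : H →L[ℂ] H)‖ ≤ ‖X‖ := realPart.norm_le X
  have h5 : ‖(imaginaryPart X : H →L[ℂ] H)‖ ≤ ‖X‖ := imaginaryPart.norm_le X
  linarith

end NormalStates

theorem norm_prod_ofFn_le {H : Type*} [NormedAddCommGroup H] [NormedSpace ℂ H] {m : ℕ}
    {X : Fin m → (H →L[ℂ] H)} {c : Fin m → ℝ} (h : ∀ i, ‖X i‖ ≤ c i) :
    ‖(List.ofFn X).prod‖ ≤ (List.ofFn c).prod := by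
  induction m with
  | zero =>
    rw [List.ofFn_zero, List.ofFn_zero, List.prod_nil, List.prod_nil]
    exact ContinuousLinearMap.norm_id_le
  | succ m ih =>
    rw [List.ofFn_succ, List.ofFn_succ, List.prod_cons, List.prod_cons]
    exact (norm_mul_le _ _).trans (mul_le_mul (h 0) (ih fun i => h i.succ) (norm_nonneg _)
      ((norm_nonneg _).trans (h 0)))

/-! ### Existence of filters and density of the observed elements. -/

namespace FilteringData.IsModel

variable {A H : Type*} [CStarAlgebra A] [PartialOrder A] [StarOrderedRing A]
  [NormedAddCommGroup H] [InnerProductSpace ℂ H] [CompleteSpace H] {n : ℕ}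
  {D : FilteringData A H n}

theorem exists_isFilter (hD : D.IsModel) (ρ : stateSpace A) : ∃ π, D.IsFilter ρ π := by
  choose E hE using fun t => (hD.normalState ρ).exists_isCondExp (hD.selfNondemolition t)
    (hD.Yt_le_M t)
  exact ⟨fun t X => E t (D.j t X), fun t => ⟨E t, hE t, fun _ => rfl⟩⟩

theorem j_mem_M (hD : D.IsModel) (t : ℝ≥0) (X : A) : D.j t X ∈ D.M :=
  hD.Mt_le t (hD.j_mem t X)

theorem norm_j_le (D : FilteringData A H n) (t : ℝ≥0) (X : A) : ‖D.j t X‖ ≤ ‖X‖ :=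
  NonUnitalStarAlgHom.norm_apply_le (D.j t) X

theorem commute_j (hD : D.IsModel) {t : ℝ≥0} {U : H →L[ℂ] H} (hU : U ∈ D.Yt t) (X : A) :
    U * D.j t X = D.j t X * U :=
  VonNeumannAlgebra.mem_commutant_iff.1 (hD.nondemolition t X) U hU

/-- The elements `Z` for which `j_s(Z)` is, uniformly in `s`, represented by a bounded
observable. -/
def observedElements (D : FilteringData A H n) : Submodule ℂ A where
  carrier := {Z | ∃ c : ℝ, ∀ s, ∃ F ∈ D.Yinf, ‖F‖ ≤ c ∧
    ∀ ρ, ∀ U ∈ D.Yt s, D.Φ ρ (U * D.j s Z) = D.Φ ρ (U * F)}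
  add_mem' := by
    rintro Z Z' ⟨c, hc⟩ ⟨c', hc'⟩
    refine ⟨c + c', fun s => ?_⟩
    obtain ⟨F, hF, hFc, h⟩ := hc s
    obtain ⟨F', hF', hFc', h'⟩ := hc' s
    refine ⟨F + F', add_mem hF hF', (norm_add_le _ _).trans (add_le_add hFc hFc'),
      fun ρ U hU => ?_⟩
    rw [map_add, mul_add, map_add, h ρ U hU, h' ρ U hU, mul_add, map_add]
  zero_mem' := ⟨0, fun s => ⟨0, zero_mem _, by simp, fun ρ U _ => by simp⟩⟩
  smul_mem' := by
    rintro a Z ⟨c, hc⟩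
    refine ⟨‖a‖ * c, fun s => ?_⟩
    obtain ⟨F, hF, hFc, h⟩ := hc s
    refine ⟨a • F, VonNeumannAlgebra.smul_mem _ _ hF, ?_, fun ρ U hU => ?_⟩
    · rw [norm_smul]
      gcongr
    · rw [map_smul, mul_smul_comm, map_smul, h ρ U hU, mul_smul_comm, map_smul]

/-- Taking adjoints reverses products; nondemolition lets U pass j_s(Z), and commutativity of 𝔜 lets
it pass F. -/
theorem star_mem_observedElements (hD : D.IsModel) {Z : A} (hZ : Z ∈ observedElements D) :
    star Z ∈ observedElements D := by
  obtain ⟨c, hc⟩ := hZ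
  refine ⟨c, fun s => ?_⟩
  obtain ⟨F, hF, hFc, h⟩ := hc s
  refine ⟨star F, star_mem hF, by rwa [norm_star], fun ρ U hU => ?_⟩
  have hUs := star_mem hU
  have hUM := hD.Yt_le_M s hUs
  have e1 : U * D.j s (star Z) = star (star U * D.j s Z) := by
    rw [hD.commute_j hUs, star_mul, star_star, map_star]
  have e2 : U * star F = star (star U * F) := by
    rw [hD.commute_Yinf (D.Yt_le_Yinf s hUs) hF, star_mul, star_star]
  rw [e1, e2, (hD.normalState ρ).map_star (mul_mem hUM (hD.j_mem_M s Z)),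
    (hD.normalState ρ).map_star (mul_mem hUM (hD.Yinf_le_M hF)), h ρ _ hUs]

theorem one_mem_observedElements (D : FilteringData A H n) : 1 ∈ observedElements D :=
  ⟨1, fun s => ⟨1, one_mem _, ContinuousLinearMap.norm_id_le, fun ρ U _ => by rw [map_one]⟩⟩

/-- The Feller-type assumption provides observed elements with prescribed initial
expectations. -/
theorem exists_observedElement (hD : D.IsModel) {m : ℕ} (t : Fin m → ℝ≥0) (k : Fin m → Fin n)
    (f : Fin m → (ℝ →ᵇ ℝ)) (ht : ∀ l, 0 < t l) : ∃ Z ∈ observedElements D,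
      ∀ ρ : stateSpace A, (ρ : StrongDual ℂ A) Z =
        D.Φ ρ (List.ofFn fun l => boundedFunction (D.Y (t l) (k l)) (f l)).prod := by
  obtain ⟨Z, hZ0, hZ⟩ := hD.feller m t k f ht
  refine ⟨Z, ⟨(List.ofFn fun l => ‖f l‖).prod, fun s => ?_⟩, fun ρ => ?_⟩
  · have hmem : (List.ofFn fun l => boundedFunction (D.increment s (t l) (k l)) (f l)).prod ∈
        D.Yinf := list_prod_mem fun X hX => by
      obtain ⟨l, rfl⟩ := List.mem_ofFn.1 hX
      exact hD.boundedFunction_increment_mem_Yinf s (t l) (k l) (f l)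
    refine ⟨_, hmem, ?_, fun ρ U hU => ?_⟩
    · exact norm_prod_ofFn_le fun l => norm_boundedFunction_le (f l)
    · obtain ⟨E, hE⟩ := hD.exists_condExp ρ s
      have hUs := hD.Yt_le_Mt s hU
      have hUM := hD.Yt_le_M s hU
      have hF := hD.Yinf_le_M hmem
      -- Φ(U j_s(Z)) = Φ(U E(F)) = Φ(E(UF)) = Φ(UF), as U belongs to 𝔐_{s]}.
      have h1 := (hD.normalState ρ).apply_mul_eq_of_indistinguishable hUM
        (hD.Mt_le s (hE.mapsTo _ hF)) (hD.j_mem_M s Z) (hZ s ρ E hE)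
      rw [← h1]
      have h2 := hE.map_mul_mul U hUs _ hF 1 (one_mem _)
      rw [mul_one, mul_one] at h2
      rw [← h2]
      exact hE.state_apply _ (mul_mem hUM hF)
  · obtain ⟨E, hE⟩ := hD.exists_condExp ρ 0
    have hF : (List.ofFn fun l => boundedFunction (D.Y (t l) (k l)) (f l)).prod ∈ D.M :=
      list_prod_mem fun X hX => by
        obtain ⟨l, rfl⟩ := List.mem_ofFn.1 hX
        exact hD.Yt_le_M _ (hD.boundedFunction_Y_mem_Yt (t l) (k l) (f l))
    have h1 := (hD.normalState ρ).apply_mul_eq_of_indistinguishable (one_mem D.M)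
      (hD.Mt_le 0 (hE.mapsTo _ hF)) (hD.j_mem_M 0 Z) (hZ0 ρ E hE)
    rw [one_mul, one_mul, hE.state_apply _ hF, hD.initial] at h1
    exact h1.symm

/-- The bounded functions of the observations at positive times. -/
def boundedObservations (D : FilteringData A H n) : Set (H →L[ℂ] H) :=
  {X | ∃ t k f, 0 < t ∧ X = boundedFunction (D.Y t k) f}

theorem star_mem_boundedObservations {X : H →L[ℂ] H} (hX : X ∈ boundedObservations D) :
    star X ∈ boundedObservations D := by
  obtain ⟨t, k, f, ht, rfl⟩ := hX
  rw [(isSelfAdjoint_boundedFunction f).star_eq]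
  exact ⟨t, k, f, ht, rfl⟩

theorem Yinf_le_generatedVNA (hD : D.IsModel) :
    D.Yinf ≤ generatedVNA (boundedObservations D) := by
  refine generatedVNA_le fun Z hZ => ?_
  obtain ⟨t, ht⟩ := Set.mem_iUnion.1 hZ
  have hstar : ∀ X ∈ boundedObservations D, star X ∈ boundedObservations D :=
    fun X hX => star_mem_boundedObservations hX
  refine (mem_generatedVNA hstar).2 fun X hX => mem_generatedVNAOfUnbounded.1 ht X ?_
  rintro T ⟨s, -, k, rfl⟩
  have key {X : H →L[ℂ] H} (hX : X ∈ Set.centralizer (boundedObservations D)) :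
      CommutesWithUnbounded X (D.Y s k) := by
    -- The Feller assumption covers positive times only; nothing is lost, since the observation at
    -- time 0 is zero.
    rcases eq_or_lt_of_le (zero_le (a := s)) with rfl | hs
    · rw [hD.Y_zero]
      exact fun v => ⟨trivial, (map_zero X).symm⟩
    · exact (hD.Y_selfAdjoint s k).commutesWithUnbounded_of_commute fun f =>
        (hX _ ⟨s, k, f, hs, rfl⟩).symm
  refine ⟨key hX, key ?_⟩
  intro Z hZ
  have := congrArg star (hX _ (hstar Z hZ))
  rw [star_mul, star_mul, star_star] at this
  exact this.symm

/-- In an observable model, the observed elements separate the states. -/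
theorem eq_of_forall_observedElements (hD : D.IsModel) (hobs : D.Observable) (ρ₁ ρ₂ : stateSpace A)
    (h : ∀ Z ∈ observedElements D, (ρ₁ : StrongDual ℂ A) Z = (ρ₂ : StrongDual ℂ A) Z) :
    ρ₁ = ρ₂ := by
  by_contra hne
  refine hobs ⟨ρ₁, ρ₂, hne, fun Y hY => ?_⟩
  have hstar : ∀ X ∈ boundedObservations D, star X ∈ boundedObservations D :=
    fun X hX => star_mem_boundedObservations hX
  -- Agreement on observed elements gives agreement on products of bounded observations, then on
  -- their span by linearity, and finally on 𝔜 by normality.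
  have hprod : ∀ X ∈ Submonoid.closure (boundedObservations D), D.Φ ρ₁ X = D.Φ ρ₂ X := by
    intro X hX
    obtain ⟨l, hl, rfl⟩ := Submonoid.exists_list_of_mem_closure hX
    choose t k f ht hf using fun i : Fin l.length => hl (l.get i) (l.get_mem i)
    obtain ⟨Z, hZ, hZρ⟩ := hD.exists_observedElement t k f ht
    have e : l = List.ofFn fun i => boundedFunction (D.Y (t i) (k i)) (f i) := by
      simp only [← hf]
      exact (List.ofFn_get l).symm
    rw [e, ← hZρ, ← hZρ, h Z hZ]
  have hS : ∀ X ∈ StarAlgebra.adjoin ℂ (boundedObservations D), D.Φ ρ₁ X = D.Φ ρ₂ X := by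
    intro X hX
    have hU : boundedObservations D ∪ star (boundedObservations D) = boundedObservations D :=
      Set.union_eq_self_of_subset_right fun X hX => by
        simpa using hstar _ hX
    have hX' : X ∈ Submodule.span ℂ
        (Submonoid.closure (boundedObservations D) : Set (H →L[ℂ] H)) := by
      rw [← Algebra.adjoin_eq_span, ← hU, ← StarAlgebra.adjoin_toSubalgebra]
      exact hX
    exact LinearMap.eqOn_span (f := D.Φ ρ₁) (g := D.Φ ρ₂) hprod hX'
  refine (hD.normalState ρ₁).eq_of_mem_bicommutant (hD.normalState ρ₂)
    (StarAlgebra.adjoin ℂ (boundedObservations D)) ?_ hS ?_ (hD.Yinf_le_M hY)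
  · have : StarAlgebra.adjoin ℂ (boundedObservations D) ≤ D.M.toStarSubalgebra :=
      StarAlgebra.adjoin_le (by
        rintro _ ⟨t, k, f, -, rfl⟩
        exact hD.Yt_le_M t (hD.boundedFunction_Y_mem_Yt t k f))
    exact this
  · exact Set.centralizer_subset (Set.centralizer_subset (StarAlgebra.subset_adjoin ℂ _))
      ((mem_generatedVNA hstar).1 (hD.Yinf_le_generatedVNA hY))

/-- This is where observability enters: separation of states becomes approximation in norm. -/
theorem exists_observedElement_near (hD : D.IsModel) (hobs : D.Observable) (X : A) {ε : ℝ}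
    (hε : 0 < ε) : ∃ Z ∈ observedElements D, ‖X - Z‖ < ε :=
  exists_norm_sub_lt_of_separates_states _ (fun _ => hD.star_mem_observedElements)
    (one_mem_observedElements D) (fun ρ₁ h₁ ρ₂ h₂ h =>
      congrArg Subtype.val (hD.eq_of_forall_observedElements hobs ⟨ρ₁, h₁⟩ ⟨ρ₂, h₂⟩ h)) X hε

end FilteringData.IsModel

/-! ### Merging of the filters. -/

namespace FilteringData.IsModel

variable {A H : Type*} [CStarAlgebra A] [PartialOrder A] [StarOrderedRing A]
  [NormedAddCommGroup H] [InnerProductSpace ℂ H] [CompleteSpace H] {n : ℕ}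
  {D : FilteringData A H n}

theorem filter_mem {ρ : stateSpace A} {π : ℝ≥0 → A → (H →L[ℂ] H)} (hD : D.IsModel)
    (hπ : D.IsFilter ρ π) (t : ℝ≥0) (X : A) : π t X ∈ D.Yt t := by
  obtain ⟨E, hE, h⟩ := hπ t
  rw [h]
  exact hE.mapsTo _ ⟨hD.j_mem_M t X, hD.nondemolition t X⟩

theorem norm_filter_le {ρ : stateSpace A} {π : ℝ≥0 → A → (H →L[ℂ] H)} (hD : D.IsModel)
    (hπ : D.IsFilter ρ π) (t : ℝ≥0) (X : A) : ‖π t X‖ ≤ 6 * ‖X‖ := by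
  obtain ⟨E, hE, h⟩ := hπ t
  rw [h]
  have h1 := hE.norm_apply_le (hD.j_mem_M t X) (hD.nondemolition t X)
  linarith [norm_j_le D t X]

theorem filter_sub {ρ : stateSpace A} {π : ℝ≥0 → A → (H →L[ℂ] H)}
    (hπ : D.IsFilter ρ π) (t : ℝ≥0) (X Y : A) : π t (X - Y) = π t X - π t Y := by
  obtain ⟨E, -, h⟩ := hπ t
  rw [h, h, h, map_sub, map_sub]

/-- The defining property of the filter. -/
theorem state_mul_filter {ρ : stateSpace A} {π : ℝ≥0 → A → (H →L[ℂ] H)} (hD : D.IsModel)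
    (hπ : D.IsFilter ρ π) {t : ℝ≥0} {U : H →L[ℂ] H} (hU : U ∈ D.Yt t) (X : A) :
    D.Φ ρ (U * π t X) = D.Φ ρ (U * D.j t X) := by
  obtain ⟨E, hE, h⟩ := hπ t
  have hUc : U ∈ (D.Yt t).commutant :=
    VonNeumannAlgebra.mem_commutant_iff.2 fun V hV => hD.selfNondemolition t V hV U hU
  have h1 := hE.map_mul_mul U hU _ ⟨hD.j_mem_M t X, hD.nondemolition t X⟩ 1 (one_mem (D.Yt t))
  rw [mul_one, mul_one] at h1
  rw [h, ← h1]
  exact hE.state_apply _ ⟨mul_mem (hD.Yt_le_M t hU) (hD.j_mem_M t X),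
    mul_mem hUc (hD.nondemolition t X)⟩

/-- For observed elements, the filters with two initial states merge. -/
theorem tendsto_norm_amp_filter_sub_of_mem_observedElements (hD : D.IsModel)
    {ρ₁ ρ₂ : stateSpace A} (hac : D.ObsAbsolutelyContinuous ρ₁ ρ₂)
    {π₁ π₂ : ℝ≥0 → A → (H →L[ℂ] H)} (hπ₁ : D.IsFilter ρ₁ π₁) (hπ₂ : D.IsFilter ρ₂ π₂)
    {z₁ : Ell2 H} (hz₁ : ∀ X ∈ D.M, D.Φ ρ₁ X = ⟪z₁, amp X z₁⟫_ℂ) {Z : A}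
    (hZ : Z ∈ observedElements D) {ε : ℝ} (hε : 0 < ε) :
    ∀ᶠ t in atTop, ‖amp (π₁ t Z - π₂ t Z) z₁‖ ^ 2 ≤ ε := by
  obtain ⟨z₂, -, hz₂⟩ := (hD.normalState ρ₂).exists_vector
  obtain ⟨c, hc⟩ := hZ
  have hc0 : 0 ≤ c := by
    obtain ⟨F, -, h, -⟩ := hc 0
    exact (norm_nonneg F).trans h
  -- The two factors of δ are the norm bounds `n1` and `n2` below, uniform in t.
  obtain ⟨δ, hδ, hδε⟩ : ∃ δ > 0, δ * (12 * ‖Z‖ * c) + δ * (12 * ‖Z‖ * (6 * ‖Z‖)) ≤ ε := by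
    have hK : 0 < 12 * ‖Z‖ * c + 12 * ‖Z‖ * (6 * ‖Z‖) + 1 := by positivity
    refine ⟨ε / _, div_pos hε hK, ?_⟩
    rw [← mul_add, div_mul_eq_mul_div, div_le_iff₀ hK]
    exact mul_le_mul_of_nonneg_left (by linarith) hε.le
  obtain ⟨B, hB, happrox⟩ := D.Yinf.exists_approx_density (finiteTimeObservations D)
    (centralizer_centralizer_finiteTimeObservations D) z₁ z₂ (fun p hp hproj h2 => by
      have hpp : star p * p = p := by rw [hproj.isSelfAdjoint.star_eq, hproj.isIdempotentElem.eq]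
      have h1 := hac p hp hproj (by rw [hz₂ _ (hD.Yinf_le_M hp), h2, inner_zero_right])
      rwa [hz₁ _ (hD.Yinf_le_M hp), ← hpp, inner_amp_star_mul_self, inner_self_eq_zero] at h1) hδ
  obtain ⟨T, hT⟩ := Set.mem_iUnion.1 hB
  filter_upwards [eventually_ge_atTop T] with t ht
  have hBt : B ∈ D.Yt t := D.Yt_mono ht hT
  obtain ⟨F, hF, hFc, hFU⟩ := hc t
  set W := π₁ t Z - π₂ t Z with hW
  have hWt : star W ∈ D.Yt t :=
    star_mem (sub_mem (hD.filter_mem hπ₁ t Z) (hD.filter_mem hπ₂ t Z))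
  have hWnorm : ‖star W‖ ≤ 12 * ‖Z‖ := by
    rw [norm_star]
    linarith [norm_sub_le (π₁ t Z) (π₂ t Z), hD.norm_filter_le hπ₁ t Z,
      hD.norm_filter_le hπ₂ t Z]
  have hπt := hD.filter_mem hπ₂ t Z
  -- The filter π₁ is replaced by j_t(Z) and then by F, under Φ_{ρ₁}, against the past element W*.
  have e1 : D.Φ ρ₁ (star W * W) = D.Φ ρ₁ (star W * F) - D.Φ ρ₁ (star W * π₂ t Z) := by
    conv_lhs => rw [hW]
    rw [mul_sub, map_sub, ← hW, hD.state_mul_filter hπ₁ hWt, hFU ρ₁ _ hWt]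
  -- The same replacement for π₂ under Φ_{ρ₂}; it is allowed against B W* because B lies in the past
  -- once t ≥ T.
  have e2 : D.Φ ρ₂ (B * (star W * π₂ t Z)) = D.Φ ρ₂ (B * (star W * F)) := by
    have hU := mul_mem hBt hWt
    rw [← mul_assoc, hD.state_mul_filter hπ₂ hU, hFU ρ₂ _ hU, mul_assoc]
  have hY₁ := mul_mem (D.Yt_le_Yinf t hWt) hF
  have hY₂ := D.Yt_le_Yinf t (mul_mem hWt hπt)
  have hBinf := D.Yt_le_Yinf t hBt
  have a1 := happrox _ hY₁
  have a2 := happrox _ hY₂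
  rw [← hz₁ _ (hD.Yinf_le_M hY₁), ← hz₂ _ (hD.Yinf_le_M (mul_mem hBinf hY₁))] at a1
  rw [← hz₁ _ (hD.Yinf_le_M hY₂), ← hz₂ _ (hD.Yinf_le_M (mul_mem hBinf hY₂)), e2] at a2
  have e3 : ‖D.Φ ρ₁ (star W * W)‖ = ‖amp W z₁‖ ^ 2 := by
    rw [hz₁ _ (mul_mem (hD.Yt_le_M t hWt) (by simpa using hD.Yt_le_M t (star_mem hWt))),
      inner_amp_star_mul_self, inner_self_eq_norm_sq_to_K]
    simp
  have n1 : ‖star W * F‖ ≤ 12 * ‖Z‖ * c :=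
    (norm_mul_le _ _).trans (mul_le_mul hWnorm hFc (norm_nonneg _) (by positivity))
  have n2 : ‖star W * π₂ t Z‖ ≤ 12 * ‖Z‖ * (6 * ‖Z‖) :=
    (norm_mul_le _ _).trans (mul_le_mul hWnorm (hD.norm_filter_le hπ₂ t Z) (norm_nonneg _)
      (by positivity))
  rw [← e3, e1, ← sub_sub_sub_cancel_right _ _ (D.Φ ρ₂ (B * (star W * F)))]
  exact (norm_sub_le _ _).trans ((add_le_add (a1.trans (mul_le_mul_of_nonneg_left n1 hδ.le))
    (a2.trans (mul_le_mul_of_nonneg_left n2 hδ.le))).trans hδε)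

/-- In an observable model, filters with absolutely continuous observation laws merge. -/
theorem tendsto_state_abs_filter_sub (hD : D.IsModel) (hobs : D.Observable)
    {ρ₁ ρ₂ : stateSpace A} (hac : D.ObsAbsolutelyContinuous ρ₁ ρ₂)
    {π₁ π₂ : ℝ≥0 → A → (H →L[ℂ] H)} (hπ₁ : D.IsFilter ρ₁ π₁) (hπ₂ : D.IsFilter ρ₂ π₂) (X : A) :
    Tendsto (fun t => D.Φ ρ₁ (CFC.abs (π₁ t X - π₂ t X))) atTop (𝓝 0) := by
  obtain ⟨z₁, hz, hz₁⟩ := (hD.normalState ρ₁).exists_vector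
  rw [Metric.tendsto_nhds]
  intro ε hε
  -- The two filters together have norm at most 12 ‖X − Z‖ on X − Z, so ε / 24 leaves half of ε.
  obtain ⟨Z, hZ, hXZ⟩ := hD.exists_observedElement_near hobs X (ε := ε / 24) (by positivity)
  filter_upwards [hD.tendsto_norm_amp_filter_sub_of_mem_observedElements hac hπ₁ hπ₂ hz₁ hZ
    (ε := (ε / 2) ^ 2 / 2) (by positivity)] with t ht
  have h1 : ‖amp (π₁ t Z - π₂ t Z) z₁‖ < ε / 2 :=
    lt_of_pow_lt_pow_left₀ 2 (by positivity)
      (ht.trans_lt (half_lt_self (by positivity)))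
  have hm : π₁ t X - π₂ t X ∈ D.M :=
    hD.Yt_le_M t (sub_mem (hD.filter_mem hπ₁ t X) (hD.filter_mem hπ₂ t X))
  have e : π₁ t X - π₂ t X = (π₁ t Z - π₂ t Z) + (π₁ t (X - Z) - π₂ t (X - Z)) := by
    rw [filter_sub hπ₁, filter_sub hπ₂]
    abel
  have h2 : ‖amp (π₁ t (X - Z) - π₂ t (X - Z)) z₁‖ ≤ 12 * ‖X - Z‖ := by
    have := norm_amp_apply_le (π₁ t (X - Z) - π₂ t (X - Z)) z₁
    rw [hz, mul_one] at this
    linarith [norm_sub_le (π₁ t (X - Z)) (π₂ t (X - Z)), hD.norm_filter_le hπ₁ t (X - Z),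
      hD.norm_filter_le hπ₂ t (X - Z)]
  -- Cauchy-Schwarz with the unit vector z₁ bounds the expectation of |W| by the norm of W z₁.
  rw [dist_zero_right, hz₁ _ (VonNeumannAlgebra.abs_mem hm)]
  refine (norm_inner_le_norm _ _).trans_lt ?_
  rw [hz, one_mul, norm_amp_abs_apply, e, amp_add]
  refine (norm_add_le (amp (π₁ t Z - π₂ t Z) z₁)
    (amp (π₁ t (X - Z) - π₂ t (X - Z)) z₁)).trans_lt ?_
  linarith

end FilteringData.IsModel

theorem mainTheorem1 {A H : Type*} [CStarAlgebra A] [PartialOrder A] [StarOrderedRing A]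
    [NormedAddCommGroup H] [InnerProductSpace ℂ H] [CompleteSpace H] {n : ℕ}
    (D : FilteringData A H n) (hD : D.IsModel) (hobs : D.Observable) :
    (∀ ρ, ∃ π, D.IsFilter ρ π) ∧
    ∀ ρ₁ ρ₂ : stateSpace A, D.ObsAbsolutelyContinuous ρ₁ ρ₂ →
      ∀ π₁ π₂ : ℝ≥0 → A → (H →L[ℂ] H), D.IsFilter ρ₁ π₁ → D.IsFilter ρ₂ π₂ →
        ∀ X : A, Tendsto (fun t => D.Φ ρ₁ (CFC.abs (π₁ t X - π₂ t X))) atTop (𝓝 0) :=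
  ⟨fun ρ => hD.exists_isFilter ρ, fun _ _ hac _ _ hπ₁ hπ₂ X =>
    hD.tendsto_state_abs_filter_sub hobs hac hπ₁ hπ₂ X⟩
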